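/- Let $\alpha>1$, let $L:(0,\infty)\to(0,\infty)$ be slowly varying (measurable, with $L(cx)/L(x)\to1$ as $x\to\infty$ for every $c>0$), and let $K(n)=L(n)n^{-(1+\alpha)}$, $n\ge1$, satisfy $\sum_{n\ge1}K(n)=1$. Let $\tau=\{\tau_0=0,\tau_1,\tau_2,\dots\}$ be the renewal process whose i.i.d. interarrival times have law $K$, put $\delta_k=\mathbf 1_{\{k\in\tau\}}$, and let $E$ be the expectation over $\tau$. Independently of $\tau$, let $\omega=(\omega_n)_{n\in\mathbb Z}$ be a stationary centered Gaussian process of variance $1$ with law $\mathbb P$ (expectation $\mathbb E$), and suppose that for some integer $q\ge1$ the covariances $\rho_n=\operatorname{Cov}(\omega_0,\omega_n)$ vanish for all $n>q$. For $\beta\ge0$ and $h\in\mathbb R$ let $$Z_{n,\beta,h,\omega}=E\Big(\exp\Big(\sum_{k=1}^n(\beta\omega_k+h)\delta_k\Big)\delta_n\Big),\qquad Z^a_{n,\beta,h}=\mathbb E\,Z_{n,\beta,h,\omega},$$ let $F(\beta,h)=\lim_{n\to\infty}\frac1n\log Z_{n,\beta,h,\omega}$ (almost surely and in $L^1(\mathbb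 P)$) and $F^a(\beta,h)=\lim_{n\to\infty}\frac1n\log Z^a_{n,\beta,h}$ be the quenched and annealed free energies, and let $$h_c(\beta)=\sup\{h\in\mathbb R:F(\beta,h)=0\},\qquad h_c^a(\beta)=\sup\{h\in\mathbb R:F^a(\beta,h)=0\}$$ be the quenched and annealed critical points. For every $\beta\ge0$ these are suprema of nonempty sets that are bounded above, and: 1. If $1+2\sum_{k=1}^q\rho_k>0$, then there is $a>0$ such that $h_c(\beta)\ge h_c^a(\beta)+a\beta^2$ for all $\beta\in[0,1]$. 2. $h_c(\beta)>h_c^a(\beta)$ for all $\beta>0$. -/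

import Mathlib

open MeasureTheory ProbabilityTheory Filter Topology

noncomputable section

namespace PinningModel

/-- A slowly varying function: measurable, positive on `(0, ∞)`, and
`L (c x) / L x → 1` as `x → ∞` for every `c > 0`. -/
structure IsSlowlyVarying (L : ℝ → ℝ) : Prop where
  measurable : Measurable L
  pos : ∀ x, 0 < x → 0 < L x
  tendsto_ratio : ∀ c, 0 < c → Tendsto (fun x => L (c * x) / L x) atTop (𝓝 1)

/-- `K` is the law of a recurrent interarrival time, with
`K(n) = L(n) n^{-(1+α)}` for `n ≥ 1`, `L` slowly varying, and `∑_{n ≥ 1} K(n) = 1`. -/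
structure IsInterarrivalLaw (α : ℝ) (L : ℝ → ℝ) (K : ℕ → ℝ) : Prop where
  slowlyVarying : IsSlowlyVarying L
  eq : ∀ n : ℕ, 1 ≤ n → K n = L n * (n : ℝ) ^ (-(1 + α))
  recurrent : HasSum (fun n : ℕ => K (n + 1)) 1

/-- `T 0, T 1, …` are the i.i.d. interarrival times of a renewal process, with common law `K`
(as `K` sums to one over `n ≥ 1`, they are almost surely positive). -/
structure IsInterarrivalSequence {Ω' : Type*} [MeasurableSpace Ω'] (P : Measure Ω')
    (K : ℕ → ℝ) (T : ℕ → Ω' → ℕ) : Prop where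
  measurable : ∀ i, Measurable (T i)
  indep : iIndepFun T P
  law : ∀ i n : ℕ, 1 ≤ n → P.real {x | T i x = n} = K n

/-- The renewal set `τ = {τ_0, τ_1, …}` with `τ_0 = 0` and `τ_{j+1} = τ_j + T_j`. -/
def renewalSet {Ω' : Type*} (T : ℕ → Ω' → ℕ) (x : Ω') : Set ℕ :=
  {m | ∃ j : ℕ, ∑ i ∈ Finset.range j, T i x = m}

open Classical in
/-- `δ_k`, the indicator of the event `k ∈ τ`. -/
def contact {Ω' : Type*} (T : ℕ → Ω' → ℕ) (k : ℕ) (x : Ω') : ℝ :=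
  if k ∈ renewalSet T x then 1 else 0

/-- The disorder: a stationary centered Gaussian process `(ω_n)_{n ∈ ℤ}` of variance one, with
`Cov(ω_i, ω_j) = ρ_{|i - j|}` and `ρ_n = 0` as soon as `n > q`. -/
structure IsFiniteRangeGaussianDisorder {Ω : Type*} [MeasurableSpace Ω] (μ : Measure Ω)
    (q : ℕ) (ρ : ℕ → ℝ) (ω : ℤ → Ω → ℝ) : Prop where
  gaussian : IsGaussianProcess ω μ
  mean_zero : ∀ i, ∫ y, ω i y ∂μ = 0
  covariance_eq : ∀ i j : ℤ, covariance (ω i) (ω j) μ = ρ (i - j).natAbs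
  variance_one : ρ 0 = 1
  finite_range : ∀ n : ℕ, q < n → ρ n = 0

/-- The Hamiltonian `H_n = ∑_{k=1}^n (β ω_k + h) δ_k` for the environment `w`. -/
def hamiltonian {Ω' : Type*} (T : ℕ → Ω' → ℕ) (β h : ℝ) (w : ℤ → ℝ) (n : ℕ) (x : Ω') : ℝ :=
  ∑ k ∈ Finset.Icc 1 n, (β * w k + h) * contact T k x

/-- The quenched partition function `Z_n = E(exp(H_n) δ_n)`, the expectation being over the
renewal process only. -/
def partitionFunction {Ω' : Type*} [MeasurableSpace Ω'] (P : Measure Ω') (T : ℕ → Ω' → ℕ)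
    (β h : ℝ) (w : ℤ → ℝ) (n : ℕ) : ℝ :=
  ∫ x, Real.exp (hamiltonian T β h w n x) * contact T n x ∂P

/-- The annealed partition function, the mean of `Z_n` over the disorder. -/
def annealedPartitionFunction {Ω Ω' : Type*} [MeasurableSpace Ω] [MeasurableSpace Ω']
    (μ : Measure Ω) (P : Measure Ω') (ω : ℤ → Ω → ℝ) (T : ℕ → Ω' → ℕ)
    (β h : ℝ) (n : ℕ) : ℝ :=
  ∫ y, partitionFunction P T β h (fun i => ω i y) n ∂μ

/-- `F(β, h) = f`, that is, `(1/n) log Z_n → f` almost surely and in `L¹` of the disorder. -/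
def HasQuenchedFreeEnergy {Ω Ω' : Type*} [MeasurableSpace Ω] [MeasurableSpace Ω']
    (μ : Measure Ω) (P : Measure Ω') (ω : ℤ → Ω → ℝ) (T : ℕ → Ω' → ℕ)
    (β h f : ℝ) : Prop :=
  (∀ᵐ y ∂μ, Tendsto
    (fun n : ℕ => (1 / (n : ℝ)) * Real.log (partitionFunction P T β h (fun i => ω i y) n))
    atTop (𝓝 f)) ∧
  Tendsto (fun n : ℕ => eLpNorm
    (fun y => (1 / (n : ℝ)) * Real.log (partitionFunction P T β h (fun i => ω i y) n) - f) 1 μ)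
    atTop (𝓝 0)

/-- `F^a(β, h) = f`, that is, `(1/n) log Z^a_n → f`. -/
def HasAnnealedFreeEnergy {Ω Ω' : Type*} [MeasurableSpace Ω] [MeasurableSpace Ω']
    (μ : Measure Ω) (P : Measure Ω') (ω : ℤ → Ω → ℝ) (T : ℕ → Ω' → ℕ)
    (β h f : ℝ) : Prop :=
  Tendsto (fun n : ℕ => (1 / (n : ℝ)) * Real.log (annealedPartitionFunction μ P ω T β h n))
    atTop (𝓝 f)

/-- The set `{h : F(β, h) = 0}`. -/
def quenchedDelocalized {Ω Ω' : Type*} [MeasurableSpace Ω] [MeasurableSpace Ω']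
    (μ : Measure Ω) (P : Measure Ω') (ω : ℤ → Ω → ℝ) (T : ℕ → Ω' → ℕ) (β : ℝ) : Set ℝ :=
  {h | HasQuenchedFreeEnergy μ P ω T β h 0}

/-- The set `{h : F^a(β, h) = 0}`. -/
def annealedDelocalized {Ω Ω' : Type*} [MeasurableSpace Ω] [MeasurableSpace Ω']
    (μ : Measure Ω) (P : Measure Ω') (ω : ℤ → Ω → ℝ) (T : ℕ → Ω' → ℕ) (β : ℝ) : Set ℝ :=
  {h | HasAnnealedFreeEnergy μ P ω T β h 0}

/-- The quenched critical point `h_c(β) = sup {h : F(β, h) = 0}`. -/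
def criticalPoint {Ω Ω' : Type*} [MeasurableSpace Ω] [MeasurableSpace Ω']
    (μ : Measure Ω) (P : Measure Ω') (ω : ℤ → Ω → ℝ) (T : ℕ → Ω' → ℕ) (β : ℝ) : ℝ :=
  sSup (quenchedDelocalized μ P ω T β)

/-- The annealed critical point `h_c^a(β) = sup {h : F^a(β, h) = 0}`. -/
def annealedCriticalPoint {Ω Ω' : Type*} [MeasurableSpace Ω] [MeasurableSpace Ω']
    (μ : Measure Ω) (P : Measure Ω') (ω : ℤ → Ω → ℝ) (T : ℕ → Ω' → ℕ) (β : ℝ) : ℝ :=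
  sSup (annealedDelocalized μ P ω T β)

end PinningModel

end

/-! Averaging over the disorder gives a path with contact set `S` the annealed weight `exp (h |S| +
β² / 2 * energy S)`, where the energy is the variance of the environment summed over `S`.
Correlations have range `q`, so cutting a path in two changes the energy by at most `2 q²`: the
weight is multiplicative up to the factor `C = exp (β² q²)`. Hence the logarithm of the total mass
of paths with `m` gaps is additive in `m` up to a bounded error, so linear up to the same error, and
one value `h₀` of `h` cancels the linear part (`exists_isCriticalWeight`). At `h₀` every level has
mass between `1 / C` and `C`. Then the annealed partition functions are at most `C ^ 3`
(`gapSum_endpoint_le`), while for `h > h₀` they grow exponentially (`exists_discount`). So `h₀` is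
the annealed critical point.

A uniform bound on `𝔼 Z_n ^ γ`, for some `γ > 0`, forces the quenched free energy to vanish
(`hasQuenchedFreeEnergy_of_lintegral_rpow_le`). With `γ = 1` this gives `h_c ≥ h₀`. To go beyond
`h₀`, use `γ < 1` such that `∑ n K(n) ^ γ` converges, which exists because `α > 1`. Decomposing a
path around a window of `q` sites and decoupling the two sides by a Cameron–Martin shift reduces the
bound on all scales to the smallness of a weighted sum of the fractional moments of sizes `j < k`
(`fracMoment_le_of_criterion`).

Take `h = h₀ + 1 / k`. For `j < k` the annealed partition functions exceed those at `h₀` by a factor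
at most `e`, so they stay bounded; sizes far from `k` are paid for by the tail of `K ^ γ`. For `j`
near `k`, Hölder's inequality makes the fractional moment small as soon as some event is unlikely
for the disorder but likely after the mean shift produced by the contacts of a typical path
(`fracMoment_le_of_event`, `exists_scale`). Typical paths have a positive density of contacts, since
the gaps have finite mean (`exists_density`).

If `σ = 1 + 2 ∑ ρ_k > 0`, the event is that the sum of the environment is large: contacts raise it
by about `β σ j`, against fluctuations of order `√j`, so `k` of order `β⁻²` suffices
(`exists_quadratic_gap`). If `σ` may vanish, the sum of squares of the environment replaces the sum.
The shift raises it by the squared norm of the shift, which by Cauchy–Schwarz is at least `β²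
energy² / |S|`. The energy is proportional to `|S|` for most paths because `h₀ < 0`: a path of small
energy has weight at most `exp (h₀ |S| / 2)`. Negativity of `h₀` comes from isolated contacts, which
contribute a positive density of energy (`IsCriticalWeight.neg`, `exists_gap`). -/

noncomputable section

set_option linter.unusedSectionVars false

namespace PinningModel

open scoped ENNReal NNReal

/-! ### The Gaussian environment -/

/-- A law of environments on `ℤ → ℝ` whose coordinate process is a finite range Gaussian
disorder. -/
abbrev IsDisorderLaw (ν : Measure (ℤ → ℝ)) (q : ℕ) (ρ : ℕ → ℝ) : Prop :=
  IsFiniteRangeGaussianDisorder ν q ρ (fun i w => w i)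

/-- Completing the square: `exp x` times the density of `N(0, v)` is `exp (v / 2)` times the density
of `N(v, v)`. This is the one-dimensional case of the Cameron–Martin formula below. -/
lemma lintegral_gaussianReal_exp_mul (v : ℝ≥0) {g : ℝ → ℝ≥0∞} (hg : Measurable g) :
    ∫⁻ x, ENNReal.ofReal (Real.exp x) * g x ∂(gaussianReal 0 v) =
      ENNReal.ofReal (Real.exp (v / 2)) * ∫⁻ x, g (x + v) ∂(gaussianReal 0 v) := by
  have hmap : ∫⁻ x, g (x + v) ∂(gaussianReal 0 v) = ∫⁻ x, g x ∂(gaussianReal v v) := by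
    have h := gaussianReal_map_add_const (μ := 0) (v := v) (v : ℝ)
    rw [zero_add] at h
    rw [← h, lintegral_map hg (by fun_prop)]
  rw [hmap]
  by_cases hv : v = 0
  · subst hv
    simp
  rw [gaussianReal_of_var_ne_zero _ hv, gaussianReal_of_var_ne_zero _ hv,
    lintegral_withDensity_eq_lintegral_mul _ (measurable_gaussianPDF _ _) (by fun_prop),
    lintegral_withDensity_eq_lintegral_mul _ (measurable_gaussianPDF _ _) hg,
    ← lintegral_const_mul _ ((measurable_gaussianPDF _ _).mul hg)]
  congr 1 with x
  simp only [Pi.mul_apply, gaussianPDF, gaussianPDFReal]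
  rw [← mul_assoc, ← mul_assoc, ← ENNReal.ofReal_mul (by positivity),
    ← ENNReal.ofReal_mul (by positivity)]
  congr 2
  have hv' : (v : ℝ) ≠ 0 := by exact_mod_cast hv
  rw [mul_assoc, mul_left_comm (Real.exp _), ← Real.exp_add, ← Real.exp_add]
  congr 2
  field_simp
  ring

/-- The linear combination `∑_{i ∈ S} c_i w_{p i}` of the environment. -/
def linComb {ι : Type*} (S : Finset ι) (c : ι → ℝ) (p : ι → ℤ) (w : ℤ → ℝ) : ℝ :=
  ∑ i ∈ S, c i * w (p i)

/-- The covariance of `linComb S c p` with the `j`-th coordinate. -/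
def meanShift (ρ : ℕ → ℝ) {ι : Type*} (S : Finset ι) (c : ι → ℝ) (p : ι → ℤ) (j : ℤ) : ℝ :=
  ∑ i ∈ S, c i * ρ (p i - j).natAbs

/-- The variance of `linComb S c p`. -/
def combVariance (ρ : ℕ → ℝ) {ι : Type*} (S : Finset ι) (c : ι → ℝ) (p : ι → ℤ) : ℝ :=
  ∑ j ∈ S, c j * meanShift ρ S c p (p j)

@[fun_prop]
lemma measurable_linComb {ι : Type*} (S : Finset ι) (c : ι → ℝ) (p : ι → ℤ) :
    Measurable (linComb S c p) := by
  unfold linComb; fun_prop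

namespace IsFiniteRangeGaussianDisorder

variable {ν : Measure (ℤ → ℝ)} {q : ℕ} {ρ : ℕ → ℝ} {ι : Type*}

lemma isProbabilityMeasure (hν : IsDisorderLaw ν q ρ) : IsProbabilityMeasure ν :=
  hν.gaussian.isProbabilityMeasure

lemma memLp_eval (hν : IsDisorderLaw ν q ρ) (i : ℤ) {r : ℝ≥0∞} (hr : r ≠ ∞) :
    MemLp (fun w : ℤ → ℝ => w i) r ν :=
  (hν.gaussian.hasGaussianLaw_eval i).memLp hr

lemma memLp_linComb (hν : IsDisorderLaw ν q ρ) (S : Finset ι) (c : ι → ℝ) (p : ι → ℤ)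
    {r : ℝ≥0∞} (hr : r ≠ ∞) : MemLp (linComb S c p) r ν :=
  memLp_finsetSum _ fun i _ => (hν.memLp_eval (p i) hr).const_mul (c i)

lemma integral_linComb (hν : IsDisorderLaw ν q ρ) (S : Finset ι) (c : ι → ℝ) (p : ι → ℤ) :
    ∫ w, linComb S c p w ∂ν = 0 := by
  have := hν.isProbabilityMeasure
  unfold linComb
  rw [integral_finsetSum _ fun i _ => ((hν.memLp_eval (p i) ENNReal.ofNat_ne_top).integrable
    (q := 2) (by norm_num)).const_mul (c i)]
  refine Finset.sum_eq_zero fun i _ => ?_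
  rw [integral_const_mul, hν.mean_zero, mul_zero]

lemma covariance_linComb_eval (hν : IsDisorderLaw ν q ρ) (S : Finset ι) (c : ι → ℝ)
    (p : ι → ℤ) (j : ℤ) :
    covariance (linComb S c p) (fun w => w j) ν = meanShift ρ S c p j := by
  have := hν.isProbabilityMeasure
  have : linComb S c p = ∑ i ∈ S, fun w : ℤ → ℝ => c i * w (p i) := by
    ext w; simp [linComb]
  rw [this, covariance_sum_left' (fun i _ => (hν.memLp_eval (p i) ENNReal.ofNat_ne_top).const_mul
    (c i)) (hν.memLp_eval j ENNReal.ofNat_ne_top)]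
  refine Finset.sum_congr rfl fun i _ => ?_
  rw [covariance_const_mul_left, hν.covariance_eq]

lemma variance_linComb (hν : IsDisorderLaw ν q ρ) (S : Finset ι) (c : ι → ℝ) (p : ι → ℤ) :
    variance (linComb S c p) ν = combVariance ρ S c p := by
  have := hν.isProbabilityMeasure
  rw [← covariance_self (by fun_prop)]
  have : linComb S c p = ∑ i ∈ S, fun w : ℤ → ℝ => c i * w (p i) := by
    ext w; simp [linComb]
  nth_rewrite 2 [this]
  rw [covariance_sum_right' (fun i _ => (hν.memLp_eval (p i) ENNReal.ofNat_ne_top).const_mul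
    (c i)) (hν.memLp_linComb S c p ENNReal.ofNat_ne_top)]
  refine Finset.sum_congr rfl fun i _ => ?_
  rw [covariance_const_mul_right, hν.covariance_linComb_eval]

lemma combVariance_nonneg (hν : IsDisorderLaw ν q ρ) (S : Finset ι) (c : ι → ℝ) (p : ι → ℤ) :
    0 ≤ combVariance ρ S c p := by
  rw [← hν.variance_linComb]; exact variance_nonneg _ _

/-- The variances `2 ± 2 ρ n` of `ω_0 ± ω_n` are nonnegative. -/
lemma abs_rho_le_one (hν : IsDisorderLaw ν q ρ) (n : ℕ) : |ρ n| ≤ 1 := by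
  have h1 := hν.combVariance_nonneg (Finset.univ : Finset (Fin 2)) ![1, 1] ![0, n]
  have h2 := hν.combVariance_nonneg (Finset.univ : Finset (Fin 2)) ![1, -1] ![0, n]
  simp [combVariance, meanShift, hν.variance_one] at h1 h2
  rw [abs_le]; constructor <;> linarith

lemma abs_meanShift_le (hν : IsDisorderLaw ν q ρ) (S : Finset ι) (c : ι → ℝ) (p : ι → ℤ)
    (j : ℤ) : |meanShift ρ S c p j| ≤ ∑ i ∈ S, |c i| := by
  refine (Finset.abs_sum_le_sum_abs _ _).trans (Finset.sum_le_sum fun i _ => ?_)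
  rw [abs_mul]
  exact mul_le_of_le_one_right (abs_nonneg _) (hν.abs_rho_le_one _)

lemma hasGaussianLaw_linComb (hν : IsDisorderLaw ν q ρ) (S : Finset ι) (c : ι → ℝ)
    (p : ι → ℤ) : HasGaussianLaw (linComb S c p) ν := by
  have h := ((hν.gaussian.comp_right p).smul c).hasGaussianLaw_fun_sum (I := S)
  exact h

lemma map_linComb (hν : IsDisorderLaw ν q ρ) (S : Finset ι) (c : ι → ℝ) (p : ι → ℤ) :
    ν.map (linComb S c p) = gaussianReal 0 (combVariance ρ S c p).toNNReal := by
  rw [(hν.hasGaussianLaw_linComb S c p).map_eq_gaussianReal, hν.integral_linComb,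
    hν.variance_linComb]

/-- The Cameron–Martin formula: tilting by a linear functional of the environment shifts it by
the covariances. -/
theorem lintegral_exp_linComb_mul (hν : IsDisorderLaw ν q ρ) (S : Finset ι) (c : ι → ℝ)
    (p : ι → ℤ) {F : (ℤ → ℝ) → ℝ≥0∞} (hF : Measurable F) :
    ∫⁻ w, ENNReal.ofReal (Real.exp (linComb S c p w)) * F w ∂ν =
      ENNReal.ofReal (Real.exp (combVariance ρ S c p / 2)) *
        ∫⁻ w, F (w + meanShift ρ S c p) ∂ν := by
  have := hν.isProbabilityMeasure
  set X := linComb S c p with hX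
  set v := combVariance ρ S c p with hv
  set s := meanShift ρ S c p with hs
  have hXm : Measurable X := measurable_linComb S c p
  have hv0 : 0 ≤ v := hν.combVariance_nonneg S c p
  have hX2 : MemLp X 2 ν := hν.memLp_linComb S c p ENNReal.ofNat_ne_top
  -- In the degenerate case the linear combination vanishes almost surely, so all its covariances
  -- vanish and there is nothing to shift.
  rcases hv0.eq_or_lt with hv1 | hv1
  · have hX0 : X =ᵐ[ν] 0 := by
      have h := ae_eq_integral_of_variance_eq_zero hX2
        (by rw [hX, hν.variance_linComb, ← hv, ← hv1])
      filter_upwards [h] with w hw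
      rw [hw, hX, hν.integral_linComb]; rfl
    have hs0 : s = 0 := by
      ext j
      rw [hs, ← hν.covariance_linComb_eval, ← hX]
      rw [covariance, hX, hν.integral_linComb]
      refine (integral_congr_ae (g := 0) ?_).trans (by simp)
      filter_upwards [hX0] with w hw
      simp [← hX, hw]
    rw [hs0, ← hv1]
    simp only [zero_div, Real.exp_zero, ENNReal.ofReal_one, one_mul, add_zero]
    refine lintegral_congr_ae ?_
    filter_upwards [hX0] with w hw
    simp [hw]
  -- Regression on `X`: the residuals `W j` are jointly Gaussian with `X` and uncorrelated with it,
  -- hence independent of it. The tilt therefore acts on `X` alone, and replacing `X` by `X + v`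
  -- moves the coordinate `j` by `s j`.
  · set W : ℤ → (ℤ → ℝ) → ℝ := fun j w => w j - s j / v * X w with hW
    have hWm : ∀ j, Measurable (W j) := fun j => by fun_prop
    have hindep : IndepFun (fun w (_ : Unit) => X w) (fun w j => W j w) ν := by
      refine IsGaussianProcess.indepFun_of_covariance_eq_zero (X := fun _ : Unit => X)
        (Y := W) ?_ (fun _ => hXm.aemeasurable) (fun j => (hWm j).aemeasurable) ?_
      · classical
        refine hν.gaussian.of_isGaussianProcess fun t => ?_
        rcases t with t | j
        · refine ⟨S.image p, ∑ i : S, c i • ContinuousLinearMap.proj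
            ⟨p i, Finset.mem_image_of_mem _ i.2⟩, fun w => ?_⟩
          simp [hX, linComb, ← Finset.sum_coe_sort S]
        · refine ⟨insert j (S.image p), ContinuousLinearMap.proj ⟨j, by simp⟩ -
            (s j / v) • ∑ i : S, c i • ContinuousLinearMap.proj
            ⟨p i, Finset.mem_insert_of_mem (Finset.mem_image_of_mem _ i.2)⟩, fun w => ?_⟩
          simp [hX, hW, linComb, ← Finset.sum_coe_sort S]
      · intro _ j
        simp only [hW]
        rw [covariance_fun_sub_right hX2 (hν.memLp_eval j ENNReal.ofNat_ne_top)
          (hX2.const_mul _), covariance_const_mul_right, covariance_self hXm.aemeasurable, hX,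
          hν.covariance_linComb_eval, hν.variance_linComb, ← hv, ← hs]
        field_simp
        simp
    have hindep' : IndepFun X (fun w j => W j w) ν :=
      hindep.comp (φ := fun f : Unit → ℝ => f ()) (ψ := id) (by fun_prop) measurable_id
    have hWm' : Measurable (fun w j => W j w) := measurable_pi_lambda _ hWm
    have hprod := (indepFun_iff_map_prod_eq_prod_map_map hXm.aemeasurable
      hWm'.aemeasurable).1 hindep'
    have hlaw : ν.map X = gaussianReal 0 v.toNNReal := hν.map_linComb S c p
    have hcoe : ((v.toNNReal : ℝ≥0) : ℝ) = v := Real.coe_toNNReal _ hv0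
    have key : ∀ Φ : ℝ × (ℤ → ℝ) → ℝ≥0∞, Measurable Φ →
        ∫⁻ w, Φ (X w, fun j => W j w) ∂ν =
          ∫⁻ y, ∫⁻ x, Φ (x, y) ∂(gaussianReal 0 v.toNNReal) ∂(ν.map fun w j => W j w) := by
      intro Φ hΦ
      rw [← lintegral_map (f := Φ) (g := fun w => (X w, fun j => W j w)) hΦ
        (hXm.prodMk hWm'), hprod, lintegral_prod_symm _ hΦ.aemeasurable, hlaw]
    have hrec : ∀ w : ℤ → ℝ, (fun j => W j w + s j / v * X w) = w := by
      intro w; ext j; simp [hW]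
    have h1 := key (fun z => ENNReal.ofReal (Real.exp z.1) * F (fun j => z.2 j + s j / v * z.1))
      (by
        refine (by fun_prop : Measurable fun z : ℝ × (ℤ → ℝ) =>
          ENNReal.ofReal (Real.exp z.1)).mul (hF.comp ?_)
        exact measurable_pi_lambda _ fun j => by fun_prop)
    have h2 := key (fun z => F (fun j => z.2 j + s j / v * (z.1 + v)))
      (hF.comp (measurable_pi_lambda _ fun j => by fun_prop))
    simp only [hrec] at h1
    have h2' : ∀ w : ℤ → ℝ, (fun j => W j w + s j / v * (X w + v)) = w + s := by
      intro w; ext j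
      simp only [hW, Pi.add_apply]
      field_simp
      ring
    simp only [h2'] at h2
    rw [h1, h2, ← lintegral_const_mul _ (by
      refine Measurable.lintegral_prod_left' (f := fun z : ℝ × (ℤ → ℝ) =>
        F (fun j => z.2 j + s j / v * (z.1 + v))) ?_
      exact hF.comp (measurable_pi_lambda _ fun j => by fun_prop))]
    refine lintegral_congr fun y => ?_
    have := lintegral_gaussianReal_exp_mul v.toNNReal (g := fun x => F (fun j => y j + s j / v * x))
      (hF.comp (measurable_pi_lambda _ fun j => by fun_prop))
    rw [this, hcoe]

/-- Stationarity of the environment. -/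
theorem map_translate (hν : IsDisorderLaw ν q ρ) (a : ℤ) :
    ν.map (fun w i => w (a + i)) = ν := by
  have := hν.isProbabilityMeasure
  have hm : Measurable (fun (w : ℤ → ℝ) (i : ℤ) => w (a + i)) :=
    measurable_pi_lambda _ fun i => measurable_pi_apply _
  have : IsProbabilityMeasure (ν.map fun w i => w (a + i)) :=
    Measure.isProbabilityMeasure_map hm.aemeasurable
  refine IsProjectiveLimit.unique (P := fun I : Finset ℤ => ν.map I.restrict) (fun I => ?_)
    (fun I => rfl)
  have hI : Measurable (I.restrict (π := fun _ : ℤ => ℝ)) := by fun_prop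
  rw [Measure.map_map hI hm]
  -- A Gaussian law is determined by the mean and variance of every linear functional. These are
  -- linear combinations of coordinates, whose variance depends only on differences of positions.
  refine Measure.ext_of_charFunDual ?_
  ext Λ
  have h1 : HasGaussianLaw (fun w : ℤ → ℝ => I.restrict w) ν := hν.gaussian.hasGaussianLaw I
  have h2 : HasGaussianLaw (I.restrict ∘ fun (w : ℤ → ℝ) (i : ℤ) => w (a + i)) ν :=
    (hν.gaussian.comp_right (fun i => a + i)).hasGaussianLaw I
  rw [h1.charFunDual_map_eq Λ, h2.charFunDual_map_eq Λ]
  have e : ∀ x : I → ℝ, Λ x = ∑ i : I, Λ (Pi.single i 1) * x i := by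
    intro x
    classical
    conv_lhs => rw [← Finset.univ_sum_single x]
    rw [map_sum]
    refine Finset.sum_congr rfl fun i _ => ?_
    rw [mul_comm, ← smul_eq_mul, ← map_smul]
    congr 1
    ext j; simp [Pi.single_apply]
  have e1 : (Λ ∘ fun w : ℤ → ℝ => I.restrict w) =
      linComb (Finset.univ : Finset I) (fun i => Λ (Pi.single i 1)) (fun i => i) := by
    ext w; rw [Function.comp_apply, e]; rfl
  have e2 : (Λ ∘ (I.restrict ∘ fun (w : ℤ → ℝ) (i : ℤ) => w (a + i))) =
      linComb (Finset.univ : Finset I) (fun i => Λ (Pi.single i 1)) (fun i => a + i) := by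
    ext w; rw [Function.comp_apply, e]; rfl
  rw [e1, e2, hν.integral_linComb, hν.integral_linComb, hν.variance_linComb,
    hν.variance_linComb]
  simp [combVariance, meanShift]

/-- Independence of the past and of the future beyond the range. -/
theorem lintegral_mul_of_gap (hν : IsDisorderLaw ν q ρ) {A B : Set ℤ}
    (hAB : ∀ i ∈ A, ∀ j ∈ B, q < (i - j).natAbs) {F G : (ℤ → ℝ) → ℝ≥0∞} (hF : Measurable F)
    (hG : Measurable G) (hFA : ∀ w w' : ℤ → ℝ, (∀ i ∈ A, w i = w' i) → F w = F w')
    (hGB : ∀ w w' : ℤ → ℝ, (∀ i ∈ B, w i = w' i) → G w = G w') :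
    ∫⁻ w, F w * G w ∂ν = (∫⁻ w, F w ∂ν) * ∫⁻ w, G w ∂ν := by
  classical
  have hind : IndepFun (fun (w : ℤ → ℝ) (i : A) => w i) (fun (w : ℤ → ℝ) (i : B) => w i) ν := by
    refine IsGaussianProcess.indepFun_of_covariance_eq_zero
      (X := fun (i : A) (w : ℤ → ℝ) => w i) (Y := fun (i : B) (w : ℤ → ℝ) => w i) ?_
      (fun i => (measurable_pi_apply _).aemeasurable)
      (fun i => (measurable_pi_apply _).aemeasurable) ?_
    · have := hν.gaussian.comp_right (Sum.elim (fun i : A => (i : ℤ)) (fun i : B => (i : ℤ)))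
      have e : (Sum.elim (fun (i : A) (w : ℤ → ℝ) => w i) fun (i : B) (w : ℤ → ℝ) => w i) =
          (fun (i : ℤ) (w : ℤ → ℝ) => w i) ∘
            Sum.elim (fun i : A => (i : ℤ)) (fun i : B => (i : ℤ)) := by
        ext t w
        rcases t with t | t <;> rfl
      rw [e]
      exact this
    · intro i j
      rw [hν.covariance_eq, hν.finite_range _ (hAB i i.2 j j.2)]
  -- Extension by zero. The value off `A` is irrelevant to `F`, so `F` factors through the
  -- restriction to `A`; likewise for `G` and `B`.
  let eA : (A → ℝ) → ℤ → ℝ := fun x i => if h : i ∈ A then x ⟨i, h⟩ else 0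
  let eB : (B → ℝ) → ℤ → ℝ := fun x i => if h : i ∈ B then x ⟨i, h⟩ else 0
  have heA : Measurable eA := measurable_pi_lambda _ fun i => by
    by_cases h : i ∈ A
    · simp only [eA, h, dif_pos]; fun_prop
    · simp [eA, h]
  have heB : Measurable eB := measurable_pi_lambda _ fun i => by
    by_cases h : i ∈ B
    · simp only [eB, h, dif_pos]; fun_prop
    · simp [eB, h]
  have h := hind.comp (hF.comp heA) (hG.comp heB)
  have hF' : ((F ∘ eA) ∘ fun (w : ℤ → ℝ) (i : A) => w i) = F := by
    ext w
    refine hFA _ _ fun i hi => ?_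
    simp [eA, hi]
  have hG' : ((G ∘ eB) ∘ fun (w : ℤ → ℝ) (i : B) => w i) = G := by
    ext w
    refine hGB _ _ fun i hi => ?_
    simp [eB, hi]
  rw [hF', hG'] at h
  exact lintegral_mul_eq_lintegral_mul_lintegral_of_indepFun'' hF.aemeasurable hG.aemeasurable h


/-- Pairs at distance at most `q`: the diagonal dominates. -/
lemma sum_sum_le_of_finite_range {q : ℕ} (S : Finset ℤ) (C : ℤ → ℤ → ℝ) (V : ℤ → ℝ)
    (hV : ∀ i, 0 ≤ V i) (h0 : ∀ i j, q < (i - j).natAbs → C i j = 0)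
    (h1 : ∀ i j, C i j ≤ (V i + V j) / 2) :
    ∑ i ∈ S, ∑ j ∈ S, C i j ≤ (2 * q + 1) * ∑ i ∈ S, V i := by
  classical
  have hcount : ∀ i : ℤ, ∑ j ∈ S, (if (i - j).natAbs ≤ q then (1 : ℝ) else 0) ≤ 2 * q + 1 := by
    intro i
    rw [Finset.sum_boole]
    have : (S.filter fun j => (i - j).natAbs ≤ q) ⊆ Finset.Icc (i - q) (i + q) := by
      intro j hj
      rw [Finset.mem_filter] at hj
      rw [Finset.mem_Icc]
      omega
    have h := Finset.card_le_card this
    rw [Int.card_Icc] at h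
    have h2 : (S.filter fun j => (i - j).natAbs ≤ q).card ≤ 2 * q + 1 := by omega
    exact_mod_cast h2
  have hle : ∀ i j, C i j ≤ (if (i - j).natAbs ≤ q then (V i + V j) / 2 else 0) := by
    intro i j
    split_ifs with h
    · exact h1 i j
    · exact (h0 i j (by omega)).le
  calc ∑ i ∈ S, ∑ j ∈ S, C i j
      ≤ ∑ i ∈ S, ∑ j ∈ S, (if (i - j).natAbs ≤ q then (V i + V j) / 2 else 0) :=
        Finset.sum_le_sum fun i _ => Finset.sum_le_sum fun j _ => hle i j
    _ = (∑ i ∈ S, ∑ j ∈ S, (if (i - j).natAbs ≤ q then (1 : ℝ) else 0) * (V i / 2)) +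
        ∑ i ∈ S, ∑ j ∈ S, (if (j - i).natAbs ≤ q then (1 : ℝ) else 0) * (V j / 2) := by
        rw [← Finset.sum_add_distrib]
        refine Finset.sum_congr rfl fun i _ => ?_
        rw [← Finset.sum_add_distrib]
        refine Finset.sum_congr rfl fun j _ => ?_
        rw [show (j - i).natAbs = (i - j).natAbs by omega]
        split_ifs <;> ring
    _ = ∑ i ∈ S, (∑ j ∈ S, (if (i - j).natAbs ≤ q then (1 : ℝ) else 0)) * V i := by
        rw [Finset.sum_comm (f := fun i j => (if (j - i).natAbs ≤ q then (1 : ℝ) else 0) *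
          (V j / 2)), ← Finset.sum_add_distrib]
        refine Finset.sum_congr rfl fun i _ => ?_
        rw [← Finset.sum_mul]
        ring
    _ ≤ (2 * q + 1) * ∑ i ∈ S, V i := by
        rw [Finset.mul_sum]
        exact Finset.sum_le_sum fun i _ => mul_le_mul_of_nonneg_right (hcount i) (hV i)

lemma combVariance_le (hν : IsDisorderLaw ν q ρ) (S : Finset ℤ) (c : ℤ → ℝ) :
    combVariance ρ S c id ≤ (2 * q + 1) * ∑ i ∈ S, c i ^ 2 := by
  have := sum_sum_le_of_finite_range (q := q) S (fun j i => c j * (c i * ρ (i - j).natAbs))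
    (fun i => c i ^ 2) (fun i => sq_nonneg _) (fun i j hij => by
      rw [hν.finite_range _ (by omega)]; ring) (fun i j => by
      have h := abs_le.1 (hν.abs_rho_le_one (j - i).natAbs)
      nlinarith [mul_nonneg (sq_nonneg (c i - c j)) (by linarith : 0 ≤ 1 + ρ (j - i).natAbs),
        mul_nonneg (sq_nonneg (c i + c j)) (by linarith : 0 ≤ 1 - ρ (j - i).natAbs)])
  simpa [combVariance, meanShift, Finset.mul_sum] using this

/-- Chebyshev's inequality for linear statistics of the environment. -/
lemma measure_le_abs_linComb (hν : IsDisorderLaw ν q ρ) (S : Finset ℤ) (c : ℤ → ℝ) {t : ℝ}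
    (ht : 0 < t) :
    ν {w | t ≤ |linComb S c id w|} ≤
      ENNReal.ofReal ((2 * q + 1) * (∑ i ∈ S, c i ^ 2) / t ^ 2) := by
  have := hν.isProbabilityMeasure
  have h := meas_ge_le_variance_div_sq
    (hν.memLp_linComb S c id (r := 2) ENNReal.ofNat_ne_top) ht
  rw [hν.integral_linComb, hν.variance_linComb] at h
  simp only [sub_zero] at h
  refine h.trans (ENNReal.ofReal_le_ofReal ?_)
  gcongr
  exact hν.combVariance_le S c

lemma identDistrib_eval (hν : IsDisorderLaw ν q ρ) (i : ℤ) :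
    IdentDistrib (fun w : ℤ → ℝ => w i) (fun w : ℤ → ℝ => w 0) ν ν where
  aemeasurable_fst := (measurable_pi_apply i).aemeasurable
  aemeasurable_snd := (measurable_pi_apply 0).aemeasurable
  map_eq := by
    conv_rhs => rw [← hν.map_translate i, Measure.map_map (by fun_prop) (by fun_prop)]
    congr 1
    ext w
    simp

lemma integral_sq (hν : IsDisorderLaw ν q ρ) (i : ℤ) : ∫ w, w i ^ 2 ∂ν = 1 := by
  have h := hν.covariance_eq i i
  rw [covariance_self (measurable_pi_apply i).aemeasurable,
    variance_eq_integral (measurable_pi_apply i).aemeasurable, hν.mean_zero] at h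
  simpa [hν.variance_one] using h

lemma memLp_sq (hν : IsDisorderLaw ν q ρ) (i : ℤ) : MemLp (fun w : ℤ → ℝ => w i ^ 2) 2 ν := by
  have := hν.isProbabilityMeasure
  have h := hν.memLp_eval i (r := 4) ENNReal.ofNat_ne_top
  have h2 := MemLp.mul (r := 2) h h (hpqr := ⟨by
    have : (4 : ℝ≥0∞) = 2 * 2 := by norm_num
    rw [this, ENNReal.mul_inv (by simp) (by simp), ← mul_add, ENNReal.inv_two_add_inv_two,
      mul_one]⟩)
  refine h2.congr_norm ((measurable_pi_apply i).pow_const 2).aestronglyMeasurable ?_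
  exact Eventually.of_forall fun w => by simp [sq]

/-- Chebyshev's inequality for the empirical second moment of the environment. -/
lemma exists_measure_le_abs_sum_sq (hν : IsDisorderLaw ν q ρ) :
    ∃ D : ℝ, 0 ≤ D ∧ ∀ (S : Finset ℤ) (t : ℝ), 0 < t →
      ν {w | t ≤ |(∑ i ∈ S, w i ^ 2) - S.card|} ≤ ENNReal.ofReal (D * S.card / t ^ 2) := by
  have := hν.isProbabilityMeasure
  set v := variance (fun w : ℤ → ℝ => w 0 ^ 2) ν with hv
  refine ⟨(2 * q + 1) * v, mul_nonneg (by positivity) (variance_nonneg _ _), fun S t ht => ?_⟩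
  have hL : MemLp (fun w : ℤ → ℝ => ∑ i ∈ S, w i ^ 2) 2 ν :=
    memLp_finsetSum _ fun i _ => hν.memLp_sq i
  have h := meas_ge_le_variance_div_sq hL ht
  have hint : ∫ w : ℤ → ℝ, ∑ i ∈ S, w i ^ 2 ∂ν = S.card := by
    rw [integral_finsetSum _ fun i _ => (hν.memLp_sq i).integrable (by norm_num)]
    simp [hν.integral_sq]
  rw [hint] at h
  refine h.trans (ENNReal.ofReal_le_ofReal ?_)
  have hvi : ∀ i : ℤ, variance (fun w : ℤ → ℝ => w i ^ 2) ν = v := fun i =>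
    ((hν.identDistrib_eval i).comp (u := fun x => x ^ 2) (by fun_prop)).variance_eq
  have e : (fun w : ℤ → ℝ => ∑ i ∈ S, w i ^ 2) = ∑ i ∈ S, fun w : ℤ → ℝ => w i ^ 2 := by
    ext w; simp
  rw [e, variance_sum' fun i _ => hν.memLp_sq i]
  -- Beyond the range two coordinates are uncorrelated Gaussians, hence independent, and so are
  -- their squares. At any distance the covariance of two squares is at most their common variance
  -- `v`, because the variance of their difference is nonnegative.
  have hb := sum_sum_le_of_finite_range (q := q) S
    (fun i j => covariance (fun w : ℤ → ℝ => w i ^ 2) (fun w => w j ^ 2) ν) (fun _ => v)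
    (fun _ => variance_nonneg _ _) (fun i j hij => ?_) (fun i j => ?_)
  · gcongr
    refine hb.trans (le_of_eq ?_)
    simp
    ring
  · have hG : HasGaussianLaw (fun w : ℤ → ℝ => (w i, w j)) ν := hν.gaussian.hasGaussianLaw_prodMk
    have hI := hG.indepFun_of_covariance_eq_zero (by
      rw [hν.covariance_eq, hν.finite_range _ hij])
    exact (hI.comp (φ := fun x => x ^ 2) (ψ := fun x => x ^ 2) (by fun_prop)
      (by fun_prop)).covariance_eq_zero (hν.memLp_sq i) (hν.memLp_sq j)
  · have h1 := variance_nonneg ((fun w : ℤ → ℝ => w i ^ 2) - fun w => w j ^ 2) ν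
    rw [variance_sub (hν.memLp_sq i) (hν.memLp_sq j), hvi, hvi] at h1
    linarith

end IsFiniteRangeGaussianDisorder

/-! ### Slowly varying functions and the interarrival law -/

/-- A measurable function whose increments over each fixed distance vanish at infinity has
increments over bounded distances that are bounded near infinity. -/
theorem exists_abs_increment_le_two {f : ℝ → ℝ} (hf : Measurable f)
    (h : ∀ u, Tendsto (fun x => f (x + u) - f x) atTop (𝓝 0)) :
    ∃ X : ℝ, ∀ x, X ≤ x → ∀ u, 0 ≤ u → u ≤ 1 → |f (x + u) - f x| ≤ 2 := by
  by_contra! hcon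
  choose x hx u hu0 hu1 hxu using fun n : ℕ => hcon n
  have hxt : Tendsto x atTop atTop := tendsto_atTop_mono hx tendsto_natCast_atTop_atTop
  -- By continuity of the measure from below, for most `v` in `[0, 2]` the increment of `f` over the
  -- distance `v` is below one from all late points of the sequence. This is used from the points `x
  -- n` and from the points `x n + u n`.
  have hmeas : ∀ y : ℕ → ℝ, Tendsto y atTop atTop →
      Tendsto (fun n : ℕ => volume {v ∈ Set.Icc (0 : ℝ) 2 | ∀ k, n ≤ k →
        |f (y k + v) - f (y k)| < 1}) atTop (𝓝 2) := by
    intro y hy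
    have hmono : Monotone fun n : ℕ => {v ∈ Set.Icc (0 : ℝ) 2 | ∀ k, n ≤ k →
        |f (y k + v) - f (y k)| < 1} := fun n m hnm v hv =>
      ⟨hv.1, fun k hk => hv.2 k (hnm.trans hk)⟩
    have ht := tendsto_measure_iUnion_atTop (μ := volume) hmono
    have hU : (⋃ n : ℕ, {v ∈ Set.Icc (0 : ℝ) 2 | ∀ k, n ≤ k →
        |f (y k + v) - f (y k)| < 1}) = Set.Icc 0 2 := by
      ext v
      simp only [Set.mem_iUnion, Set.mem_ofPred_eq]
      refine ⟨fun ⟨n, hn⟩ => hn.1, fun hv => ?_⟩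
      have h1 := ((h v).comp hy).eventually (Metric.ball_mem_nhds 0 one_pos)
      obtain ⟨n, hn⟩ := eventually_atTop.1 h1
      exact ⟨n, hv, fun k hk => by simpa using hn k hk⟩
    rw [hU] at ht
    simpa [Function.comp_def] using ht
  have hV := hmeas x hxt
  have hW := hmeas (fun n => x n + u n) (tendsto_atTop_mono (fun n => by linarith [hu0 n]) hxt)
  have h32 : (3 / 2 : ℝ≥0∞) < 2 := by
    rw [ENNReal.div_lt_iff (by simp) (by simp)]; norm_num
  obtain ⟨n, hVn, hWn⟩ := ((hV.eventually (lt_mem_nhds h32)).and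
    (hW.eventually (lt_mem_nhds h32))).exists
  set V := {v ∈ Set.Icc (0 : ℝ) 2 | ∀ k, n ≤ k → |f (x k + v) - f (x k)| < 1} with hVdef
  set W := {v ∈ Set.Icc (0 : ℝ) 2 | ∀ k, n ≤ k → |f (x k + u k + v) - f (x k + u k)| < 1}
    with hWdef
  have hWm : MeasurableSet W := by
    refine measurableSet_Icc.inter ?_
    have : {v : ℝ | ∀ k, n ≤ k → |f (x k + u k + v) - f (x k + u k)| < 1} =
        ⋂ k, ⋂ _ : n ≤ k, {v | |f (x k + u k + v) - f (x k + u k)| < 1} := by ext; simp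
    change MeasurableSet {v : ℝ | ∀ k, n ≤ k → |f (x k + u k + v) - f (x k + u k)| < 1}
    rw [this]
    refine MeasurableSet.iInter fun k => MeasurableSet.iInter fun _ => ?_
    exact measurableSet_lt (by fun_prop) measurable_const
  have hW' : volume ((fun v => v + -u n) ⁻¹' W) = volume W :=
    measure_preimage_add_right volume (-u n) W
  -- A common point `v` would place `f (x n + v)` within distance one of both `f (x n)` and `f (x n
  -- + u n)`, which differ by more than two. But `V` and the translate of `W` both have measure
  -- above `3 / 2` and lie in `[0, 3]`.
  have hdisj : Disjoint V ((fun v => v + -u n) ⁻¹' W) := by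
    rw [Set.disjoint_left]
    rintro v ⟨_, hv⟩ ⟨_, hw⟩
    have h1 := abs_lt.1 (hv n le_rfl)
    have h2 := abs_lt.1 (hw n le_rfl)
    rw [show x n + u n + (v + -u n) = x n + v by ring] at h2
    have h3 := hxu n
    rw [lt_abs] at h3
    rcases h3 with h3 | h3 <;> linarith [h1.1, h1.2, h2.1, h2.2]
  have hsub : V ∪ (fun v => v + -u n) ⁻¹' W ⊆ Set.Icc 0 3 := by
    rintro v (⟨hv, _⟩ | ⟨hv, _⟩)
    · exact ⟨hv.1, by linarith [hv.2]⟩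
    · simp only [Set.mem_Icc] at hv
      exact ⟨by linarith [hu0 n], by linarith [hu1 n]⟩
  have hle := measure_mono (μ := volume) hsub
  rw [measure_union hdisj (hWm.preimage (by fun_prop)), hW', Real.volume_Icc] at hle
  have hlt := ENNReal.add_lt_add hVn hWn
  have h3 : (3 / 2 : ℝ≥0∞) + 3 / 2 = ENNReal.ofReal (3 - 0) := by
    rw [ENNReal.add_halves]; norm_num
  rw [h3] at hlt
  exact absurd hlt (not_lt.2 hle)

/-- A slowly varying function grows more slowly than every power. -/
theorem IsSlowlyVarying.exists_abs_log_le {L : ℝ → ℝ} (hL : IsSlowlyVarying L) {ε : ℝ}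
    (hε : 0 < ε) : ∃ N : ℕ, 1 ≤ N ∧ ∀ n : ℕ, N ≤ n → |Real.log (L n)| ≤ ε * Real.log n := by
  -- In logarithmic coordinates slow variation says that increments over fixed distances vanish at
  -- infinity, and the claim becomes sublinear growth.
  set f : ℝ → ℝ := fun x => Real.log (L (Real.exp x)) with hfdef
  have hf : Measurable f := Real.measurable_log.comp (hL.measurable.comp Real.measurable_exp)
  have hinc : ∀ u, Tendsto (fun x => f (x + u) - f x) atTop (𝓝 0) := by
    intro u
    have h1 := (hL.tendsto_ratio (Real.exp u) (Real.exp_pos u)).comp Real.tendsto_exp_atTop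
    have h2 := h1.log one_ne_zero
    rw [Real.log_one] at h2
    refine h2.congr fun x => ?_
    simp only [Function.comp_apply, hfdef]
    rw [Real.log_div (hL.pos _ (by positivity)).ne' (hL.pos _ (by positivity)).ne',
      ← Real.exp_add, add_comm u x]
  obtain ⟨X₁, hX₁⟩ := exists_abs_increment_le_two hf hinc
  obtain ⟨X₂, hX₂⟩ := eventually_atTop.1
    ((hinc 1).eventually (Metric.ball_mem_nhds 0 (half_pos hε)))
  set X := max (max X₁ X₂) 0 with hX
  have hX1 : X₁ ≤ X := (le_max_left _ _).trans (le_max_left _ _)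
  have hX2 : X₂ ≤ X := (le_max_right _ _).trans (le_max_left _ _)
  have hX0 : 0 ≤ X := le_max_right _ _
  -- Telescoping over unit steps, each at most `ε / 2` beyond `X`. The fractional part of the
  -- distance is covered by the uniform bound two, and the constants are absorbed by the other half
  -- of `ε`.
  have hstep : ∀ n : ℕ, |f (X + n)| ≤ |f X| + ε / 2 * n := by
    intro n
    induction n with
    | zero => simp
    | succ n ih =>
      have h1 := hX₂ (X + n) (by linarith [(Nat.cast_nonneg n : (0 : ℝ) ≤ n)])
      rw [dist_zero_right, Real.norm_eq_abs] at h1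
      push_cast
      have h2 := abs_add_le (f (X + n + 1) - f (X + n)) (f (X + n))
      rw [sub_add_cancel] at h2
      rw [← add_assoc]
      linarith
  have hbound : ∀ y, X ≤ y → |f y| ≤ |f X| + 2 + ε / 2 * y := by
    intro y hy
    set n := ⌊y - X⌋₊ with hn
    have hn1 : (n : ℝ) ≤ y - X := Nat.floor_le (by linarith)
    have hn2 : y - X < n + 1 := Nat.lt_floor_add_one _
    have h1 := hX₁ (X + n) (by linarith [(Nat.cast_nonneg n : (0 : ℝ) ≤ n)]) (y - X - n)
      (by linarith) (by linarith)
    rw [show X + n + (y - X - n) = y by ring] at h1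
    have h2 := abs_add_le (f y - f (X + n)) (f (X + n))
    rw [sub_add_cancel] at h2
    have h3 := hstep n
    nlinarith
  have hlog : Tendsto (fun n : ℕ => Real.log n) atTop atTop :=
    Real.tendsto_log_atTop.comp tendsto_natCast_atTop_atTop
  obtain ⟨N, hN⟩ := eventually_atTop.1 (hlog.eventually_ge_atTop
    (max X ((|f X| + 2) / (ε / 2))))
  refine ⟨max N 1, le_max_right _ _, fun n hn => ?_⟩
  have h1 := hN n (le_of_max_le_left hn)
  have h2 := hbound (Real.log n) (le_of_max_le_left h1)
  have h3 := (div_le_iff₀ (half_pos hε)).1 (le_of_max_le_right h1)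
  have hn0 : (0 : ℝ) < n := by
    have : 1 ≤ n := le_of_max_le_right hn
    exact_mod_cast this
  rw [hfdef] at h2
  simp only [Real.exp_log hn0] at h2
  linarith

namespace IsInterarrivalLaw

variable {α : ℝ} {L : ℝ → ℝ} {K : ℕ → ℝ}

lemma pos (hK : IsInterarrivalLaw α L K) (t : ℕ) : 0 < K (t + 1) := by
  rw [hK.eq _ (Nat.le_add_left 1 t)]
  have h : (0 : ℝ) < ((t + 1 : ℕ) : ℝ) := by positivity
  exact mul_pos (hK.slowlyVarying.pos _ h) (Real.rpow_pos_of_pos h _)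

lemma log_eq (hK : IsInterarrivalLaw α L K) {n : ℕ} (hn : 1 ≤ n) :
    Real.log (K n) = Real.log (L n) - (1 + α) * Real.log n := by
  have h : (0 : ℝ) < n := by exact_mod_cast hn
  rw [hK.eq n hn, Real.log_mul (hK.slowlyVarying.pos _ h).ne' (Real.rpow_pos_of_pos h _).ne',
    Real.log_rpow h]
  ring

/-- For `α > 1` some fractional power of the law still has a finite mean. -/
theorem exists_summable_rpow (hK : IsInterarrivalLaw α L K) (hα : 1 < α) :
    ∃ γ : ℝ, 0 < γ ∧ γ < 1 ∧ Summable fun t : ℕ => ((t : ℝ) + 1) * K (t + 1) ^ γ := by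
  have hε : 0 < (α - 1) / 2 := by linarith
  obtain ⟨N, hN1, hN⟩ := hK.slowlyVarying.exists_abs_log_le hε
  -- With `ε = (α - 1) / 2` the law is eventually at most `n ^ (-(α + 3) / 2)`, so summability of `n
  -- K(n) ^ γ` requires `γ (α + 3) / 2 > 2`. Since `α > 1`, the interval `(4 / (α + 3), 1)` is
  -- nonempty; `γ` is its midpoint.
  set γ := (4 / (α + 3) + 1) / 2 with hγ
  have h4 : 4 / (α + 3) < 1 := by rw [div_lt_one (by linarith)]; linarith
  have h4' : 0 < 4 / (α + 3) := by positivity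
  refine ⟨γ, by linarith, by linarith, ?_⟩
  have hγ2 : 2 < γ * ((α + 3) / 2) := by
    have : 4 / (α + 3) * ((α + 3) / 2) = 2 := by field_simp; norm_num
    nlinarith
  have hs : Summable fun n : ℕ => (n : ℝ) ^ (1 - γ * ((α + 3) / 2)) :=
    Real.summable_nat_rpow.2 (by linarith)
  have hs' := (summable_nat_add_iff (N + 1)).2 hs
  rw [← summable_nat_add_iff N]
  refine hs'.of_nonneg_of_le (fun t => mul_nonneg (by positivity)
    (Real.rpow_nonneg (hK.pos _).le _)) fun t => ?_
  have hn : N ≤ t + N + 1 := by omega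
  have hb := (abs_le.1 (hN (t + N + 1) hn)).2
  have hlog := hK.log_eq (n := t + N + 1) (by omega)
  have hn0 : (0 : ℝ) < ((t + N + 1 : ℕ) : ℝ) := by positivity
  have hpos := hK.pos (t + N)
  rw [show ((t + N : ℕ) : ℝ) + 1 = ((t + N + 1 : ℕ) : ℝ) by push_cast; ring,
    show ((t + (N + 1) : ℕ) : ℝ) = ((t + N + 1 : ℕ) : ℝ) by push_cast; ring, sub_eq_add_neg,
    Real.rpow_add hn0, Real.rpow_one]
  gcongr
  rw [Real.rpow_def_of_pos hpos, Real.rpow_def_of_pos hn0]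
  refine Real.exp_le_exp.2 ?_
  rw [hlog]
  have : Real.log (L ((t + N + 1 : ℕ) : ℝ)) - (1 + α) * Real.log ((t + N + 1 : ℕ) : ℝ) ≤
      -((α + 3) / 2) * Real.log ((t + N + 1 : ℕ) : ℝ) := by linarith
  nlinarith [this, (by linarith : 0 < γ)]

/-- The interarrival law decays subexponentially. -/
theorem tendsto_log_div (hK : IsInterarrivalLaw α L K) :
    Tendsto (fun n : ℕ => Real.log (K n) / n) atTop (𝓝 0) := by
  obtain ⟨N, hN1, hN⟩ := hK.slowlyVarying.exists_abs_log_le one_pos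
  have h0 : Tendsto (fun n : ℕ => (1 + |1 + α|) * (Real.log n / n)) atTop (𝓝 0) := by
    have h1 := Real.isLittleO_log_id_atTop.tendsto_div_nhds_zero.comp
      (tendsto_natCast_atTop_atTop (R := ℝ))
    simpa using h1.const_mul (1 + |1 + α|)
  refine squeeze_zero_norm' ?_ h0
  filter_upwards [eventually_ge_atTop N] with n hn
  have hn1 : 1 ≤ n := hN1.trans hn
  rw [hK.log_eq hn1, norm_div, Real.norm_eq_abs, Real.norm_eq_abs, Nat.abs_cast, ← mul_div_assoc]
  gcongr
  have hl : 0 ≤ Real.log n := Real.log_natCast_nonneg n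
  calc |Real.log (L n) - (1 + α) * Real.log n|
      ≤ |Real.log (L n)| + |(1 + α) * Real.log n| := abs_sub _ _
    _ ≤ 1 * Real.log n + |1 + α| * Real.log n := by
        rw [abs_mul, abs_of_nonneg hl]
        gcongr
        exact hN n hn
    _ = _ := by ring

end IsInterarrivalLaw

/-! ### Sums over gap sequences -/

/-- The sum of `f` over lists of length `m`, weighted by the product of the weights `κ` of the
entries. -/
def levelSum (κ : ℕ → ℝ≥0∞) : ℕ → (List ℕ → ℝ≥0∞) → ℝ≥0∞
  | 0, f => f []
  | m + 1, f => ∑' t, κ t * levelSum κ m fun l => f (t :: l)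

/-- The sum of `f` over all lists, weighted by the product of the weights `κ` of the entries. -/
def gapSum (κ : ℕ → ℝ≥0∞) (f : List ℕ → ℝ≥0∞) : ℝ≥0∞ := ∑' m, levelSum κ m f

section Sums

variable {κ : ℕ → ℝ≥0∞}

lemma levelSum_mono {m : ℕ} {f g : List ℕ → ℝ≥0∞} (h : ∀ l, l.length = m → f l ≤ g l) :
    levelSum κ m f ≤ levelSum κ m g := by
  induction m generalizing f g with
  | zero => exact h [] rfl
  | succ m ih =>
    exact ENNReal.tsum_le_tsum fun t => mul_le_mul_right (ih fun l hl => h _ (by simp [hl])) _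

lemma levelSum_congr {m : ℕ} {f g : List ℕ → ℝ≥0∞} (h : ∀ l, l.length = m → f l = g l) :
    levelSum κ m f = levelSum κ m g :=
  le_antisymm (levelSum_mono fun l hl => (h l hl).le) (levelSum_mono fun l hl => (h l hl).ge)

lemma levelSum_const_mul {m : ℕ} (c : ℝ≥0∞) (f : List ℕ → ℝ≥0∞) :
    levelSum κ m (fun l => c * f l) = c * levelSum κ m f := by
  induction m generalizing f with
  | zero => rfl
  | succ m ih =>
    simp only [levelSum, ih]
    rw [← ENNReal.tsum_mul_left]
    exact tsum_congr fun t => by ring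

lemma levelSum_mul_const {m : ℕ} (c : ℝ≥0∞) (f : List ℕ → ℝ≥0∞) :
    levelSum κ m (fun l => f l * c) = levelSum κ m f * c := by
  simp only [mul_comm _ c, levelSum_const_mul]

lemma levelSum_tsum {ι : Type*} {m : ℕ} (f : ι → List ℕ → ℝ≥0∞) :
    levelSum κ m (fun l => ∑' i, f i l) = ∑' i, levelSum κ m (f i) := by
  induction m generalizing f with
  | zero => rfl
  | succ m ih =>
    simp only [levelSum, ih, ← ENNReal.tsum_mul_left]
    exact ENNReal.tsum_comm

lemma levelSum_sum {ι : Type*} {m : ℕ} (s : Finset ι) (f : ι → List ℕ → ℝ≥0∞) :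
    levelSum κ m (fun l => ∑ i ∈ s, f i l) = ∑ i ∈ s, levelSum κ m (f i) := by
  simp only [← Finset.tsum_subtype s]
  exact levelSum_tsum fun (i : s) => f i

lemma levelSum_add (m n : ℕ) (f : List ℕ → ℝ≥0∞) :
    levelSum κ (m + n) f = levelSum κ m fun l₁ => levelSum κ n fun l₂ => f (l₁ ++ l₂) := by
  induction m generalizing f with
  | zero => simp [levelSum]
  | succ m ih =>
    rw [Nat.succ_add]
    simp only [levelSum, ih, List.cons_append]

lemma levelSum_one_eq_one (hκ : ∑' t, κ t = 1) (m : ℕ) : levelSum κ m (fun _ => 1) = 1 := by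
  induction m with
  | zero => rfl
  | succ m ih => simp [levelSum, ih, hκ]

lemma measurable_levelSum {X : Type*} [MeasurableSpace X] {m : ℕ} {f : X → List ℕ → ℝ≥0∞}
    (hf : ∀ l, Measurable fun x => f x l) : Measurable fun x => levelSum κ m (f x) := by
  induction m generalizing f with
  | zero => exact hf []
  | succ m ih => exact Measurable.tsum fun t => (ih fun l => hf (t :: l)).const_mul _

lemma lintegral_levelSum {X : Type*} [MeasurableSpace X] (μ : Measure X) {m : ℕ}
    {f : X → List ℕ → ℝ≥0∞} (hf : ∀ l, Measurable fun x => f x l) :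
    ∫⁻ x, levelSum κ m (f x) ∂μ = levelSum κ m fun l => ∫⁻ x, f x l ∂μ := by
  induction m generalizing f with
  | zero => rfl
  | succ m ih =>
    simp only [levelSum]
    rw [lintegral_tsum fun t =>
      ((measurable_levelSum fun l => hf (t :: l)).const_mul _).aemeasurable]
    refine tsum_congr fun t => ?_
    rw [lintegral_const_mul _ (measurable_levelSum fun l => hf (t :: l)),
      ih fun l => hf (t :: l)]

lemma gapSum_mono {f g : List ℕ → ℝ≥0∞} (h : ∀ l, f l ≤ g l) : gapSum κ f ≤ gapSum κ g :=
  ENNReal.tsum_le_tsum fun _ => levelSum_mono fun l _ => h l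

lemma gapSum_const_mul (c : ℝ≥0∞) (f : List ℕ → ℝ≥0∞) :
    gapSum κ (fun l => c * f l) = c * gapSum κ f := by
  simp only [gapSum, levelSum_const_mul, ENNReal.tsum_mul_left]

lemma gapSum_tsum {ι : Type*} (f : ι → List ℕ → ℝ≥0∞) :
    gapSum κ (fun l => ∑' i, f i l) = ∑' i, gapSum κ (f i) := by
  simp only [gapSum, levelSum_tsum]
  exact ENNReal.tsum_comm

lemma gapSum_add (f g : List ℕ → ℝ≥0∞) :
    gapSum κ (fun l => f l + g l) = gapSum κ f + gapSum κ g := by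
  have := gapSum_tsum (κ := κ) fun (b : Bool) l => bif b then f l else g l
  simpa [tsum_bool, add_comm] using this

lemma gapSum_cons (f : List ℕ → ℝ≥0∞) :
    gapSum κ f = f [] + ∑' t, κ t * gapSum κ fun l => f (t :: l) := by
  rw [gapSum, tsum_eq_zero_add' ENNReal.summable]
  congr 1
  simp only [levelSum, gapSum, ← ENNReal.tsum_mul_left]
  exact ENNReal.tsum_comm

lemma measurable_gapSum {X : Type*} [MeasurableSpace X] {f : X → List ℕ → ℝ≥0∞}
    (hf : ∀ l, Measurable fun x => f x l) : Measurable fun x => gapSum κ (f x) :=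
  Measurable.tsum fun _ => measurable_levelSum hf

lemma lintegral_gapSum {X : Type*} [MeasurableSpace X] (μ : Measure X)
    {f : X → List ℕ → ℝ≥0∞} (hf : ∀ l, Measurable fun x => f x l) :
    ∫⁻ x, gapSum κ (f x) ∂μ = gapSum κ fun l => ∫⁻ x, f x l ∂μ := by
  simp only [gapSum]
  rw [lintegral_tsum fun m => (measurable_levelSum hf).aemeasurable]
  exact tsum_congr fun m => lintegral_levelSum μ hf

end Sums

/-! ### Contact configurations -/

/-- The contacts of a path started at the contact `a`, whose successive gaps are `t + 1` for `t`
in the list. -/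
def supp : ℕ → List ℕ → Finset ℕ
  | _, [] => ∅
  | a, t :: l => insert (a + t + 1) (supp (a + t + 1) l)

/-- The last contact of a path started at the contact `a`. -/
def endpoint : ℕ → List ℕ → ℕ
  | a, [] => a
  | a, t :: l => endpoint (a + t + 1) l

lemma endpoint_eq (a : ℕ) (l : List ℕ) : endpoint a l = a + (l.sum + l.length) := by
  induction l generalizing a with
  | nil => rfl
  | cons t l ih => simp only [endpoint, ih, List.sum_cons, List.length_cons]; ring

lemma endpoint_append (a : ℕ) (l₁ l₂ : List ℕ) :
    endpoint a (l₁ ++ l₂) = endpoint (endpoint a l₁) l₂ := by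
  simp only [endpoint_eq, List.sum_append, List.length_append]; ring

lemma supp_append (a : ℕ) (l₁ l₂ : List ℕ) :
    supp a (l₁ ++ l₂) = supp a l₁ ∪ supp (endpoint a l₁) l₂ := by
  induction l₁ generalizing a with
  | nil => simp [supp, endpoint]
  | cons t l ih => simp [supp, endpoint, ih]

lemma lt_and_le_of_mem_supp {a : ℕ} {l : List ℕ} {x : ℕ} (hx : x ∈ supp a l) :
    a < x ∧ x ≤ endpoint a l := by
  induction l generalizing a with
  | nil => simp [supp] at hx
  | cons t l ih =>
    rw [supp, Finset.mem_insert] at hx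
    rcases hx with rfl | hx
    · simp only [endpoint, endpoint_eq]; omega
    · have := ih hx
      simp only [endpoint]
      omega

lemma supp_cons_notMem (a t : ℕ) (l : List ℕ) : a + t + 1 ∉ supp (a + t + 1) l := fun h =>
  lt_irrefl _ (lt_and_le_of_mem_supp h).1

lemma disjoint_supp_append (a : ℕ) (l₁ l₂ : List ℕ) :
    Disjoint (supp a l₁) (supp (endpoint a l₁) l₂) := by
  rw [Finset.disjoint_left]
  intro x h1 h2
  have := (lt_and_le_of_mem_supp h1).2
  have := (lt_and_le_of_mem_supp h2).1
  omega

lemma card_supp (a : ℕ) (l : List ℕ) : (supp a l).card = l.length := by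
  induction l generalizing a with
  | nil => rfl
  | cons t l ih => rw [supp, Finset.card_insert_of_notMem (supp_cons_notMem a t l), ih]; rfl

lemma supp_add (a b : ℕ) (l : List ℕ) :
    supp (a + b) l = (supp b l).map (addLeftEmbedding a) := by
  induction l generalizing b with
  | nil => simp [supp]
  | cons t l ih =>
    rw [supp, supp, Finset.map_insert, ← ih]
    simp [add_assoc]

lemma endpoint_add (a b : ℕ) (l : List ℕ) : endpoint (a + b) l = a + endpoint b l := by
  simp only [endpoint_eq]; ring

/-- The Boltzmann weight of a configuration in the environment `w`. -/
def boltzmann (β h : ℝ) (w : ℤ → ℝ) (S : Finset ℕ) : ℝ≥0∞ :=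
  ENNReal.ofReal (Real.exp (∑ k ∈ S, (β * w k + h)))

lemma boltzmann_union {β h : ℝ} {w : ℤ → ℝ} {S S' : Finset ℕ} (hS : Disjoint S S') :
    boltzmann β h w (S ∪ S') = boltzmann β h w S * boltzmann β h w S' := by
  rw [boltzmann, Finset.sum_union hS, Real.exp_add, ENNReal.ofReal_mul (by positivity)]
  rfl

lemma measurable_boltzmann (β h : ℝ) (S : Finset ℕ) : Measurable fun w => boltzmann β h w S := by
  unfold boltzmann; fun_prop

/-- The point-to-point partition function, from a contact at `a` to a contact at `b`. -/
def pinned (κ : ℕ → ℝ≥0∞) (β h : ℝ) (w : ℤ → ℝ) (a b : ℕ) : ℝ≥0∞ :=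
  gapSum κ fun l => if endpoint a l = b then boltzmann β h w (supp a l) else 0

section Pinned

variable {κ : ℕ → ℝ≥0∞} {β h : ℝ}

lemma measurable_pinned (a b : ℕ) : Measurable fun w => pinned κ β h w a b := by
  refine measurable_gapSum fun l => ?_
  split_ifs
  · exact measurable_boltzmann _ _ _
  · exact measurable_const

/-- First step decomposition. -/
lemma pinned_eq (w : ℤ → ℝ) (a b : ℕ) :
    pinned κ β h w a b = (if a = b then 1 else 0) +
      ∑' t, κ t * (boltzmann β h w {a + t + 1} * pinned κ β h w (a + t + 1) b) := by
  rw [pinned, gapSum_cons]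
  congr 1
  · simp [endpoint, supp, boltzmann]
  · refine tsum_congr fun t => ?_
    congr 1
    rw [pinned, ← gapSum_const_mul]
    congr 1
    ext l
    rw [mul_ite, mul_zero, endpoint, supp, Finset.insert_eq, boltzmann_union]
    simpa using supp_cons_notMem a t l

lemma pinned_eq_zero {w : ℤ → ℝ} {a b : ℕ} (hab : b < a) : pinned κ β h w a b = 0 := by
  rw [pinned, gapSum]
  refine ENNReal.tsum_eq_zero.2 fun m => ?_
  have : levelSum κ m (fun _ => 0) = 0 := by
    simpa using levelSum_const_mul (κ := κ) (m := m) 0 fun _ => 0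
  refine (levelSum_congr (g := fun _ => 0) fun l _ => if_neg ?_).trans this
  rw [endpoint_eq]; omega

lemma pinned_self (w : ℤ → ℝ) (a : ℕ) : pinned κ β h w a a = 1 := by
  rw [pinned_eq, if_pos rfl]
  have : ∑' t, κ t * (boltzmann β h w {a + t + 1} * pinned κ β h w (a + t + 1) a) = 0 :=
    ENNReal.tsum_eq_zero.2 fun t => by rw [pinned_eq_zero (by omega)]; simp
  rw [this, add_zero]

/-- Decomposition at the first contact beyond `k`. -/
lemma pinned_decomposition (w : ℤ → ℝ) {a k b : ℕ} (hak : a < k) (hkb : k ≤ b) :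
    pinned κ β h w a b = ∑' j, ∑' t, if j < k ∧ k ≤ j + t + 1 then
      pinned κ β h w a j * (κ t * (boltzmann β h w {j + t + 1} * pinned κ β h w (j + t + 1) b))
      else 0 := by
  obtain ⟨d, hd⟩ : ∃ d, d = k - a := ⟨_, rfl⟩
  induction d using Nat.strong_induction_on generalizing a with
  | _ d ih =>
  -- `Φ j` is the contribution after a last contact `j` before `k`. In the computation below the
  -- first step from `a` either crosses `k`, which yields `Φ a`, or lands before `k`, where the
  -- induction hypothesis applies.
  set Φ : ℕ → ℝ≥0∞ := fun j => ∑' t, if j < k ∧ k ≤ j + t + 1 then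
    κ t * (boltzmann β h w {j + t + 1} * pinned κ β h w (j + t + 1) b) else 0 with hΦ
  have hrhs : ∀ a, (∑' j, ∑' t, if j < k ∧ k ≤ j + t + 1 then
      pinned κ β h w a j * (κ t * (boltzmann β h w {j + t + 1} * pinned κ β h w (j + t + 1) b))
      else 0) = ∑' j, pinned κ β h w a j * Φ j := by
    intro a
    refine tsum_congr fun j => ?_
    rw [hΦ, ← ENNReal.tsum_mul_left]
    refine tsum_congr fun t => ?_
    rw [mul_ite, mul_zero]
  rw [hrhs]
  have hΦ0 : ∀ j, k ≤ j → Φ j = 0 := fun j hj => by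
    refine ENNReal.tsum_eq_zero.2 fun t => if_neg ?_
    omega
  calc pinned κ β h w a b
      = ∑' t, κ t * (boltzmann β h w {a + t + 1} * pinned κ β h w (a + t + 1) b) := by
        rw [pinned_eq, if_neg (by omega), zero_add]
    _ = ∑' t, ((if k ≤ a + t + 1 then
          κ t * (boltzmann β h w {a + t + 1} * pinned κ β h w (a + t + 1) b) else 0) +
          κ t * (boltzmann β h w {a + t + 1} *
            ∑' j, pinned κ β h w (a + t + 1) j * Φ j)) := by
        refine tsum_congr fun t => ?_
        by_cases hk : k ≤ a + t + 1
        · rw [if_pos hk]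
          have : ∑' j, pinned κ β h w (a + t + 1) j * Φ j = 0 := by
            refine ENNReal.tsum_eq_zero.2 fun j => ?_
            rcases lt_or_ge j k with hj | hj
            · rw [pinned_eq_zero (by omega), zero_mul]
            · rw [hΦ0 j hj, mul_zero]
          rw [this, mul_zero, mul_zero, add_zero]
        · rw [if_neg hk, zero_add, ih (k - (a + t + 1)) (by omega) (by omega) rfl, hrhs]
    _ = Φ a + ∑' j, (∑' t, κ t * (boltzmann β h w {a + t + 1} *
          pinned κ β h w (a + t + 1) j)) * Φ j := by
        rw [ENNReal.tsum_add]
        congr 1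
        · simp [hΦ, hak]
        · simp only [← ENNReal.tsum_mul_left, ← ENNReal.tsum_mul_right]
          rw [ENNReal.tsum_comm]
          exact tsum_congr fun j => tsum_congr fun t => by ring
    _ = ∑' j, ((if a = j then 1 else 0) * Φ j + (∑' t, κ t * (boltzmann β h w {a + t + 1} *
          pinned κ β h w (a + t + 1) j)) * Φ j) := by
        rw [ENNReal.tsum_add]
        congr 1
        rw [tsum_eq_single a fun j hj => by simp [hj.symm]]
        simp
    _ = ∑' j, pinned κ β h w a j * Φ j := by
        refine tsum_congr fun j => ?_
        rw [← add_mul, ← pinned_eq]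

end Pinned

/-! ### The renewal representation of the partition function -/

/-- The weight `K (t + 1)` of a gap encoded by `t`. -/
def gapWeight (K : ℕ → ℝ) (t : ℕ) : ℝ≥0∞ := ENNReal.ofReal (K (t + 1))

namespace IsInterarrivalLaw

variable {α : ℝ} {L : ℝ → ℝ} {K : ℕ → ℝ}

lemma tsum_gapWeight (hK : IsInterarrivalLaw α L K) : ∑' t, gapWeight K t = 1 := by
  unfold gapWeight
  rw [← ENNReal.ofReal_tsum_of_nonneg (fun t => (hK.pos t).le) hK.recurrent.summable,
    hK.recurrent.tsum_eq, ENNReal.ofReal_one]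

lemma gapWeight_ne_zero (hK : IsInterarrivalLaw α L K) (t : ℕ) : gapWeight K t ≠ 0 := by
  simpa [gapWeight] using hK.pos t

end IsInterarrivalLaw

section Renewal

variable {Ω' : Type*} [MeasurableSpace Ω'] {P : Measure Ω'} [IsProbabilityMeasure P]
  {α : ℝ} {L : ℝ → ℝ} {K : ℕ → ℝ} {T : ℕ → Ω' → ℕ}

/-- The gaps `T_a, …, T_{a+m-1}`, diminished by one. -/
def gapList (T : ℕ → Ω' → ℕ) (a m : ℕ) (x : Ω') : List ℕ :=
  (List.range' a m).map fun i => T i x - 1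

lemma gapList_succ (a m : ℕ) (x : Ω') :
    gapList T a (m + 1) x = (T a x - 1) :: gapList T (a + 1) m x := by
  simp [gapList, List.range'_succ]

lemma gapList_succ' (a m : ℕ) (x : Ω') :
    gapList T a (m + 1) x = gapList T a m x ++ [T (a + m) x - 1] := by
  simp [gapList, List.range'_concat]

/-- The masses of the values `n ≥ 1` already add up to one, so the value zero is negligible. -/
lemma IsInterarrivalSequence.ae_pos (hT : IsInterarrivalSequence P K T)
    (hK : IsInterarrivalLaw α L K) : ∀ᵐ x ∂P, ∀ i, 1 ≤ T i x := by
  rw [ae_all_iff]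
  intro i
  have h1 : P {x | 1 ≤ T i x} = 1 := by
    have : {x | 1 ≤ T i x} = ⋃ t : ℕ, {x | T i x = t + 1} := by
      ext x
      simp only [Set.mem_ofPred_eq, Set.mem_iUnion]
      exact ⟨fun h => ⟨T i x - 1, by omega⟩, fun ⟨t, ht⟩ => by omega⟩
    rw [this, measure_iUnion]
    · rw [← hK.tsum_gapWeight]
      refine tsum_congr fun t => ?_
      rw [gapWeight, ← hT.law i (t + 1) (by omega), ofReal_measureReal]
    · intro s t hst
      rw [Function.onFun, Set.disjoint_left]
      intro x hx hx'
      simp only [Set.mem_ofPred_eq] at hx hx'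
      omega
    · exact fun t => hT.measurable i (measurableSet_singleton _)
  have hm : MeasurableSet {x | 1 ≤ T i x} := hT.measurable i measurableSet_Ici
  exact (prob_compl_eq_zero_iff hm).2 h1

lemma IsInterarrivalSequence.measure_eq (hT : IsInterarrivalSequence P K T)
    (hK : IsInterarrivalLaw α L K) (i t : ℕ) : P {x | T i x - 1 = t} = gapWeight K t := by
  rw [gapWeight, ← hT.law i (t + 1) (by omega), ofReal_measureReal]
  refine measure_congr ?_
  filter_upwards [hT.ae_pos hK] with x hx
  have := hx i
  refine propext ?_
  change T i x - 1 = t ↔ T i x = t + 1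
  omega

lemma measurable_gapList (hT : IsInterarrivalSequence P K T) (a m : ℕ) {f : List ℕ → ℝ≥0∞} :
    Measurable fun x => f (gapList T a m x) := by
  induction m generalizing a f with
  | zero => simp [gapList]
  | succ m ih =>
    have e : (fun x => f (gapList T a (m + 1) x)) = fun x => ∑' t,
        Set.indicator {x | T a x - 1 = t} (fun x => f (t :: gapList T (a + 1) m x)) x := by
      ext x
      rw [tsum_eq_single (T a x - 1) fun t ht => Set.indicator_of_notMem (by
        simpa using ht.symm) _, Set.indicator_of_mem (by simp), gapList_succ]
    rw [e]
    refine Measurable.tsum fun t => (ih (a + 1) (f := fun l => f (t :: l))).indicator ?_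
    exact (hT.measurable a) (Set.to_countable {n | n - 1 = t}).measurableSet

/-- The first gap is independent of the following ones. Conditioning on it reproduces the recursion
that defines `levelSum`, with one weight `K` per gap. -/
lemma lintegral_gapList (hT : IsInterarrivalSequence P K T) (hK : IsInterarrivalLaw α L K)
    (a m : ℕ) (f : List ℕ → ℝ≥0∞) :
    ∫⁻ x, f (gapList T a m x) ∂P = levelSum (gapWeight K) m f := by
  classical
  induction m generalizing a f with
  | zero => simp [gapList, levelSum]
  | succ m ih =>
    have e : (fun x => f (gapList T a (m + 1) x)) = fun x => ∑' t,
        Set.indicator {x | T a x - 1 = t} 1 x * f (t :: gapList T (a + 1) m x) := by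
      ext x
      rw [tsum_eq_single (T a x - 1) fun t ht => by
        rw [Set.indicator_of_notMem (by simpa using ht.symm), zero_mul],
        Set.indicator_of_mem (by simp), gapList_succ, Pi.one_apply, one_mul]
    have hms : ∀ t, MeasurableSet {x | T a x - 1 = t} := fun t =>
      (hT.measurable a) (Set.to_countable {n | n - 1 = t}).measurableSet
    have hmi : ∀ t, Measurable (Set.indicator {x | T a x - 1 = t} (1 : Ω' → ℝ≥0∞)) := fun t =>
      measurable_one.indicator (hms t)
    have hae : ∀ t, AEMeasurable (fun x => Set.indicator {x | T a x - 1 = t} 1 x *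
        f (t :: gapList T (a + 1) m x)) P := fun t => ((hmi t).mul
      (measurable_gapList hT (a + 1) m (f := fun l => f (t :: l)))).aemeasurable
    rw [e, levelSum, lintegral_tsum hae]
    refine tsum_congr fun t => ?_
    have hind := hT.indep.indepFun_finset {a} (Finset.Ico (a + 1) (a + 1 + m)) (by simp)
      hT.measurable
    let φ : (({a} : Finset ℕ) → ℕ) → ℝ≥0∞ := fun y =>
      if y ⟨a, Finset.mem_singleton_self a⟩ - 1 = t then 1 else 0
    let ψ : (Finset.Ico (a + 1) (a + 1 + m) → ℕ) → ℝ≥0∞ := fun y =>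
      f (t :: (List.range' (a + 1) m).attach.map fun i =>
        y ⟨i.1, by have := List.mem_range'_1.1 i.2; rw [Finset.mem_Ico]; exact this⟩ - 1)
    have hind' := hind.comp (φ := φ) (ψ := ψ) (measurable_of_countable _)
      (measurable_of_countable _)
    have e1 : (φ ∘ fun x (i : ({a} : Finset ℕ)) => T i x) =
        Set.indicator {x | T a x - 1 = t} 1 := by
      ext x; simp [φ, Set.indicator_apply]
    have e2 : (ψ ∘ fun x (i : Finset.Ico (a + 1) (a + 1 + m)) => T i x) =
        fun x => f (t :: gapList T (a + 1) m x) := by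
      ext x
      simp only [ψ, Function.comp_apply, gapList]
      rw [List.attach_map_val (l := List.range' (a + 1) m) (f := fun i => T i x - 1)]
    rw [e1, e2] at hind'
    rw [lintegral_mul_eq_lintegral_mul_lintegral_of_indepFun'' (hmi t).aemeasurable
      (measurable_gapList hT (a + 1) m (f := fun l => f (t :: l))).aemeasurable hind',
      lintegral_indicator_one (hms t), hT.measure_eq hK, ih (a + 1) fun l => f (t :: l)]

lemma sum_gapList (x : Ω') (hx : ∀ i, 1 ≤ T i x) (m : ℕ) :
    ∑ i ∈ Finset.range m, T i x = endpoint 0 (gapList T 0 m x) := by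
  induction m with
  | zero => rfl
  | succ m ih =>
    rw [Finset.sum_range_succ, ih, gapList_succ', endpoint_append]
    simp only [zero_add, endpoint]
    have := hx m
    omega

lemma strictMono_sum_gap (x : Ω') (hx : ∀ i, 1 ≤ T i x) :
    StrictMono fun m => ∑ i ∈ Finset.range m, T i x := by
  refine strictMono_nat_of_lt_succ fun m => ?_
  rw [Finset.sum_range_succ]
  have := hx m
  omega

lemma supp_gapList (x : Ω') (hx : ∀ i, 1 ≤ T i x) (m : ℕ) :
    supp 0 (gapList T 0 m x) =
      (Finset.range m).image fun j => ∑ i ∈ Finset.range (j + 1), T i x := by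
  induction m with
  | zero => rfl
  | succ m ih =>
    rw [gapList_succ', supp_append, ih, Finset.range_add_one, Finset.image_insert, Finset.union_comm]
    simp only [supp, zero_add, ← sum_gapList x hx, Finset.sum_range_succ]
    rw [insert_empty_eq, Finset.singleton_union]
    congr 1
    have := hx m
    omega

lemma filter_renewalSet (x : Ω') (hx : ∀ i, 1 ≤ T i x) (m : ℕ) (k : ℕ) :
    (k ∈ renewalSet T x ∧ 1 ≤ k ∧ k ≤ ∑ i ∈ Finset.range m, T i x) ↔
      k ∈ supp 0 (gapList T 0 m x) := by
  have hmono := strictMono_sum_gap x hx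
  rw [supp_gapList x hx, Finset.mem_image]
  constructor
  · rintro ⟨⟨j, rfl⟩, h1, h2⟩
    have hj : j ≤ m := hmono.le_iff_le.1 h2
    have hj0 : j ≠ 0 := by rintro rfl; simp at h1
    exact ⟨j - 1, by rw [Finset.mem_range]; omega, by rw [Nat.sub_add_cancel (by omega)]⟩
  · rintro ⟨j, hj, rfl⟩
    rw [Finset.mem_range] at hj
    refine ⟨⟨j + 1, rfl⟩, ?_, hmono.monotone (by omega)⟩
    exact Nat.one_le_iff_ne_zero.2 (hmono (Nat.zero_lt_succ j)).ne_bot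

lemma measurable_contact (hT : IsInterarrivalSequence P K T) (k : ℕ) :
    Measurable (contact T k) := by
  classical
  have hs : MeasurableSet {x | k ∈ renewalSet T x} := by
    have : {x | k ∈ renewalSet T x} =
        ⋃ j : ℕ, {x | ∑ i ∈ Finset.range j, T i x = k} := by ext; simp [renewalSet]
    rw [this]
    refine MeasurableSet.iUnion fun j => ?_
    exact (Finset.measurable_fun_sum _ fun i _ => hT.measurable i) (measurableSet_singleton k)
  unfold contact
  exact Measurable.ite hs measurable_const measurable_const

lemma contact_nonneg (k : ℕ) (x : Ω') : 0 ≤ contact T k x := by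
  unfold contact; split_ifs <;> norm_num

lemma contact_le_one (k : ℕ) (x : Ω') : contact T k x ≤ 1 := by
  unfold contact; split_ifs <;> norm_num

/-- The renewal epochs are strictly increasing, so at most one `m` has `τ_m = n`. For that `m` the
contacts in `[1, n]` are exactly the support of the first `m` gaps. -/
lemma ofReal_exp_hamiltonian (β h : ℝ) (w : ℤ → ℝ) (n : ℕ) (x : Ω') (hx : ∀ i, 1 ≤ T i x) :
    ENNReal.ofReal (Real.exp (hamiltonian T β h w n x) * contact T n x) =
      ∑' m, if endpoint 0 (gapList T 0 m x) = n then
        boltzmann β h w (supp 0 (gapList T 0 m x)) else 0 := by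
  classical
  have hmono := strictMono_sum_gap x hx
  simp only [← sum_gapList x hx]
  by_cases hn : n ∈ renewalSet T x
  · obtain ⟨m, hm⟩ := hn
    rw [tsum_eq_single m fun j hj => if_neg fun h => hj (hmono.injective (h.trans hm.symm)),
      if_pos hm]
    have : contact T n x = 1 := if_pos ⟨m, hm⟩
    rw [this, mul_one, boltzmann]
    congr 2
    rw [hamiltonian]
    have e : supp 0 (gapList T 0 m x) =
        (Finset.Icc 1 n).filter fun k => k ∈ renewalSet T x := by
      ext k
      rw [← filter_renewalSet x hx, Finset.mem_filter, Finset.mem_Icc, hm]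
      tauto
    rw [e, Finset.sum_filter]
    refine Finset.sum_congr rfl fun k _ => ?_
    rw [contact]
    split_ifs <;> simp
  · have : contact T n x = 0 := if_neg hn
    rw [this, mul_zero, ENNReal.ofReal_zero, eq_comm, ENNReal.tsum_eq_zero]
    exact fun m => if_neg fun h => hn ⟨m, h⟩

/-- This removes the renewal probability space: from here on, partition functions are weighted sums
over lists of gaps with values in `ℝ≥0∞`, where sums and integrals may be interchanged freely. -/
theorem ofReal_partitionFunction (hT : IsInterarrivalSequence P K T)
    (hK : IsInterarrivalLaw α L K) (β h : ℝ) (w : ℤ → ℝ) (n : ℕ) :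
    ENNReal.ofReal (partitionFunction P T β h w n) = pinned (gapWeight K) β h w 0 n := by
  have hHm : Measurable fun x => hamiltonian T β h w n x :=
    Finset.measurable_fun_sum _ fun k _ => (measurable_contact hT k).const_mul _
  have hbound : ∀ x, |hamiltonian T β h w n x| ≤ ∑ k ∈ Finset.Icc 1 n, |β * w k + h| := by
    intro x
    refine (Finset.abs_sum_le_sum_abs _ _).trans (Finset.sum_le_sum fun k _ => ?_)
    rw [abs_mul, abs_of_nonneg (contact_nonneg k x)]
    exact mul_le_of_le_one_right (abs_nonneg _) (contact_le_one k x)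
  have hint : Integrable (fun x => Real.exp (hamiltonian T β h w n x) * contact T n x) P := by
    refine Integrable.of_bound (C := Real.exp (∑ k ∈ Finset.Icc 1 n, |β * w k + h|))
      ((hHm.exp.mul (measurable_contact hT n)).aestronglyMeasurable)
      (Eventually.of_forall fun x => ?_)
    rw [Real.norm_of_nonneg (mul_nonneg (Real.exp_pos _).le (contact_nonneg n x))]
    exact (mul_le_of_le_one_right (Real.exp_pos _).le (contact_le_one n x)).trans
      (Real.exp_le_exp.2 ((le_abs_self _).trans (hbound x)))
  rw [partitionFunction, ofReal_integral_eq_lintegral_ofReal hint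
    (Eventually.of_forall fun x => mul_nonneg (Real.exp_pos _).le (contact_nonneg n x)),
    pinned, gapSum]
  have h1 : ∀ᵐ x ∂P, ENNReal.ofReal (Real.exp (hamiltonian T β h w n x) * contact T n x) =
      ∑' m, if endpoint 0 (gapList T 0 m x) = n then
        boltzmann β h w (supp 0 (gapList T 0 m x)) else 0 := by
    filter_upwards [hT.ae_pos hK] with x hx using ofReal_exp_hamiltonian β h w n x hx
  rw [lintegral_congr_ae h1, lintegral_tsum fun m => (measurable_gapList hT 0 m
    (f := fun l => if endpoint 0 l = n then boltzmann β h w (supp 0 l) else 0)).aemeasurable]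
  exact tsum_congr fun m => lintegral_gapList hT hK 0 m
    fun l => if endpoint 0 l = n then boltzmann β h w (supp 0 l) else 0

lemma partitionFunction_nonneg (β h : ℝ) (w : ℤ → ℝ) (n : ℕ) :
    0 ≤ partitionFunction P T β h w n :=
  integral_nonneg fun x => mul_nonneg (Real.exp_pos _).le (contact_nonneg n x)

lemma partitionFunction_eq (hT : IsInterarrivalSequence P K T)
    (hK : IsInterarrivalLaw α L K) (β h : ℝ) (w : ℤ → ℝ) (n : ℕ) :
    partitionFunction P T β h w n = (pinned (gapWeight K) β h w 0 n).toReal := by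
  rw [← ofReal_partitionFunction hT hK, ENNReal.toReal_ofReal (partitionFunction_nonneg _ _ _ _)]

end Renewal

/-! ### Almost multiplicative weights on gap sequences -/

/-- Concatenation multiplies the weight, up to the factor `C`. -/
structure IsAlmostMultiplicative (C : ℝ≥0∞) (W : List ℕ → ℝ≥0∞) : Prop where
  append_le : ∀ l₁ l₂, W (l₁ ++ l₂) ≤ C * (W l₁ * W l₂)
  le_append : ∀ l₁ l₂, W l₁ * W l₂ ≤ C * W (l₁ ++ l₂)

/-- Total mass of the level `m` is comparable to one, uniformly in `m`. -/
structure IsCriticalWeight (κ : ℕ → ℝ≥0∞) (C : ℝ≥0∞) (W : List ℕ → ℝ≥0∞) : Prop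
    extends IsAlmostMultiplicative C W where
  one_le : ∀ m, 1 ≤ C * levelSum κ m W
  level_le : ∀ m, levelSum κ m W ≤ C

section Abstract

variable {κ : ℕ → ℝ≥0∞} {C : ℝ≥0∞} {W : List ℕ → ℝ≥0∞}

lemma IsAlmostMultiplicative.levelSum_add_le (hW : IsAlmostMultiplicative C W) (m n : ℕ)
    (f g : List ℕ → ℝ≥0∞) {F : List ℕ → ℝ≥0∞}
    (hF : ∀ l₁ l₂, l₁.length = m → l₂.length = n → F (l₁ ++ l₂) ≤ f l₁ * g l₂) :
    levelSum κ (m + n) (fun l => W l * F l) ≤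
      C * (levelSum κ m (fun l => W l * f l) * levelSum κ n fun l => W l * g l) := by
  rw [levelSum_add, ← levelSum_mul_const, ← levelSum_const_mul]
  refine levelSum_mono fun l₁ h₁ => ?_
  rw [← levelSum_const_mul, ← levelSum_const_mul]
  refine levelSum_mono fun l₂ h₂ => ?_
  calc W (l₁ ++ l₂) * F (l₁ ++ l₂) ≤ C * (W l₁ * W l₂) * (f l₁ * g l₂) :=
        mul_le_mul' (hW.append_le _ _) (hF _ _ h₁ h₂)
    _ = _ := by ring

lemma IsAlmostMultiplicative.le_levelSum_add (hW : IsAlmostMultiplicative C W) (m n : ℕ)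
    (f g : List ℕ → ℝ≥0∞) {F : List ℕ → ℝ≥0∞}
    (hF : ∀ l₁ l₂, l₁.length = m → l₂.length = n → f l₁ * g l₂ ≤ F (l₁ ++ l₂)) :
    levelSum κ m (fun l => W l * f l) * levelSum κ n (fun l => W l * g l) ≤
      C * levelSum κ (m + n) fun l => W l * F l := by
  rw [levelSum_add, ← levelSum_mul_const, ← levelSum_const_mul]
  refine levelSum_mono fun l₁ h₁ => ?_
  rw [← levelSum_const_mul, ← levelSum_const_mul]
  refine levelSum_mono fun l₂ h₂ => ?_
  calc W l₁ * f l₁ * (W l₂ * g l₂) = W l₁ * W l₂ * (f l₁ * g l₂) := by ring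
    _ ≤ C * W (l₁ ++ l₂) * F (l₁ ++ l₂) := mul_le_mul' (hW.le_append _ _) (hF _ _ h₁ h₂)
    _ = _ := by ring

lemma strictMono_endpoint_take {l : List ℕ} {m n : ℕ} (hmn : m < n) (hn : n ≤ l.length) :
    endpoint 0 (l.take m) < endpoint 0 (l.take n) := by
  have h : l.take n = l.take m ++ (l.take n).drop m := by
    conv_lhs => rw [← List.take_append_drop m (l.take n), List.take_take, min_eq_left hmn.le]
  rw [h, endpoint_append, endpoint_eq (endpoint 0 _)]
  have : ((l.take n).drop m).length = n - m := by
    rw [List.length_drop, List.length_take, min_eq_left hn]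
  omega

/-- A path visits `j` at most once, and only if it ends at or beyond `j`. -/
lemma sum_endpoint_take_le {l : List ℕ} {M : ℕ} (hl : l.length = M) (j : ℕ) :
    ∑ m ∈ Finset.range (M + 1), (if endpoint 0 (l.take m) = j then (1 : ℝ≥0∞) else 0) ≤
      if j ≤ endpoint 0 l then 1 else 0 := by
  by_cases h : ∃ m ∈ Finset.range (M + 1), endpoint 0 (l.take m) = j
  · obtain ⟨m, hm, hmj⟩ := h
    rw [Finset.mem_range] at hm
    rw [Finset.sum_eq_single m]
    · rw [if_pos hmj, if_pos]
      rw [← hmj]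
      rcases (Nat.lt_succ_iff.1 hm).eq_or_lt with rfl | hlt
      · rw [← hl, List.take_length]
      · have := strictMono_endpoint_take (l := l) hlt hl.ge
        rw [← hl, List.take_length] at this
        exact this.le
    · intro n hn hnm
      rw [Finset.mem_range] at hn
      refine if_neg fun h => ?_
      rcases lt_or_gt_of_ne hnm with h' | h'
      · have := strictMono_endpoint_take (l := l) h' (by omega); omega
      · have := strictMono_endpoint_take (l := l) h' (by omega); omega
    · intro h'
      exact absurd (Finset.mem_range.2 hm) h'
  · push Not at h
    rw [Finset.sum_eq_zero fun m hm => if_neg (h m hm)]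
    exact zero_le

namespace IsCriticalWeight

/-- The mass of the first `M` levels ending at `j` is controlled by the mass of the level `M` that
has crossed `j`. -/
lemma sum_levelSum_endpoint_le (hW : IsCriticalWeight κ C W) (M j : ℕ) :
    ∑ m ∈ Finset.range (M + 1), levelSum κ m (fun l => W l * if endpoint 0 l = j then 1 else 0) ≤
      C ^ 2 * levelSum κ M fun l => W l * if j ≤ endpoint 0 l then 1 else 0 := by
  calc ∑ m ∈ Finset.range (M + 1),
        levelSum κ m (fun l => W l * if endpoint 0 l = j then 1 else 0)
      ≤ ∑ m ∈ Finset.range (M + 1), C ^ 2 * levelSum κ M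
          (fun l => W l * if endpoint 0 (l.take m) = j then 1 else 0) := by
        refine Finset.sum_le_sum fun m hm => ?_
        -- A path of `m` gaps ending at `j` is prolonged by `M - m` arbitrary gaps. One factor `C`
        -- bounds the mass of the prolongation from below, the other pays for the concatenation.
        rw [Finset.mem_range] at hm
        have h := hW.le_levelSum_add (κ := κ) m (M - m) (fun l => if endpoint 0 l = j then 1 else 0)
          (fun _ => 1) (F := fun l => if endpoint 0 (l.take m) = j then 1 else 0)
          (fun l₁ l₂ h₁ _ => by rw [List.take_left' h₁, mul_one])
        rw [Nat.add_sub_cancel' (by omega)] at h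
        simp only [mul_one] at h
        calc levelSum κ m (fun l => W l * if endpoint 0 l = j then 1 else 0)
            ≤ levelSum κ m (fun l => W l * if endpoint 0 l = j then 1 else 0) *
              (C * levelSum κ (M - m) W) := le_mul_of_one_le_right zero_le (hW.one_le _)
          _ = C * (levelSum κ m (fun l => W l * if endpoint 0 l = j then 1 else 0) *
              levelSum κ (M - m) W) := by ring
          _ ≤ _ := by
            rw [sq, mul_assoc]
            exact mul_le_mul_right h C
    _ = C ^ 2 * levelSum κ M (fun l => ∑ m ∈ Finset.range (M + 1),
          W l * if endpoint 0 (l.take m) = j then 1 else 0) := by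
        rw [levelSum_sum, Finset.mul_sum]
    _ ≤ _ := by
        refine mul_le_mul_right (levelSum_mono fun l hl => ?_) _
        rw [← Finset.mul_sum]
        exact mul_le_mul_right (sum_endpoint_take_le hl j) _

/-- The analogue of the fact that a renewal process hits a given site with probability at most one.
The preceding bound is uniform in `M`: a factor `C ^ 2`, and one more `C` for the mass of the level
`M`. -/
lemma gapSum_endpoint_le (hW : IsCriticalWeight κ C W) (j : ℕ) :
    gapSum κ (fun l => W l * if endpoint 0 l = j then 1 else 0) ≤ C ^ 3 := by
  refine ENNReal.tsum_le_of_sum_range_le fun M => ?_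
  refine (Finset.sum_le_sum_of_subset (Finset.range_mono (Nat.le_succ M))).trans ?_
  refine (hW.sum_levelSum_endpoint_le M j).trans ?_
  rw [pow_succ C 2]
  refine mul_le_mul_right ((levelSum_mono fun l _ => ?_).trans (hW.level_le M)) _
  split_ifs <;> simp

/-- The endpoint is the sum of the `M` gaps. To isolate one gap the list is cut before and after it,
at the cost of `C` for each cut, and the two remaining pieces have mass at most `C` each; hence `C ^
4`. -/
lemma levelSum_endpoint_le (hW : IsCriticalWeight κ C W) (M : ℕ) :
    levelSum κ M (fun l => W l * endpoint 0 l) ≤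
      M * (C ^ 4 * ∑' t, κ t * (W [t] * (t + 1))) := by
  have hterm : ∀ i ∈ Finset.range M, levelSum κ M (fun l => W l * ((l.getD i 0 : ℕ) + 1)) ≤
      C ^ 4 * ∑' t, κ t * (W [t] * (t + 1)) := by
    intro i hi
    rw [Finset.mem_range] at hi
    obtain ⟨n, rfl⟩ : ∃ n, M = i + (1 + n) := ⟨M - i - 1, by omega⟩
    have h1 := hW.levelSum_add_le (κ := κ) i (1 + n) (fun _ => 1) (fun l => ((l.getD 0 0 : ℕ) + 1))
      (F := fun l => ((l.getD i 0 : ℕ) + 1)) (fun l₁ l₂ h₁ _ => by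
        rw [one_mul, List.getD_append_right _ _ _ _ (by omega), h₁, Nat.sub_self])
    have h2 := hW.levelSum_add_le (κ := κ) 1 n (fun l => ((l.getD 0 0 : ℕ) + 1)) (fun _ => 1)
      (F := fun l => ((l.getD 0 0 : ℕ) + 1)) (fun l₁ l₂ h₁ _ => by
        rw [mul_one, List.getD_append _ _ _ _ (by omega)])
    simp only [mul_one] at h1 h2
    have h3 : levelSum κ 1 (fun l => W l * ((l.getD 0 0 : ℕ) + 1)) =
        ∑' t, κ t * (W [t] * (t + 1)) := rfl
    rw [h3] at h2
    calc _ ≤ C * (levelSum κ i W * levelSum κ (1 + n) fun l => W l * ((l.getD 0 0 : ℕ) + 1)) := h1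
      _ ≤ C * (C * (C * ((∑' t, κ t * (W [t] * (t + 1))) * C))) := by
        refine mul_le_mul_right (mul_le_mul' (hW.level_le i) (h2.trans ?_)) _
        exact mul_le_mul_right (mul_le_mul_right (hW.level_le n) _) _
      _ = _ := by ring
  calc levelSum κ M (fun l => W l * endpoint 0 l)
      = levelSum κ M (fun l => ∑ i ∈ Finset.range M, W l * ((l.getD i 0 : ℕ) + 1)) := by
        refine levelSum_congr fun l hl => ?_
        rw [← Finset.mul_sum]
        congr 1
        subst hl
        have hs : ∀ l : List ℕ, ((endpoint 0 l : ℕ) : ℝ≥0∞) =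
            ∑ i ∈ Finset.range l.length, (((l.getD i 0 : ℕ) : ℝ≥0∞) + 1) := by
          intro l
          induction l with
          | nil => simp [endpoint]
          | cons t l ih =>
            rw [List.length_cons, Finset.sum_range_succ']
            simp only [List.getD_cons_succ, List.getD_cons_zero]
            rw [← ih, endpoint_eq, endpoint_eq, List.sum_cons, List.length_cons]
            push_cast
            ring
        exact hs l
    _ = ∑ i ∈ Finset.range M, levelSum κ M (fun l => W l * ((l.getD i 0 : ℕ) + 1)) :=
        levelSum_sum _ _
    _ ≤ _ := by
        refine (Finset.sum_le_sum hterm).trans ?_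
        simp

/-- Configurations with few contacts carry little mass. -/
lemma mul_sum_levelSum_endpoint_le (hW : IsCriticalWeight κ C W) (M j : ℕ) :
    j * ∑ m ∈ Finset.range (M + 1),
      levelSum κ m (fun l => W l * if endpoint 0 l = j then 1 else 0) ≤
      M * (C ^ 6 * ∑' t, κ t * (W [t] * (t + 1))) := by
  calc _ ≤ j * (C ^ 2 * levelSum κ M fun l => W l * if j ≤ endpoint 0 l then 1 else 0) :=
        mul_le_mul_right (hW.sum_levelSum_endpoint_le M j) _
    _ = C ^ 2 * levelSum κ M (fun l => j * (W l * if j ≤ endpoint 0 l then 1 else 0)) := by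
        rw [levelSum_const_mul]; ring
    -- Markov's inequality for the endpoint.
    _ ≤ C ^ 2 * levelSum κ M (fun l => W l * endpoint 0 l) := by
        refine mul_le_mul_right (levelSum_mono fun l _ => ?_) _
        split_ifs with h
        · rw [mul_one, mul_comm]
          exact mul_le_mul_right (by exact_mod_cast h) _
        · simp
    _ ≤ C ^ 2 * (M * (C ^ 4 * ∑' t, κ t * (W [t] * (t + 1)))) :=
        mul_le_mul_right (hW.levelSum_endpoint_le M) _
    _ = _ := by ring

end IsCriticalWeight

/-- A level of large mass makes the total mass infinite, even after a small exponential discount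
of the length. -/
lemma IsAlmostMultiplicative.exists_discount (hW : IsAlmostMultiplicative C W) (hC : 1 ≤ C)
    (hCtop : C ≠ ∞) {m : ℕ} (hm0 : m ≠ 0) (hm : C < levelSum κ m W) :
    ∃ b : ℝ, 0 < b ∧ ∑' n : ℕ, ENNReal.ofReal (Real.exp (-(b * n))) *
      gapSum κ (fun l => W l * if endpoint 0 l = n then 1 else 0) = ∞ := by
  have hdecomp : ∀ m (φ : ℕ → ℝ≥0∞), levelSum κ m (fun l => W l * φ (endpoint 0 l)) =
      ∑' n, φ n * levelSum κ m (fun l => W l * if endpoint 0 l = n then 1 else 0) := by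
    intro m φ
    simp only [← levelSum_const_mul]
    rw [← levelSum_tsum]
    refine levelSum_congr fun l _ => ?_
    rw [tsum_eq_single (endpoint 0 l) fun n hn => by rw [if_neg hn.symm]; simp]
    simp [mul_comm]
  have h1 := hdecomp m fun _ => 1
  simp only [mul_one, one_mul] at h1
  have hm' := hm
  rw [h1, ENNReal.tsum_eq_iSup_nat, lt_iSup_iff] at hm'
  obtain ⟨N, hN⟩ := hm'
  set s := ∑ n ∈ Finset.range N,
    levelSum κ m (fun l => W l * if endpoint 0 l = n then 1 else 0) with hs
  -- Finitely many endpoints, those below `N`, already carry mass above `C` at level `m`. For small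
  -- `b` a discount by at most `exp (-b N)` keeps that mass above `C`.
  have hlim : Tendsto (fun b : ℝ => ENNReal.ofReal (Real.exp (-(b * N))) * s) (𝓝[>] 0)
      (𝓝 (1 * s)) := by
    refine ENNReal.Tendsto.mul_const ?_ (Or.inl one_ne_zero)
    have : Tendsto (fun b : ℝ => ENNReal.ofReal (Real.exp (-(b * N)))) (𝓝[>] 0)
        (𝓝 (ENNReal.ofReal (Real.exp (-(0 * N))))) := by
      refine (Continuous.tendsto ?_ 0).mono_left nhdsWithin_le_nhds
      exact ENNReal.continuous_ofReal.comp (by fun_prop)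
    simpa using this
  rw [one_mul] at hlim
  obtain ⟨b, hb, hb0⟩ := ((hlim.eventually (lt_mem_nhds hN)).and self_mem_nhdsWithin).exists
  replace hb0 : 0 < b := hb0
  refine ⟨b, hb0, ?_⟩
  -- The endpoint is additive under concatenation, so the discounted weight is almost multiplicative
  -- with the same constant.
  set W' : List ℕ → ℝ≥0∞ := fun l => W l * ENNReal.ofReal (Real.exp (-(b * (endpoint 0 l : ℕ))))
    with hW'
  have hend : ∀ l₁ l₂ : List ℕ, ENNReal.ofReal (Real.exp (-(b * (endpoint 0 (l₁ ++ l₂) : ℕ)))) =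
      ENNReal.ofReal (Real.exp (-(b * (endpoint 0 l₁ : ℕ)))) *
        ENNReal.ofReal (Real.exp (-(b * (endpoint 0 l₂ : ℕ)))) := by
    intro l₁ l₂
    rw [← ENNReal.ofReal_mul (by positivity), ← Real.exp_add]
    congr 2
    rw [endpoint_eq, endpoint_eq, endpoint_eq]
    simp only [List.sum_append, List.length_append]
    push_cast
    ring
  have hWm : IsAlmostMultiplicative C W' := by
    constructor
    · intro l₁ l₂
      simp only [hW', hend]
      calc _ ≤ C * (W l₁ * W l₂) * _ := mul_le_mul_left (hW.append_le _ _) _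
        _ = _ := by ring
    · intro l₁ l₂
      simp only [hW', hend]
      calc _ = W l₁ * W l₂ * (ENNReal.ofReal (Real.exp (-(b * (endpoint 0 l₁ : ℕ)))) *
            ENNReal.ofReal (Real.exp (-(b * (endpoint 0 l₂ : ℕ))))) := by ring
        _ ≤ C * W (l₁ ++ l₂) * _ := mul_le_mul_left (hW.le_append _ _) _
        _ = _ := by ring
  have hlevel : ∀ n, levelSum κ n W' = ∑' i : ℕ, ENNReal.ofReal (Real.exp (-(b * i))) *
      levelSum κ n (fun l => W l * if endpoint 0 l = i then 1 else 0) := fun n =>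
    hdecomp n fun i => ENNReal.ofReal (Real.exp (-(b * i)))
  have hbig : C < levelSum κ m W' := by
    rw [hlevel]
    refine hb.trans_le ?_
    rw [hs, Finset.mul_sum]
    refine le_trans ?_ (ENNReal.sum_le_tsum (Finset.range N))
    refine Finset.sum_le_sum fun i hi => mul_le_mul_left (ENNReal.ofReal_le_ofReal ?_) _
    rw [Finset.mem_range] at hi
    rw [Real.exp_le_exp]
    have : (i : ℝ) ≤ N := by exact_mod_cast hi.le
    nlinarith
  -- The threshold `C` reproduces itself: the product of two masses at least `C` is at most `C`
  -- times the mass of the joint level. Infinitely many levels of mass at least `C ≥ 1` make the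
  -- total infinite.
  have hmul : ∀ k, C ≤ levelSum κ ((k + 1) * m) W' := by
    intro k
    induction k with
    | zero => rw [zero_add, one_mul]; exact hbig.le
    | succ k ih =>
      have h := hWm.le_levelSum_add (κ := κ) ((k + 1) * m) m (fun _ => 1) (fun _ => 1)
        (F := fun _ => 1) (fun _ _ _ _ => by simp)
      simp only [mul_one] at h
      rw [show (k + 1 + 1) * m = (k + 1) * m + m by ring]
      have h' : C * C ≤ C * levelSum κ ((k + 1) * m + m) W' := (mul_le_mul' ih hbig.le).trans h
      exact (ENNReal.mul_le_mul_iff_right (by positivity) hCtop).1 h'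
  calc _ = ∑' n, levelSum κ n W' := by
        simp only [hlevel, gapSum, ← ENNReal.tsum_mul_left]
        exact ENNReal.tsum_comm
    _ = ∞ := by
        refine top_le_iff.1 ?_
        calc ∞ = ∑' _ : ℕ, (1 : ℝ≥0∞) := by simp
          _ ≤ ∑' k : ℕ, levelSum κ ((k + 1) * m) W' :=
            ENNReal.tsum_le_tsum fun k => hC.trans (hmul k)
          _ ≤ _ := ENNReal.tsum_comp_le_tsum_of_injective (f := fun k => (k + 1) * m)
            (fun i j hij => by simpa using Nat.eq_of_mul_eq_mul_right (Nat.pos_of_ne_zero hm0) hij)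
            _

end Abstract

/-! ### The annealed weights -/

/-- The variance of the sum of the environment over `S`. -/
def energy (ρ : ℕ → ℝ) (S : Finset ℕ) : ℝ := ∑ i ∈ S, ∑ j ∈ S, ρ ((i : ℤ) - j).natAbs

/-- The annealed weight of a sequence of gaps. -/
def annealedWeight (ρ : ℕ → ℝ) (β h : ℝ) (l : List ℕ) : ℝ≥0∞ :=
  ENNReal.ofReal (Real.exp (h * l.length + β ^ 2 / 2 * energy ρ (supp 0 l)))

/-- The mean shift of the environment induced by the contacts in `S`. -/
def contactShift (ρ : ℕ → ℝ) (β : ℝ) (S : Finset ℕ) : ℤ → ℝ :=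
  meanShift ρ S (fun _ => β) (fun k : ℕ => (k : ℤ))

section Energy

variable {ν : Measure (ℤ → ℝ)} {q : ℕ} {ρ : ℕ → ℝ}

lemma combVariance_contacts (ρ : ℕ → ℝ) (β : ℝ) (S : Finset ℕ) :
    combVariance ρ S (fun _ => β) (fun k : ℕ => (k : ℤ)) = β ^ 2 * energy ρ S := by
  simp only [combVariance, meanShift, energy, Finset.mul_sum]
  rw [Finset.sum_comm]
  exact Finset.sum_congr rfl fun i _ => Finset.sum_congr rfl fun j _ => by ring

namespace IsFiniteRangeGaussianDisorder

lemma energy_nonneg (hν : IsDisorderLaw ν q ρ) (S : Finset ℕ) : 0 ≤ energy ρ S := by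
  have h := hν.combVariance_nonneg S (fun _ => 1) (fun k : ℕ => (k : ℤ))
  rwa [combVariance_contacts, one_pow, one_mul] at h

/-- The Boltzmann weight is the exponential of a linear functional of the environment, so
Cameron–Martin turns it into the annealed weight and shifts the environment by `contactShift`. -/
lemma lintegral_boltzmann_mul (hν : IsDisorderLaw ν q ρ) (β h : ℝ) (S : Finset ℕ)
    {F : (ℤ → ℝ) → ℝ≥0∞} (hF : Measurable F) :
    ∫⁻ w, boltzmann β h w S * F w ∂ν =
      ENNReal.ofReal (Real.exp (h * S.card + β ^ 2 / 2 * energy ρ S)) *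
        ∫⁻ w, F (w + contactShift ρ β S) ∂ν := by
  have e : ∀ w : ℤ → ℝ, boltzmann β h w S = ENNReal.ofReal (Real.exp (h * S.card)) *
      ENNReal.ofReal (Real.exp (linComb S (fun _ => β) (fun k : ℕ => (k : ℤ)) w)) := by
    intro w
    rw [← ENNReal.ofReal_mul (by positivity), ← Real.exp_add, boltzmann, Finset.sum_add_distrib]
    simp [linComb, add_comm, mul_comm]
  simp only [e, mul_assoc]
  rw [lintegral_const_mul _ (by fun_prop), hν.lintegral_exp_linComb_mul _ _ _ hF,
    combVariance_contacts, ← mul_assoc, ← ENNReal.ofReal_mul (by positivity), ← Real.exp_add]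
  congr 4
  ring

end IsFiniteRangeGaussianDisorder

lemma energy_supp (ρ : ℕ → ℝ) (a : ℕ) (l : List ℕ) :
    energy ρ (supp a l) = energy ρ (supp 0 l) := by
  have := supp_add a 0 l
  rw [add_zero] at this
  simp [this, energy]

lemma energy_union (ρ : ℕ → ℝ) {S S' : Finset ℕ} (h : Disjoint S S') :
    energy ρ (S ∪ S') = energy ρ S + energy ρ S' +
      2 * ∑ i ∈ S, ∑ j ∈ S', ρ ((i : ℤ) - j).natAbs := by
  simp only [energy, Finset.sum_union h, Finset.sum_add_distrib]
  have : ∑ i ∈ S', ∑ j ∈ S, ρ ((i : ℤ) - j).natAbs = ∑ i ∈ S, ∑ j ∈ S', ρ ((i : ℤ) - j).natAbs := by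
    rw [Finset.sum_comm]
    refine Finset.sum_congr rfl fun i _ => Finset.sum_congr rfl fun j _ => ?_
    rw [show ((j : ℤ) - i).natAbs = ((i : ℤ) - j).natAbs by omega]
  rw [this]
  ring

/-- Only the last `q` sites up to `e` and the first `q` sites after it can be within range of each
other, and each of these at most `q ^ 2` covariances is at most one. -/
lemma abs_cross_le (hν : IsDisorderLaw ν q ρ) {S S' : Finset ℕ} {e : ℕ} (hS : ∀ i ∈ S, i ≤ e)
    (hS' : ∀ j ∈ S', e < j) : |∑ i ∈ S, ∑ j ∈ S', ρ ((i : ℤ) - j).natAbs| ≤ (q : ℝ) ^ 2 := by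
  set A := S.filter fun i => e < i + q with hA
  set B := S'.filter fun j => j ≤ e + q with hB
  have hcA : A.card ≤ q := by
    have : A ⊆ Finset.Icc (e + 1 - q) e := fun i hi => by
      rw [hA, Finset.mem_filter] at hi
      have := hS i hi.1
      rw [Finset.mem_Icc]; omega
    have := Finset.card_le_card this
    rw [Nat.card_Icc] at this; omega
  have hcB : B.card ≤ q := by
    have : B ⊆ Finset.Ioc e (e + q) := fun j hj => by
      rw [hB, Finset.mem_filter] at hj
      have := hS' j hj.1
      rw [Finset.mem_Ioc]; omega
    have := Finset.card_le_card this
    rw [Nat.card_Ioc] at this; omega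
  have h1 : ∑ i ∈ S, ∑ j ∈ S', ρ ((i : ℤ) - j).natAbs =
      ∑ i ∈ A, ∑ j ∈ B, ρ ((i : ℤ) - j).natAbs := by
    rw [hA, Finset.sum_filter]
    refine Finset.sum_congr rfl fun i hi => ?_
    have hi' := hS i hi
    rw [hB, Finset.sum_filter]
    split_ifs with h
    · refine Finset.sum_congr rfl fun j hj => ?_
      have hj' := hS' j hj
      split_ifs with h'
      · rfl
      · exact hν.finite_range _ (by omega)
    · refine Finset.sum_eq_zero fun j hj => ?_
      have hj' := hS' j hj
      exact hν.finite_range _ (by omega)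
  rw [h1]
  calc |∑ i ∈ A, ∑ j ∈ B, ρ ((i : ℤ) - j).natAbs|
      ≤ ∑ i ∈ A, ∑ j ∈ B, (1 : ℝ) := by
        refine (Finset.abs_sum_le_sum_abs _ _).trans (Finset.sum_le_sum fun i _ => ?_)
        exact (Finset.abs_sum_le_sum_abs _ _).trans
          (Finset.sum_le_sum fun j _ => hν.abs_rho_le_one _)
    _ = A.card * B.card := by simp
    _ ≤ q * q := by gcongr
    _ = _ := (sq _).symm

lemma abs_energy_append_le (hν : IsDisorderLaw ν q ρ) (l₁ l₂ : List ℕ) :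
    |energy ρ (supp 0 (l₁ ++ l₂)) - energy ρ (supp 0 l₁) - energy ρ (supp 0 l₂)| ≤
      2 * (q : ℝ) ^ 2 := by
  rw [supp_append, energy_union ρ (disjoint_supp_append 0 l₁ l₂), energy_supp ρ (endpoint 0 l₁)]
  rw [show ∀ a b c : ℝ, a + b + c - a - b = c by intros; ring, abs_mul, abs_two]
  gcongr
  exact abs_cross_le hν (e := endpoint 0 l₁) (fun i hi => (lt_and_le_of_mem_supp hi).2)
    fun j hj => (lt_and_le_of_mem_supp hj).1

/-- The constant of almost multiplicativity of the annealed weights. -/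
def glueConst (q : ℕ) (β : ℝ) : ℝ≥0∞ := ENNReal.ofReal (Real.exp (β ^ 2 * q ^ 2))

lemma one_le_glueConst (q : ℕ) (β : ℝ) : 1 ≤ glueConst q β := by
  rw [glueConst, ENNReal.one_le_ofReal, Real.one_le_exp_iff]
  positivity

lemma glueConst_ne_top (q : ℕ) (β : ℝ) : glueConst q β ≠ ∞ := ENNReal.ofReal_ne_top

lemma isAlmostMultiplicative_annealedWeight (hν : IsDisorderLaw ν q ρ) (β h : ℝ) :
    IsAlmostMultiplicative (glueConst q β) (annealedWeight ρ β h) := by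
  have hβ : 0 ≤ β ^ 2 / 2 := by positivity
  constructor
  · intro l₁ l₂
    have h1 := mul_le_mul_of_nonneg_left (abs_le.1 (abs_energy_append_le hν l₁ l₂)).2 hβ
    simp only [annealedWeight, glueConst]
    rw [← ENNReal.ofReal_mul (by positivity), ← ENNReal.ofReal_mul (by positivity),
      ← Real.exp_add, ← Real.exp_add]
    refine ENNReal.ofReal_le_ofReal (Real.exp_le_exp.2 ?_)
    rw [List.length_append]
    push_cast
    linarith
  · intro l₁ l₂
    have h1 := mul_le_mul_of_nonneg_left (abs_le.1 (abs_energy_append_le hν l₁ l₂)).1 hβ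
    simp only [annealedWeight, glueConst]
    rw [← ENNReal.ofReal_mul (by positivity), ← ENNReal.ofReal_mul (by positivity),
      ← Real.exp_add, ← Real.exp_add]
    refine ENNReal.ofReal_le_ofReal (Real.exp_le_exp.2 ?_)
    rw [List.length_append]
    push_cast
    linarith

lemma annealedWeight_eq_mul (ρ : ℕ → ℝ) (β h h' : ℝ) (l : List ℕ) :
    annealedWeight ρ β h l =
      ENNReal.ofReal (Real.exp ((h - h') * l.length)) * annealedWeight ρ β h' l := by
  rw [annealedWeight, annealedWeight, ← ENNReal.ofReal_mul (by positivity), ← Real.exp_add]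
  congr 2
  ring

lemma levelSum_annealedWeight (κ : ℕ → ℝ≥0∞) (ρ : ℕ → ℝ) (β h h' : ℝ) (m : ℕ) :
    levelSum κ m (annealedWeight ρ β h) =
      ENNReal.ofReal (Real.exp ((h - h') * m)) * levelSum κ m (annealedWeight ρ β h') := by
  rw [← levelSum_const_mul]
  refine levelSum_congr fun l hl => ?_
  rw [annealedWeight_eq_mul ρ β h h', hl]

lemma annealedWeight_singleton (hν : IsDisorderLaw ν q ρ) (β h : ℝ) (t : ℕ) :
    annealedWeight ρ β h [t] = ENNReal.ofReal (Real.exp (h + β ^ 2 / 2)) := by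
  have : energy ρ (supp 0 [t]) = 1 := by
    simp [supp, energy, hν.variance_one]
  simp [annealedWeight, this]

end Energy

/-- A sequence that is additive up to a bounded error is linear up to the same error. -/
theorem exists_abs_sub_mul_le {a : ℕ → ℝ} {c : ℝ}
    (h : ∀ m n, |a (m + n) - a m - a n| ≤ c) : ∃ r : ℝ, ∀ m : ℕ, |a m - r * m| ≤ c := by
  have hc : 0 ≤ c := (abs_nonneg _).trans (h 0 0)
  have h0 : |a 0| ≤ c := by simpa using h 0 0
  have hlin : ∀ n : ℕ, |a n| ≤ n * (|a 1| + c) + c := by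
    intro n
    induction n with
    | zero => simpa using h0
    | succ n ih =>
      have h1 := abs_le.1 (h n 1)
      have h2 := abs_le.1 ih
      have h3 := abs_le.1 (le_refl |a 1|)
      push_cast
      rw [abs_le]
      constructor <;> linarith [h1.1, h1.2, h2.1, h2.2, h3.1, h3.2]
  have hbdd : ∀ u : ℕ → ℝ, (∀ n, |u n| ≤ |a n| + c) →
      BddBelow (Set.range fun n => u n / n) := by
    intro u hu
    refine ⟨-(|a 1| + 3 * c), ?_⟩
    rintro _ ⟨n, rfl⟩
    rcases Nat.eq_zero_or_pos n with rfl | hn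
    · have := abs_nonneg (a 1)
      simp only [CharP.cast_eq_zero, div_zero]
      linarith
    · have hn' : (1 : ℝ) ≤ n := by exact_mod_cast hn
      change -(|a 1| + 3 * c) ≤ u n / n
      rw [le_div_iff₀ (by linarith)]
      have h1 := (abs_le.1 (hu n)).1
      have h2 := hlin n
      nlinarith
  -- Both `a + c` and `c - a` are subadditive. By Fekete's lemma their slopes are limits and lower
  -- bounds of the quotients by `n`; the two slopes are opposite because the sum of the sequences is
  -- constant. The two lower bounds enclose `a`.
  have hs1 : Subadditive fun n => a n + c := fun m n => by
    have := abs_le.1 (h m n); linarith [this.2]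
  have hs2 : Subadditive fun n => c - a n := fun m n => by
    have := abs_le.1 (h m n); linarith [this.1]
  have hb1 := hbdd (fun n => a n + c) fun n => (abs_add_le _ _).trans (by rw [abs_of_nonneg hc])
  have hb2 := hbdd (fun n => c - a n) fun n => (abs_sub _ _).trans (by
    rw [abs_of_nonneg hc, add_comm])
  have ht := (hs1.tendsto_lim hb1).add (hs2.tendsto_lim hb2)
  have ht0 : Tendsto (fun n : ℕ => (a n + c) / n + (c - a n) / n) atTop (𝓝 0) := by
    refine (tendsto_const_div_atTop_nhds_zero_nat (2 * c)).congr fun n => ?_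
    rw [← add_div]; ring
  have hlim := tendsto_nhds_unique ht ht0
  refine ⟨hs1.lim, fun m => ?_⟩
  rcases Nat.eq_zero_or_pos m with rfl | hm
  · simpa using h0
  have hm' : (0 : ℝ) < m := by exact_mod_cast hm
  have h1 := hs1.lim_le_div hb1 hm.ne'
  have h2 := hs2.lim_le_div hb2 hm.ne'
  rw [le_div_iff₀ hm'] at h1 h2
  rw [abs_le]
  have e : hs2.lim = - hs1.lim := by linarith
  rw [e] at h2
  constructor <;> linarith

section Critical

variable {ν : Measure (ℤ → ℝ)} {q : ℕ} {ρ : ℕ → ℝ} {κ : ℕ → ℝ≥0∞}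

lemma levelSum_annealedWeight_one (hν : IsDisorderLaw ν q ρ) (hκ : ∑' t, κ t = 1) (β h : ℝ) :
    levelSum κ 1 (annealedWeight ρ β h) = ENNReal.ofReal (Real.exp (h + β ^ 2 / 2)) := by
  simp only [levelSum, annealedWeight_singleton hν]
  rw [ENNReal.tsum_mul_right, hκ, one_mul]

/-- Existence of the annealed critical parameter, where the mass of all levels is of order one. -/
theorem exists_isCriticalWeight (hν : IsDisorderLaw ν q ρ) (hκ : ∑' t, κ t = 1) (β : ℝ) :
    ∃ h : ℝ, |h| ≤ β ^ 2 * q ^ 2 + β ^ 2 / 2 ∧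
      IsCriticalWeight κ (glueConst q β) (annealedWeight ρ β h) := by
  set v : ℕ → ℝ≥0∞ := fun m => levelSum κ m (annealedWeight ρ β 0) with hv
  have hW := isAlmostMultiplicative_annealedWeight hν β 0
  set C := glueConst q β with hC
  have hup : ∀ m n, v (m + n) ≤ C * (v m * v n) := fun m n => by
    simpa using hW.levelSum_add_le (κ := κ) m n (fun _ => 1) (fun _ => 1) (F := fun _ => 1)
      (fun _ _ _ _ => by simp)
  have hlow : ∀ m n, v m * v n ≤ C * v (m + n) := fun m n => by
    simpa using hW.le_levelSum_add (κ := κ) m n (fun _ => 1) (fun _ => 1) (F := fun _ => 1)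
      (fun _ _ _ _ => by simp)
  -- At `h = 0` the weight is at least one, because the energy is a variance.
  have hone : ∀ m, 1 ≤ v m := fun m => by
    rw [← levelSum_one_eq_one hκ m]
    refine levelSum_mono fun l _ => ?_
    rw [annealedWeight, ENNReal.one_le_ofReal, Real.one_le_exp_iff, zero_mul, zero_add]
    exact mul_nonneg (by positivity) (hν.energy_nonneg _)
  have hv1 : v 1 = ENNReal.ofReal (Real.exp (β ^ 2 / 2)) := by
    simpa using levelSum_annealedWeight_one hν hκ β 0
  have htop : ∀ m, v m ≠ ∞ := by
    intro m
    induction m with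
    | zero => exact ENNReal.ofReal_ne_top
    | succ m ih =>
      refine ne_top_of_le_ne_top ?_ (hup m 1)
      rw [hv1]
      exact ENNReal.mul_ne_top (glueConst_ne_top _ _) (ENNReal.mul_ne_top ih ENNReal.ofReal_ne_top)
  set a : ℕ → ℝ := fun m => Real.log (v m).toReal with ha
  have hva : ∀ m, v m = ENNReal.ofReal (Real.exp (a m)) := fun m => by
    rw [ha]
    simp only
    rw [Real.exp_log, ENNReal.ofReal_toReal (htop m)]
    exact ENNReal.toReal_pos (one_pos.trans_le (hone m)).ne' (htop m)
  have hadd : ∀ m n, |a (m + n) - a m - a n| ≤ β ^ 2 * q ^ 2 := by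
    intro m n
    have h1 := hup m n
    have h2 := hlow m n
    rw [hva, hva, hva, hC, glueConst, ← ENNReal.ofReal_mul (by positivity),
      ← Real.exp_add] at h1 h2
    rw [← ENNReal.ofReal_mul (by positivity), ENNReal.ofReal_le_ofReal_iff (by positivity),
      ← Real.exp_add, Real.exp_le_exp] at h1 h2
    rw [abs_le]
    constructor <;> linarith
  obtain ⟨r, hr⟩ := exists_abs_sub_mul_le hadd
  -- All paths of a level have the same number of contacts, so the parameter `-r` multiplies level
  -- `m` by `exp (-r m)` and leaves only the bounded error.
  have hlev : ∀ m, levelSum κ m (annealedWeight ρ β (-r)) =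
      ENNReal.ofReal (Real.exp (a m - r * m)) := by
    intro m
    rw [levelSum_annealedWeight κ ρ β (-r) 0 m]
    change _ * v m = _
    rw [hva, ← ENNReal.ofReal_mul (by positivity), ← Real.exp_add]
    congr 2
    ring
  refine ⟨-r, ?_, isAlmostMultiplicative_annealedWeight hν β (-r), fun m => ?_, fun m => ?_⟩
  -- The size of `r` is read off the first level, whose logarithmic mass is exactly `β ^ 2 / 2`.
  · have h1 := hr 1
    have ha1 : a 1 = β ^ 2 / 2 := by
      rw [ha]; simp only
      rw [hv1, ENNReal.toReal_ofReal (by positivity), Real.log_exp]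
    rw [ha1, Nat.cast_one, mul_one] at h1
    rw [abs_neg]
    have hb : (0 : ℝ) ≤ β ^ 2 / 2 := by positivity
    rw [abs_le] at h1 ⊢
    constructor <;> linarith [h1.1, h1.2]
  · rw [hlev, hC, glueConst, ← ENNReal.ofReal_mul (by positivity), ← Real.exp_add,
      ENNReal.one_le_ofReal, Real.one_le_exp_iff]
    linarith [(abs_le.1 (hr m)).1]
  · rw [hlev, hC, glueConst]
    exact ENNReal.ofReal_le_ofReal (Real.exp_le_exp.2 (abs_le.1 (hr m)).2)

/-- The annealed point-to-point partition function. -/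
def annealedPinned (κ : ℕ → ℝ≥0∞) (ρ : ℕ → ℝ) (β h : ℝ) (n : ℕ) : ℝ≥0∞ :=
  gapSum κ fun l => annealedWeight ρ β h l * if endpoint 0 l = n then 1 else 0

/-- Each path tilts the environment by its own contacts; an observable of the environment is
therefore evaluated path by path, in a shifted environment. -/
lemma lintegral_pinned_mul (hν : IsDisorderLaw ν q ρ) (β h : ℝ) (n : ℕ)
    {F : (ℤ → ℝ) → ℝ≥0∞} (hF : Measurable F) :
    ∫⁻ w, pinned κ β h w 0 n * F w ∂ν = gapSum κ fun l => annealedWeight ρ β h l *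
      if endpoint 0 l = n then ∫⁻ w, F (w + contactShift ρ β (supp 0 l)) ∂ν else 0 := by
  simp only [pinned, mul_comm _ (F _)]
  simp only [← gapSum_const_mul]
  rw [lintegral_gapSum]
  · congr 1
    ext l
    split_ifs
    · simp only [mul_comm (F _)]
      rw [hν.lintegral_boltzmann_mul β h _ hF, annealedWeight, card_supp]
    · simp
  · intro l
    split_ifs
    · exact hF.mul (measurable_boltzmann _ _ _)
    · simp

lemma lintegral_pinned (hν : IsDisorderLaw ν q ρ) (β h : ℝ) (n : ℕ) :
    ∫⁻ w, pinned κ β h w 0 n ∂ν = annealedPinned κ ρ β h n := by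
  have := hν.isProbabilityMeasure
  simpa [annealedPinned] using lintegral_pinned_mul hν (κ := κ) β h n (F := fun _ => 1)
    measurable_const

/-- A path that ends at `n` has at most `n` contacts. -/
lemma annealedWeight_le_of_endpoint (ρ : ℕ → ℝ) {β h h' : ℝ} (hh : h' ≤ h) {n : ℕ} {l : List ℕ}
    (hl : endpoint 0 l = n) :
    annealedWeight ρ β h l ≤
      ENNReal.ofReal (Real.exp ((h - h') * n)) * annealedWeight ρ β h' l := by
  rw [annealedWeight_eq_mul ρ β h h']
  refine mul_le_mul_left (ENNReal.ofReal_le_ofReal (Real.exp_le_exp.2 ?_)) _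
  have : l.length ≤ n := by rw [← hl, endpoint_eq]; omega
  have : (l.length : ℝ) ≤ n := by exact_mod_cast this
  exact mul_le_mul_of_nonneg_left this (by linarith)

lemma annealedPinned_le (ρ : ℕ → ℝ) {β h h' : ℝ} (hh : h' ≤ h) (n : ℕ) :
    annealedPinned κ ρ β h n ≤
      ENNReal.ofReal (Real.exp ((h - h') * n)) * annealedPinned κ ρ β h' n := by
  rw [annealedPinned, annealedPinned, ← gapSum_const_mul]
  refine gapSum_mono fun l => ?_
  split_ifs with hl
  · simpa using annealedWeight_le_of_endpoint ρ hh hl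
  · simp

end Critical

/-! ### The annealed critical point -/

section Transfer

variable {Ω Ω' : Type*} [MeasurableSpace Ω] [MeasurableSpace Ω'] {μ : Measure Ω}
  {P : Measure Ω'} [IsProbabilityMeasure P] {α : ℝ} {L : ℝ → ℝ} {K : ℕ → ℝ} {T : ℕ → Ω' → ℕ}
  {q : ℕ} {ρ : ℕ → ℝ} {ω : ℤ → Ω → ℝ}

lemma IsFiniteRangeGaussianDisorder.aemeasurable_path
    (hω : IsFiniteRangeGaussianDisorder μ q ρ ω) : AEMeasurable (fun y i => ω i y) μ :=
  aemeasurable_pi_iff.2 fun i => hω.gaussian.aemeasurable i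

/-- The law of the disorder on the space of environments. -/
theorem IsFiniteRangeGaussianDisorder.isDisorderLaw_map
    (hω : IsFiniteRangeGaussianDisorder μ q ρ ω) :
    IsDisorderLaw (μ.map fun y i => ω i y) q ρ := by
  have hm := hω.aemeasurable_path
  refine ⟨⟨fun I => ⟨?_⟩⟩, fun i => ?_, fun i j => ?_, hω.variance_one, hω.finite_range⟩
  · have hI : Measurable (I.restrict (π := fun _ : ℤ => ℝ)) := by fun_prop
    have : (μ.map fun y i => ω i y).map (fun w => I.restrict (π := fun _ : ℤ => ℝ) w) =
        μ.map fun y => I.restrict (π := fun _ : ℤ => ℝ) fun i => ω i y :=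
      AEMeasurable.map_map_of_aemeasurable hI.aemeasurable hm
    have h2 := (hω.gaussian.hasGaussianLaw I).isGaussian_map
    rw [← this] at h2
    exact h2
  · rw [integral_map hm (measurable_pi_apply i).aestronglyMeasurable]
    exact hω.mean_zero i
  · rw [covariance_map (measurable_pi_apply i).aestronglyMeasurable
      (measurable_pi_apply j).aestronglyMeasurable hm]
    exact hω.covariance_eq i j

lemma measurable_partitionFunction (hT : IsInterarrivalSequence P K T)
    (hK : IsInterarrivalLaw α L K) (β h : ℝ) (n : ℕ) :
    Measurable fun w => partitionFunction P T β h w n := by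
  simp only [partitionFunction_eq hT hK]
  exact (measurable_pinned 0 n).ennreal_toReal

lemma pinned_ne_top (hT : IsInterarrivalSequence P K T)
    (hK : IsInterarrivalLaw α L K) (β h : ℝ) (w : ℤ → ℝ) (n : ℕ) :
    pinned (gapWeight K) β h w 0 n ≠ ∞ := by
  rw [← ofReal_partitionFunction hT hK]
  exact ENNReal.ofReal_ne_top

lemma annealedPartitionFunction_eq (hT : IsInterarrivalSequence P K T)
    (hK : IsInterarrivalLaw α L K) (hω : IsFiniteRangeGaussianDisorder μ q ρ ω) (β h : ℝ) (n : ℕ) :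
    annealedPartitionFunction μ P ω T β h n =
      (annealedPinned (gapWeight K) ρ β h n).toReal := by
  rw [annealedPartitionFunction, ← lintegral_pinned hω.isDisorderLaw_map,
    ← integral_toReal (measurable_pinned 0 n).aemeasurable
      (Eventually.of_forall fun w => (pinned_ne_top hT hK β h w n).lt_top),
    integral_map hω.aemeasurable_path (measurable_pinned 0 n).ennreal_toReal.aestronglyMeasurable]
  simp only [partitionFunction_eq hT hK]

end Transfer

section AnnealedCritical

variable {ν : Measure (ℤ → ℝ)} {q : ℕ} {ρ : ℕ → ℝ} {α : ℝ} {L : ℝ → ℝ} {K : ℕ → ℝ}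

lemma endpoint_single {n : ℕ} (hn : 1 ≤ n) : endpoint 0 [n - 1] = n := by
  simp only [endpoint]; omega

lemma le_gapSum_single (κ : ℕ → ℝ≥0∞) (f : List ℕ → ℝ≥0∞) (t : ℕ) : κ t * f [t] ≤ gapSum κ f := by
  calc κ t * f [t] ≤ levelSum κ 1 f := ENNReal.le_tsum (f := fun t => κ t * f [t]) t
    _ ≤ gapSum κ f := ENNReal.le_tsum (f := fun m => levelSum κ m f) 1

lemma le_annealedPinned (hν : IsDisorderLaw ν q ρ) (hK : IsInterarrivalLaw α L K) (β h : ℝ)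
    {n : ℕ} (hn : 1 ≤ n) :
    ENNReal.ofReal (K n * Real.exp (h + β ^ 2 / 2)) ≤
      annealedPinned (gapWeight K) ρ β h n := by
  refine le_trans (le_of_eq ?_) (le_gapSum_single _ _ (n - 1))
  rw [annealedWeight_singleton hν, endpoint_single hn, if_pos rfl, mul_one, gapWeight,
    Nat.sub_add_cancel hn, ENNReal.ofReal_mul]
  have := hK.pos (n - 1)
  rw [Nat.sub_add_cancel hn] at this
  exact this.le

/-- A sequence squeezed between a multiple of the interarrival law and a constant has zero
exponential growth rate. -/
lemma tendsto_log_div_of_le (hK : IsInterarrivalLaw α L K) {u : ℕ → ℝ} {c D : ℝ} (hc : 0 < c)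
    (hlow : ∀ n, 1 ≤ n → K n * c ≤ u n) (hup : ∀ n, u n ≤ D) :
    Tendsto (fun n : ℕ => 1 / (n : ℝ) * Real.log (u n)) atTop (𝓝 0) := by
  have h1 : Tendsto (fun n : ℕ => Real.log (K n) / n + Real.log c / n) atTop (𝓝 0) := by
    simpa using hK.tendsto_log_div.add (tendsto_const_div_atTop_nhds_zero_nat (Real.log c))
  have h2 := tendsto_const_div_atTop_nhds_zero_nat (𝕜 := ℝ) (Real.log D)
  have hpos : ∀ n, 1 ≤ n → 0 < K n := fun n hn => by
    have := hK.pos (n - 1)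
    rwa [Nat.sub_add_cancel hn] at this
  refine tendsto_of_tendsto_of_tendsto_of_le_of_le' h1 h2 ?_ ?_
  · filter_upwards [eventually_ge_atTop 1] with n hn
    rw [← add_div, ← Real.log_mul (hpos n hn).ne' hc.ne', one_div, inv_mul_eq_div]
    gcongr
    · exact mul_pos (hpos n hn) hc
    · exact hlow n hn
  · filter_upwards [eventually_ge_atTop 1] with n hn
    rw [one_div, inv_mul_eq_div]
    gcongr
    · exact (mul_pos (hpos n hn) hc).trans_le (hlow n hn)
    · exact hup n

lemma IsCriticalWeight.annealedPinned_le {κ : ℕ → ℝ≥0∞} {β h₀ : ℝ}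
    (hW : IsCriticalWeight κ (glueConst q β) (annealedWeight ρ β h₀)) (n : ℕ) :
    annealedPinned κ ρ β h₀ n ≤ glueConst q β ^ 3 :=
  hW.gapSum_endpoint_le n

lemma IsCriticalWeight.annealedPinned_ne_top {κ : ℕ → ℝ≥0∞} {β h₀ : ℝ}
    (hW : IsCriticalWeight κ (glueConst q β) (annealedWeight ρ β h₀)) {h : ℝ} (hh : h₀ ≤ h)
    (n : ℕ) : annealedPinned κ ρ β h n ≠ ∞ := by
  refine ne_top_of_le_ne_top ?_ (PinningModel.annealedPinned_le ρ hh n)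
  exact ENNReal.mul_ne_top ENNReal.ofReal_ne_top
    (ne_top_of_le_ne_top (ENNReal.pow_ne_top (glueConst_ne_top _ _)) (hW.annealedPinned_le n))

lemma tendsto_log_annealedPinned (hν : IsDisorderLaw ν q ρ) (hK : IsInterarrivalLaw α L K)
    {β h₀ : ℝ}
    (hW : IsCriticalWeight (gapWeight K) (glueConst q β) (annealedWeight ρ β h₀)) :
    Tendsto (fun n : ℕ => 1 / (n : ℝ) *
      Real.log (annealedPinned (gapWeight K) ρ β h₀ n).toReal) atTop (𝓝 0) := by
  refine tendsto_log_div_of_le hK (c := Real.exp (h₀ + β ^ 2 / 2))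
    (D := (glueConst q β ^ 3).toReal) (Real.exp_pos _) (fun n hn => ?_) fun n => ?_
  · exact (ENNReal.ofReal_le_iff_le_toReal (hW.annealedPinned_ne_top le_rfl n)).1
      (le_annealedPinned hν hK β h₀ hn)
  · exact ENNReal.toReal_mono (ENNReal.pow_ne_top (glueConst_ne_top _ _))
      (hW.annealedPinned_le n)

/-- Above `h₀` the mass of level `m` is at least `exp ((h - h₀) m) / C`, so some level exceeds `C`
and `exists_discount` makes a discounted sum of the partition functions diverge. A vanishing growth
rate would bound that sum by a geometric series. -/
lemma le_of_tendsto_log_annealedPinned (hν : IsDisorderLaw ν q ρ)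
    {β h₀ h : ℝ}
    (hW : IsCriticalWeight (gapWeight K) (glueConst q β) (annealedWeight ρ β h₀))
    (ht : Tendsto (fun n : ℕ => 1 / (n : ℝ) *
      Real.log (annealedPinned (gapWeight K) ρ β h n).toReal) atTop (𝓝 0)) : h ≤ h₀ := by
  by_contra! hh
  set C := glueConst q β with hC
  have hC1 : 1 ≤ C := one_le_glueConst q β
  have hC0 : C ≠ 0 := (one_pos.trans_le hC1).ne'
  have hCt : C ≠ ∞ := glueConst_ne_top q β
  obtain ⟨m, hm0, hm⟩ : ∃ m : ℕ, m ≠ 0 ∧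
      C < levelSum (gapWeight K) m (annealedWeight ρ β h) := by
    have hlim : Tendsto (fun m : ℕ => Real.exp ((h - h₀) * m)) atTop atTop :=
      Real.tendsto_exp_atTop.comp
        (tendsto_natCast_atTop_atTop.const_mul_atTop (by linarith))
    obtain ⟨m, hm, hm1⟩ := ((hlim.eventually_gt_atTop (C * C).toReal).and
      (eventually_ge_atTop 1)).exists
    refine ⟨m, by omega, ?_⟩
    have h1 : C * C < ENNReal.ofReal (Real.exp ((h - h₀) * m)) := by
      rwa [ENNReal.lt_ofReal_iff_toReal_lt (ENNReal.mul_ne_top hCt hCt)]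
    rw [levelSum_annealedWeight _ ρ β h h₀]
    refine (ENNReal.mul_lt_mul_iff_right hC0 hCt).1 ?_
    calc C * C < ENNReal.ofReal (Real.exp ((h - h₀) * m)) := h1
      _ ≤ ENNReal.ofReal (Real.exp ((h - h₀) * m)) *
          (C * levelSum (gapWeight K) m (annealedWeight ρ β h₀)) :=
        le_mul_of_one_le_right zero_le (hW.one_le m)
      _ = _ := by ring
  obtain ⟨b, hb, hsum⟩ := (isAlmostMultiplicative_annealedWeight hν β h).exists_discount
    hC1 hCt hm0 hm
  obtain ⟨N, hN⟩ := eventually_atTop.1 (ht.eventually (gt_mem_nhds (half_pos hb)))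
  set U : ℕ → ℝ≥0∞ := fun n => annealedPinned (gapWeight K) ρ β h n with hU
  have hUt : ∀ n, U n ≠ ∞ := fun n => hW.annealedPinned_ne_top hh.le n
  have hle : ∀ n, max N 1 ≤ n → ENNReal.ofReal (Real.exp (-(b * n))) * U n ≤
      ENNReal.ofReal (Real.exp (-(b / 2)) ^ n) := by
    intro n hn
    have hn0 : (0 : ℝ) < n := by
      have : 1 ≤ n := le_of_max_le_right hn
      exact_mod_cast this
    have h1 := hN n (le_of_max_le_left hn)
    rw [one_div, inv_mul_eq_div, div_lt_iff₀ hn0] at h1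
    rw [← ENNReal.ofReal_toReal (hUt n), ← ENNReal.ofReal_mul (by positivity)]
    refine ENNReal.ofReal_le_ofReal ?_
    rcases (ENNReal.toReal_nonneg (a := U n)).eq_or_lt with h0 | h0
    · rw [← h0, mul_zero]; positivity
    · rw [← Real.exp_log h0, ← Real.exp_add, ← Real.exp_nat_mul, Real.exp_le_exp]
      change Real.log (U n).toReal < _ at h1
      linarith
  have hfin : ∑' n : ℕ, ENNReal.ofReal (Real.exp (-(b * n))) * U n ≠ ∞ := by
    rw [← Summable.sum_add_tsum_nat_add' (k := max N 1) ENNReal.summable]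
    refine ENNReal.add_ne_top.2 ⟨?_, ?_⟩
    · exact ENNReal.sum_ne_top.2 fun n _ => ENNReal.mul_ne_top ENNReal.ofReal_ne_top (hUt n)
    · have hgeo : Summable fun n : ℕ => Real.exp (-(b / 2)) ^ (n + max N 1) :=
        (summable_nat_add_iff (max N 1)).2 (summable_geometric_of_lt_one (by positivity)
          (by rw [Real.exp_lt_one_iff]; linarith))
      refine ne_top_of_le_ne_top hgeo.tsum_ofReal_ne_top ?_
      exact ENNReal.tsum_le_tsum fun n => hle _ (by omega)
  exact hfin hsum

end AnnealedCritical

section AnnealedLUB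

variable {Ω Ω' : Type*} [MeasurableSpace Ω] [MeasurableSpace Ω'] {μ : Measure Ω}
  {P : Measure Ω'} [IsProbabilityMeasure P] {α : ℝ} {L : ℝ → ℝ} {K : ℕ → ℝ} {T : ℕ → Ω' → ℕ}
  {q : ℕ} {ρ : ℕ → ℝ} {ω : ℤ → Ω → ℝ}

theorem isLUB_annealedDelocalized (hT : IsInterarrivalSequence P K T)
    (hK : IsInterarrivalLaw α L K) (hω : IsFiniteRangeGaussianDisorder μ q ρ ω) {β h₀ : ℝ}
    (hW : IsCriticalWeight (gapWeight K) (glueConst q β) (annealedWeight ρ β h₀)) :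
    IsLUB (annealedDelocalized μ P ω T β) h₀ := by
  have e : ∀ h, HasAnnealedFreeEnergy μ P ω T β h 0 ↔ Tendsto (fun n : ℕ => 1 / (n : ℝ) *
      Real.log (annealedPinned (gapWeight K) ρ β h n).toReal) atTop (𝓝 0) := fun h => by
    simp only [HasAnnealedFreeEnergy, annealedPartitionFunction_eq hT hK hω]
  have hν := hω.isDisorderLaw_map
  refine IsGreatest.isLUB ⟨(e h₀).2 (tendsto_log_annealedPinned hν hK hW), fun h hh => ?_⟩
  exact le_of_tendsto_log_annealedPinned hν hW ((e h).1 hh)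

lemma annealedCriticalPoint_eq (hT : IsInterarrivalSequence P K T)
    (hK : IsInterarrivalLaw α L K) (hω : IsFiniteRangeGaussianDisorder μ q ρ ω) {β h₀ : ℝ}
    (hW : IsCriticalWeight (gapWeight K) (glueConst q β) (annealedWeight ρ β h₀)) :
    annealedCriticalPoint μ P ω T β = h₀ := by
  have h := isLUB_annealedDelocalized hT hK hω hW
  refine h.csSup_eq ⟨h₀, ?_⟩
  simp only [annealedDelocalized, Set.mem_ofPred_eq, HasAnnealedFreeEnergy,
    annealedPartitionFunction_eq hT hK hω]
  exact tendsto_log_annealedPinned hω.isDisorderLaw_map hK hW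

end AnnealedLUB

/-! ### The quenched free energy -/

section Quenched

variable {Ω Ω' : Type*} [MeasurableSpace Ω] [MeasurableSpace Ω'] {μ : Measure Ω}
  {P : Measure Ω'} [IsProbabilityMeasure P] {α : ℝ} {L : ℝ → ℝ} {K : ℕ → ℝ} {T : ℕ → Ω' → ℕ}
  {q : ℕ} {ρ : ℕ → ℝ} {ω : ℤ → Ω → ℝ} {ν : Measure (ℤ → ℝ)}

lemma measurable_log_partitionFunction (hT : IsInterarrivalSequence P K T)
    (hK : IsInterarrivalLaw α L K) (β h : ℝ) (n : ℕ) :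
    Measurable fun w => 1 / (n : ℝ) * Real.log (partitionFunction P T β h w n) :=
  ((measurable_partitionFunction hT hK β h n).log).const_mul _

lemma hasQuenchedFreeEnergy_of_map (hT : IsInterarrivalSequence P K T)
    (hK : IsInterarrivalLaw α L K) (hω : IsFiniteRangeGaussianDisorder μ q ρ ω) {β h : ℝ}
    (H : HasQuenchedFreeEnergy (μ.map fun y i => ω i y) P (fun i w => w i) T β h 0) :
    HasQuenchedFreeEnergy μ P ω T β h 0 := by
  refine ⟨ae_of_ae_map hω.aemeasurable_path H.1, H.2.congr fun n => ?_⟩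
  rw [eLpNorm_map_measure
    ((measurable_log_partitionFunction hT hK β h n).sub_const 0).aestronglyMeasurable
    hω.aemeasurable_path]
  rfl

lemma le_partitionFunction (hT : IsInterarrivalSequence P K T)
    (hK : IsInterarrivalLaw α L K) (β h : ℝ) (w : ℤ → ℝ) {n : ℕ} (hn : 1 ≤ n) :
    K n * Real.exp (β * w n + h) ≤ partitionFunction P T β h w n := by
  rw [partitionFunction_eq hT hK, ← ENNReal.ofReal_le_iff_le_toReal (pinned_ne_top hT hK β h w n)]
  refine le_trans (le_of_eq ?_) (le_gapSum_single _ _ (n - 1))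
  have hpos := hK.pos (n - 1)
  rw [Nat.sub_add_cancel hn] at hpos
  rw [endpoint_single hn, if_pos rfl, gapWeight, Nat.sub_add_cancel hn, ENNReal.ofReal_mul hpos.le,
    boltzmann]
  simp only [supp, zero_add, Nat.sub_add_cancel hn]
  simp

/-- A uniform bound on a fractional moment of the partition function forces delocalization. -/
theorem hasQuenchedFreeEnergy_of_lintegral_rpow_le (hT : IsInterarrivalSequence P K T)
    (hK : IsInterarrivalLaw α L K) (hν : IsDisorderLaw ν q ρ) {β h γ : ℝ} (hγ : 0 < γ)
    {D : ℝ≥0∞} (hD : D ≠ ∞)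
    (hbound : ∀ n, ∫⁻ w, pinned (gapWeight K) β h w 0 n ^ γ ∂ν ≤ D) :
    HasQuenchedFreeEnergy ν P (fun i w => w i) T β h 0 := by
  have := hν.isProbabilityMeasure
  have hKpos : ∀ n, 1 ≤ n → 0 < K n := fun n hn => by
    have := hK.pos (n - 1)
    rwa [Nat.sub_add_cancel hn] at this
  set Z : ℕ → (ℤ → ℝ) → ℝ := fun n w => partitionFunction P T β h w n with hZ
  have hZp : ∀ n w, pinned (gapWeight K) β h w 0 n = ENNReal.ofReal (Z n w) := fun n w =>
    (ofReal_partitionFunction hT hK β h w n).symm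
  have hZlow : ∀ n w, 1 ≤ n → Real.log (K n) + (β * w n + h) ≤ Real.log (Z n w) := by
    intro n w hn
    have h1 := hKpos n hn
    rw [← Real.log_exp (β * w n + h), ← Real.log_mul h1.ne' (Real.exp_pos _).ne']
    exact Real.log_le_log (mul_pos h1 (Real.exp_pos _)) (le_partitionFunction hT hK β h w hn)
  have hZpos : ∀ n w, 1 ≤ n → 0 < Z n w := fun n w hn =>
    (mul_pos (hKpos n hn) (Real.exp_pos _)).trans_le (le_partitionFunction hT hK β h w hn)
  have hZrpow : ∀ n w, 1 ≤ n → pinned (gapWeight K) β h w 0 n ^ γ =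
      ENNReal.ofReal (Z n w ^ γ) := fun n w hn => by
    rw [hZp, ENNReal.ofReal_rpow_of_pos (hZpos n w hn)]
  have hmeas : ∀ n, Measurable fun w => pinned (gapWeight K) β h w 0 n ^ γ := fun n =>
    (measurable_pinned 0 n).pow_const γ
  constructor
  -- A Borel–Cantelli argument: `∑ exp (-γ ε n) Z_n ^ γ` has finite mean, so almost surely its terms
  -- tend to zero and eventually `log Z_n ≤ ε n`.
  · have hupper : ∀ᵐ w ∂ν, ∀ k : ℕ, ∀ᶠ n : ℕ in atTop,
        1 / (n : ℝ) * Real.log (Z n w) ≤ 1 / ((k : ℝ) + 1) := by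
      rw [ae_all_iff]
      intro k
      set ε : ℝ := 1 / ((k : ℝ) + 1) with hε
      have hε0 : 0 < ε := by positivity
      have hfin : ∫⁻ w, ∑' n : ℕ, pinned (gapWeight K) β h w 0 n ^ γ *
          ENNReal.ofReal (Real.exp (-(γ * ε)) ^ n) ∂ν ≠ ∞ := by
        rw [lintegral_tsum fun n => ((hmeas n).mul_const _).aemeasurable]
        have hle : ∀ n, ∫⁻ w, pinned (gapWeight K) β h w 0 n ^ γ *
            ENNReal.ofReal (Real.exp (-(γ * ε)) ^ n) ∂ν ≤
            D * ENNReal.ofReal (Real.exp (-(γ * ε)) ^ n) := fun n => by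
          rw [lintegral_mul_const _ (hmeas n)]
          exact mul_le_mul_left (hbound n) _
        refine ne_top_of_le_ne_top ?_ (ENNReal.tsum_le_tsum hle)
        rw [ENNReal.tsum_mul_left]
        refine ENNReal.mul_ne_top hD (Summable.tsum_ofReal_ne_top ?_)
        refine summable_geometric_of_lt_one (by positivity) ?_
        rw [Real.exp_lt_one_iff]
        have := mul_pos hγ hε0
        linarith
      have hae := ae_lt_top (Measurable.tsum fun n => (hmeas n).mul_const _) hfin
      filter_upwards [hae] with w hw
      have ht := ENNReal.tendsto_atTop_zero_of_tsum_ne_top hw.ne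
      filter_upwards [ht.eventually (gt_mem_nhds one_pos), eventually_ge_atTop 1] with n h1 hn
      rw [hZrpow n w hn, ← ENNReal.ofReal_mul (by have := hZpos n w hn; positivity),
        ENNReal.ofReal_lt_one, ← Real.exp_nat_mul, Real.rpow_def_of_pos (hZpos n w hn),
        ← Real.exp_add, Real.exp_lt_one_iff] at h1
      have hn0 : (0 : ℝ) < n := by exact_mod_cast hn
      rw [one_div, inv_mul_eq_div, div_le_iff₀ hn0]
      have h2 : γ * (Real.log (Z n w) - ε * n) < γ * 0 := by linarith
      linarith [lt_of_mul_lt_mul_left h2 hγ.le]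
    -- The path with a single gap bounds `log Z_n` below by `log K(n) + β ω_n + h`. The term `ω_n /
    -- n` vanishes in the limit because the sum of its second moments is finite.
    have hlower : ∀ᵐ w : ℤ → ℝ ∂ν, Tendsto (fun n : ℕ => w n / (n : ℝ)) atTop (𝓝 0) := by
      have hfin : ∫⁻ w : ℤ → ℝ, ∑' n : ℕ, ENNReal.ofReal ((w n / (n : ℝ)) ^ 2) ∂ν ≠ ∞ := by
        have hm : ∀ n : ℕ, Measurable fun w : ℤ → ℝ => ENNReal.ofReal ((w n / (n : ℝ)) ^ 2) := fun n =>
          (((measurable_pi_apply (n : ℤ)).div_const _).pow_const 2).ennreal_ofReal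
        rw [lintegral_tsum fun n => (hm n).aemeasurable]
        have hle : ∀ n : ℕ, ∫⁻ w : ℤ → ℝ, ENNReal.ofReal ((w n / (n : ℝ)) ^ 2) ∂ν =
            ENNReal.ofReal (1 / (n : ℝ) ^ 2) := fun n => by
          rw [← ofReal_integral_eq_lintegral_ofReal]
          · simp only [div_pow]
            rw [integral_div, hν.integral_sq]
          · simp only [div_pow]
            exact ((hν.memLp_sq n).integrable (by norm_num)).div_const _
          · exact Eventually.of_forall fun w => sq_nonneg _
        simp only [hle]
        exact Summable.tsum_ofReal_ne_top (Real.summable_one_div_nat_pow.2 (by norm_num))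
      have hae := ae_lt_top (Measurable.tsum fun n : ℕ =>
        (((measurable_pi_apply (n : ℤ)).div_const _).pow_const 2).ennreal_ofReal) hfin
      filter_upwards [hae] with w hw
      have ht := ENNReal.tendsto_atTop_zero_of_tsum_ne_top hw.ne
      have ht2 : Tendsto (fun n : ℕ => (w n / n) ^ 2) atTop (𝓝 0) := by
        have := (ENNReal.tendsto_toReal ENNReal.zero_ne_top).comp ht
        refine this.congr fun n => ?_
        simp [ENNReal.toReal_ofReal, sq_nonneg]
      have ht3 := ht2.sqrt
      simp only [Real.sqrt_sq_eq_abs, Real.sqrt_zero] at ht3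
      exact (tendsto_zero_iff_abs_tendsto_zero _).2 ht3
    filter_upwards [hupper, hlower] with w hw1 hw2
    have hlow : Tendsto (fun n : ℕ => Real.log (K n) / n + β * (w n / n) + h / n) atTop (𝓝 0) := by
      simpa using (hK.tendsto_log_div.add (hw2.const_mul β)).add
        (tendsto_const_div_atTop_nhds_zero_nat h)
    refine tendsto_order.2 ⟨fun a ha => ?_, fun a ha => ?_⟩
    · filter_upwards [hlow.eventually (lt_mem_nhds ha), eventually_ge_atTop 1] with n h1 hn
      refine h1.trans_le ?_
      have hn0 : (0 : ℝ) < n := by exact_mod_cast hn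
      rw [one_div, inv_mul_eq_div, ← mul_div_assoc, ← add_div, ← add_div]
      gcongr
      have := hZlow n w hn
      linarith
    · obtain ⟨k, hk⟩ := exists_nat_one_div_lt ha
      filter_upwards [hw1 k] with n hn
      exact hn.trans_lt hk
  -- From above `log z ≤ z ^ γ / γ`, from below the path with a single gap. The constant `2 |β|` is
  -- the mean of `|β| (1 + ω_n ^ 2)`, which dominates `|β ω_n|`.
  · have hL1 : ∀ n : ℕ, 1 ≤ n → eLpNorm (fun w : ℤ → ℝ => 1 / (n : ℝ) * Real.log (Z n w) - 0) 1 ν ≤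
        ENNReal.ofReal (1 / n) * (ENNReal.ofReal (1 / γ) * D) +
          ENNReal.ofReal (|Real.log (K n) / n| + (|h| + 2 * |β|) / n) := by
      intro n hn
      have hn0 : (0 : ℝ) < n := by exact_mod_cast hn
      have hpt : ∀ w : ℤ → ℝ, ‖1 / (n : ℝ) * Real.log (Z n w) - 0‖ₑ ≤
          ENNReal.ofReal (1 / n) * (ENNReal.ofReal (1 / γ) * pinned (gapWeight K) β h w 0 n ^ γ) +
          ENNReal.ofReal (|Real.log (K n) / n| + (|h| + |β| * (1 + w n ^ 2)) / n) := by
        intro w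
        have hz := hZpos n w hn
        rw [hZrpow n w hn, ← ENNReal.ofReal_mul (by positivity),
          ← ENNReal.ofReal_mul (by positivity), ← ENNReal.ofReal_add (by positivity)
          (by positivity), Real.enorm_eq_ofReal_abs]
        refine ENNReal.ofReal_le_ofReal ?_
        have hlogle : Real.log (Z n w) ≤ 1 / γ * Z n w ^ γ := by
          have := Real.log_le_rpow_div hz.le hγ
          rwa [one_div, inv_mul_eq_div]
        have hlogge := hZlow n w hn
        have hw : |w n| ≤ 1 + w n ^ 2 := by
          rw [abs_le]
          constructor <;> nlinarith [sq_nonneg (w n - 1), sq_nonneg (w n + 1)]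
        have hb : |β * w n| ≤ |β| * (1 + w n ^ 2) := by
          rw [abs_mul]; gcongr
        have habs : |Real.log (Z n w)| ≤ 1 / γ * Z n w ^ γ +
            (|Real.log (K n)| + (|h| + |β| * (1 + w n ^ 2))) := by
          have hp : 0 ≤ 1 / γ * Z n w ^ γ := by positivity
          rw [abs_le]
          constructor
          · linarith [neg_abs_le (Real.log (K n)), neg_abs_le h, neg_abs_le (β * w n)]
          · linarith [abs_nonneg (Real.log (K n)), abs_nonneg h,
              mul_nonneg (abs_nonneg β) (by positivity : (0 : ℝ) ≤ 1 + w n ^ 2)]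
        rw [sub_zero, abs_mul, abs_of_pos (by positivity : (0 : ℝ) < 1 / n), abs_div,
          abs_of_pos hn0]
        refine (mul_le_mul_of_nonneg_left habs (by positivity)).trans (le_of_eq ?_)
        ring
      rw [eLpNorm_one_eq_lintegral_enorm]
      refine (lintegral_mono hpt).trans ?_
      rw [lintegral_add_left (((hmeas n).const_mul _).const_mul _),
        lintegral_const_mul _ ((hmeas n).const_mul _), lintegral_const_mul _ (hmeas n)]
      refine add_le_add (mul_le_mul_right (mul_le_mul_right (hbound n) _) _) (le_of_eq ?_)
      have hint : Integrable (fun w : ℤ → ℝ => w n ^ 2) ν :=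
        (hν.memLp_sq n).integrable (by norm_num)
      rw [← ofReal_integral_eq_lintegral_ofReal]
      · congr 1
        rw [integral_add (integrable_const _) (by fun_prop), integral_div,
          integral_add (integrable_const _) (by fun_prop), integral_const_mul,
          integral_add (integrable_const _) hint, hν.integral_sq]
        simp
        ring
      · fun_prop
      · exact Eventually.of_forall fun w => by positivity
    have hlim : Tendsto (fun n : ℕ => ENNReal.ofReal (1 / n) * (ENNReal.ofReal (1 / γ) * D) +
          ENNReal.ofReal (|Real.log (K n) / n| + (|h| + 2 * |β|) / n)) atTop (𝓝 0) := by
      have h1 : Tendsto (fun n : ℕ => ENNReal.ofReal (1 / (n : ℝ))) atTop (𝓝 (ENNReal.ofReal 0)) :=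
        ENNReal.tendsto_ofReal (tendsto_const_div_atTop_nhds_zero_nat 1)
      have h2 : Tendsto (fun n : ℕ => ENNReal.ofReal
          (|Real.log (K n) / n| + (|h| + 2 * |β|) / n)) atTop (𝓝 (ENNReal.ofReal (|0| + 0))) :=
        ENNReal.tendsto_ofReal (hK.tendsto_log_div.abs.add
          (tendsto_const_div_atTop_nhds_zero_nat _))
      have h3 := (ENNReal.Tendsto.mul_const (b := ENNReal.ofReal (1 / γ) * D) h1
        (Or.inr (ENNReal.mul_ne_top ENNReal.ofReal_ne_top hD))).add h2
      simpa using h3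
    refine tendsto_of_tendsto_of_tendsto_of_le_of_le' tendsto_const_nhds hlim
      (Eventually.of_forall fun n => zero_le) ?_
    filter_upwards [eventually_ge_atTop 1] with n hn using hL1 n hn

/-- Only the path that touches every site is kept. -/
lemma le_partitionFunction_unit_gaps (hT : IsInterarrivalSequence P K T)
    (hK : IsInterarrivalLaw α L K) (β h : ℝ) (w : ℤ → ℝ) (n : ℕ) :
    K 1 ^ n * Real.exp (∑ k ∈ Finset.Icc 1 n, (β * w k + h)) ≤ partitionFunction P T β h w n := by
  have hK1 : 0 < K 1 := hK.pos 0
  rw [partitionFunction_eq hT hK, ← ENNReal.ofReal_le_iff_le_toReal (pinned_ne_top hT hK β h w n)]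
  have key : ∀ d a, a + d = n → ENNReal.ofReal (K 1 ^ d *
      Real.exp (∑ k ∈ Finset.Icc (a + 1) n, (β * w k + h))) ≤
        pinned (gapWeight K) β h w a n := by
    intro d
    induction d with
    | zero =>
      intro a ha
      rw [add_zero] at ha
      subst ha
      simp [pinned_self]
    | succ d ih =>
      intro a ha
      have h1 := ih (a + 1) (by omega)
      rw [pinned_eq]
      refine le_trans ?_ le_add_self
      refine le_trans ?_ (ENNReal.le_tsum 0)
      rw [add_zero]
      refine le_trans (le_of_eq ?_) (mul_le_mul_right (mul_le_mul_right h1 _) _)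
      rw [gapWeight, boltzmann, ← ENNReal.ofReal_mul (by positivity),
        ← ENNReal.ofReal_mul hK1.le, Finset.sum_singleton]
      congr 1
      rw [← Finset.insert_Icc_succ_left_eq_Icc (show a + 1 ≤ n by omega),
        Finset.sum_insert (by simp), Real.exp_add]
      simp only [Order.succ_eq_add_one]
      push_cast
      ring
  simpa using key n 0 (by omega)

/-- The quenched delocalized phase is bounded above. -/
theorem le_neg_log_of_mem_quenchedDelocalized (hT : IsInterarrivalSequence P K T)
    (hK : IsInterarrivalLaw α L K) (hω : IsFiniteRangeGaussianDisorder μ q ρ ω) {β h : ℝ}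
    (H : HasQuenchedFreeEnergy μ P ω T β h 0) : h ≤ -Real.log (K 1) := by
  by_contra! hh
  have hK1 : 0 < K 1 := hK.pos 0
  set ε := Real.log (K 1) + h with hε
  have hε0 : 0 < ε := by linarith
  have hprob : IsProbabilityMeasure μ := hω.gaussian.isProbabilityMeasure
  have hint : ∀ i, Integrable (ω i) μ := fun i =>
    ((hω.gaussian.hasGaussianLaw_eval i).memLp_two).integrable (by norm_num)
  -- The path with unit gaps bounds `(1 / n) log Z_n` below by a variable of mean `ε`, so the `L¹`
  -- norm cannot fall below `ε`.
  have hlow : ∀ n : ℕ, 1 ≤ n → ENNReal.ofReal ε ≤ eLpNorm (fun y => 1 / (n : ℝ) *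
      Real.log (partitionFunction P T β h (fun i => ω i y) n) - 0) 1 μ := by
    intro n hn
    have hn0 : (0 : ℝ) < n := by exact_mod_cast hn
    rw [eLpNorm_one_eq_lintegral_enorm]
    have hI : Integrable (fun y => 1 / (n : ℝ) * ∑ k ∈ Finset.Icc 1 n, β * ω k y + ε) μ :=
      ((integrable_finsetSum _ fun (k : ℕ) _ => (hint k).const_mul β).const_mul _).add
        (integrable_const _)
    have hval : ∫ y, (1 / (n : ℝ) * ∑ k ∈ Finset.Icc 1 n, β * ω k y + ε) ∂μ = ε := by
      rw [integral_add ((integrable_finsetSum _ fun (k : ℕ) _ => (hint k).const_mul β).const_mul _)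
        (integrable_const _), integral_const_mul,
        integral_finsetSum _ fun (k : ℕ) _ => (hint k).const_mul β]
      simp [integral_const_mul, hω.mean_zero]
    calc ENNReal.ofReal ε
        = ENNReal.ofReal (∫ y, (1 / (n : ℝ) * ∑ k ∈ Finset.Icc 1 n, β * ω k y + ε) ∂μ) := by
          rw [hval]
      _ ≤ ∫⁻ y, ENNReal.ofReal (1 / (n : ℝ) * ∑ k ∈ Finset.Icc 1 n, β * ω k y + ε) ∂μ := by
          rw [integral_eq_lintegral_pos_part_sub_lintegral_neg_part hI]
          refine (ENNReal.ofReal_le_ofReal (sub_le_self _ ENNReal.toReal_nonneg)).trans ?_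
          exact ENNReal.ofReal_toReal_le
      _ ≤ _ := by
          refine lintegral_mono fun y => ?_
          rw [Real.enorm_eq_ofReal_abs]
          refine ENNReal.ofReal_le_ofReal (le_trans ?_ (le_abs_self _))
          have h1 := le_partitionFunction_unit_gaps hT hK β h (fun i => ω i y) n
          have h2 := Real.log_le_log (by positivity) h1
          rw [Real.log_mul (by positivity) (by positivity), Real.log_pow, Real.log_exp,
            Finset.sum_add_distrib] at h2
          simp only [Finset.sum_const, Nat.card_Icc, Nat.add_sub_cancel, nsmul_eq_mul] at h2
          have h3 := mul_le_mul_of_nonneg_left h2 (by positivity : (0 : ℝ) ≤ 1 / n)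
          refine le_trans (le_of_eq ?_) (h3.trans_eq (sub_zero _).symm)
          rw [hε]
          field_simp
          ring
  have := ge_of_tendsto H.2 (eventually_atTop.2 ⟨1, hlow⟩)
  rw [nonpos_iff_eq_zero, ENNReal.ofReal_eq_zero] at this
  linarith

end Quenched

/-! ### Fractional moments: the finite volume criterion -/

/-- Subadditivity of `x ^ γ`, first for finite sums and then for their supremum. It lets fractional
moments pass through path decompositions. -/
lemma ENNReal_rpow_tsum_le {ι : Type*} (a : ι → ℝ≥0∞) {γ : ℝ} (h0 : 0 < γ) (h1 : γ ≤ 1) :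
    (∑' i, a i) ^ γ ≤ ∑' i, a i ^ γ := by
  classical
  rw [← ENNReal.le_rpow_inv_iff h0]
  rw [ENNReal.tsum_eq_iSup_sum]
  refine iSup_le fun s => ?_
  rw [ENNReal.le_rpow_inv_iff h0]
  refine le_trans ?_ (ENNReal.sum_le_tsum s)
  induction s using Finset.induction_on with
  | empty => simp [h0]
  | insert i s hi ih =>
    rw [Finset.sum_insert hi, Finset.sum_insert hi]
    exact (ENNReal.rpow_add_le_add_rpow _ _ h0.le h1).trans (add_le_add le_rfl ih)

section PinnedEnvironment

variable {κ : ℕ → ℝ≥0∞} {β h : ℝ}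

lemma pinned_translate (w : ℤ → ℝ) (a n : ℕ) :
    pinned κ β h w a (a + n) = pinned κ β h (fun i => w (a + i)) 0 n := by
  rw [pinned, pinned]
  congr 1
  ext l
  have h1 := endpoint_add a 0 l
  have h2 := supp_add a 0 l
  rw [add_zero] at h1 h2
  rw [h1, h2]
  simp [boltzmann, addLeftEmbedding]

lemma pinned_congr {w w' : ℤ → ℝ} {a b : ℕ}
    (hw : ∀ i : ℤ, a < i → i ≤ b → w i = w' i) :
    pinned κ β h w a b = pinned κ β h w' a b := by
  rw [pinned, pinned]
  congr 1
  ext l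
  split_ifs with hl
  · rw [boltzmann, boltzmann]
    congr 2
    refine Finset.sum_congr rfl fun k hk => ?_
    have := lt_and_le_of_mem_supp hk
    rw [hw k (by omega) (by omega)]
  · rfl

lemma pinned_add_le (hβ : 0 ≤ β) {B : ℝ} (w s : ℤ → ℝ)
    (hs : ∀ S : Finset ℕ, ∑ k ∈ S, |s k| ≤ B) (a b : ℕ) :
    pinned κ β h (w + s) a b ≤ ENNReal.ofReal (Real.exp (β * B)) * pinned κ β h w a b := by
  rw [pinned, pinned, ← gapSum_const_mul]
  refine gapSum_mono fun l => ?_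
  split_ifs
  · rw [boltzmann, boltzmann, ← ENNReal.ofReal_mul (by positivity), ← Real.exp_add]
    refine ENNReal.ofReal_le_ofReal (Real.exp_le_exp.2 ?_)
    have h1 : ∑ k ∈ supp a l, (β * (w + s) k + h) =
        ∑ k ∈ supp a l, (β * w k + h) + β * ∑ k ∈ supp a l, s k := by
      rw [Finset.mul_sum, ← Finset.sum_add_distrib]
      exact Finset.sum_congr rfl fun k _ => by simp; ring
    rw [h1]
    have h2 : ∑ k ∈ supp a l, s k ≤ B :=
      (Finset.sum_le_sum fun k _ => le_abs_self _).trans (hs _)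
    linarith [mul_le_mul_of_nonneg_left h2 hβ]
  · simp

lemma pinned_le_exp (hκ : ∑' t, κ t = 1) (w : ℤ → ℝ) {a b : ℕ} {J : Finset ℕ} (hβ : 0 ≤ β)
    (hJ : Finset.Ioc a b ⊆ J) :
    pinned κ β h w a b ≤ ENNReal.ofReal (Real.exp (∑ k ∈ J, (β * |w k| + |h|))) := by
  set Y := ENNReal.ofReal (Real.exp (∑ k ∈ J, (β * |w k| + |h|))) with hY
  have hle : ∀ l, (if endpoint a l = b then boltzmann β h w (supp a l) else 0) ≤
      Y * if endpoint a l = b then 1 else 0 := by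
    intro l
    split_ifs with hl
    · rw [mul_one, hY, boltzmann]
      refine ENNReal.ofReal_le_ofReal (Real.exp_le_exp.2 ?_)
      calc ∑ k ∈ supp a l, (β * w k + h) ≤ ∑ k ∈ supp a l, (β * |w k| + |h|) :=
            Finset.sum_le_sum fun k _ => add_le_add
              (mul_le_mul_of_nonneg_left (le_abs_self _) hβ) (le_abs_self _)
        _ ≤ _ := by
            refine Finset.sum_le_sum_of_subset_of_nonneg (fun k hk => hJ ?_) fun k _ _ => by
              positivity
            have := lt_and_le_of_mem_supp hk
            rw [Finset.mem_Ioc]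
            omega
    · simp
  refine (gapSum_mono hle).trans ?_
  rw [gapSum_const_mul]
  -- The renewal process without interaction is critical with constant one, so its mass at a given
  -- endpoint is at most one.
  have hcrit : IsCriticalWeight κ 1 (fun _ => 1) :=
    { append_le := fun _ _ => by simp
      le_append := fun _ _ => by simp
      one_le := fun m => by rw [levelSum_one_eq_one hκ, mul_one]
      level_le := fun m => (levelSum_one_eq_one hκ m).le }
  refine mul_le_of_le_one_right zero_le ?_
  rcases le_or_gt a b with hab | hab
  · have := hcrit.gapSum_endpoint_le (b - a)
    simp only [one_mul, one_pow] at this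
    refine le_trans (gapSum_mono fun l => ?_) this
    have h1 := endpoint_eq a l
    have h2 := endpoint_eq 0 l
    split_ifs <;> first | omega | simp
  · refine le_trans (le_of_eq ?_) zero_le_one
    have h0 : gapSum κ (fun _ => 0) = 0 := by simpa using gapSum_const_mul (κ := κ) 0 fun _ => 0
    refine Eq.trans (congrArg (gapSum κ) (funext fun l => if_neg ?_)) h0
    rw [endpoint_eq]
    omega

end PinnedEnvironment

section Decoupling

variable {ν : Measure (ℤ → ℝ)} {q : ℕ} {ρ : ℕ → ℝ} {κ : ℕ → ℝ≥0∞} {β h γ : ℝ}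

/-- The fractional moment of order `γ` of the partition function. -/
def fracMoment (ν : Measure (ℤ → ℝ)) (κ : ℕ → ℝ≥0∞) (β h γ : ℝ) (n : ℕ) : ℝ≥0∞ :=
  ∫⁻ w, pinned κ β h w 0 n ^ γ ∂ν

lemma lintegral_pinned_rpow (hν : IsDisorderLaw ν q ρ) {a b : ℕ} (hab : a ≤ b) :
    ∫⁻ w, pinned κ β h w a b ^ γ ∂ν = fracMoment ν κ β h γ (b - a) := by
  obtain ⟨n, rfl⟩ := Nat.exists_eq_add_of_le hab
  simp only [pinned_translate, Nat.add_sub_cancel_left]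
  rw [fracMoment]
  nth_rewrite 2 [← hν.map_translate a]
  rw [lintegral_map ((measurable_pinned 0 n).pow_const γ)
    (measurable_pi_lambda _ fun i => measurable_pi_apply _)]

lemma sum_abs_meanShift_le (hν : IsDisorderLaw ν q ρ) (J : Finset ℕ) (c : ℕ → ℝ)
    (S : Finset ℕ) : ∑ k ∈ S, |meanShift ρ J c (fun i : ℕ => (i : ℤ)) k| ≤
      (2 * q + 1) * ∑ i ∈ J, |c i| := by
  have hcount : ∀ i : ℕ, ∑ k ∈ S, |ρ ((i : ℤ) - k).natAbs| ≤ 2 * q + 1 := by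
    intro i
    have h1 : ∑ k ∈ S, |ρ ((i : ℤ) - k).natAbs| ≤
        ∑ k ∈ S.filter (fun k : ℕ => ((i : ℤ) - k).natAbs ≤ q), (1 : ℝ) := by
      rw [Finset.sum_filter]
      refine Finset.sum_le_sum fun k _ => ?_
      split_ifs with hk
      · exact hν.abs_rho_le_one _
      · rw [hν.finite_range _ (by omega), abs_zero]
    refine h1.trans ?_
    have h2 : S.filter (fun k : ℕ => ((i : ℤ) - k).natAbs ≤ q) ⊆ Finset.Icc (i - q) (i + q) := by
      intro k hk
      rw [Finset.mem_filter] at hk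
      rw [Finset.mem_Icc]
      omega
    have h3 := Finset.card_le_card h2
    rw [Nat.card_Icc] at h3
    rw [Finset.sum_const, nsmul_eq_mul, mul_one]
    have h4 : (S.filter (fun k : ℕ => ((i : ℤ) - k).natAbs ≤ q)).card ≤ 2 * q + 1 := by omega
    exact_mod_cast h4
  calc ∑ k ∈ S, |meanShift ρ J c (fun i : ℕ => (i : ℤ)) k|
      ≤ ∑ k ∈ S, ∑ i ∈ J, |c i| * |ρ ((i : ℤ) - k).natAbs| := by
        refine Finset.sum_le_sum fun k _ => (Finset.abs_sum_le_sum_abs _ _).trans (le_of_eq ?_)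
        exact Finset.sum_congr rfl fun i _ => abs_mul _ _
    _ = ∑ i ∈ J, |c i| * ∑ k ∈ S, |ρ ((i : ℤ) - k).natAbs| := by
        rw [Finset.sum_comm]
        exact Finset.sum_congr rfl fun i _ => (Finset.mul_sum _ _ _).symm
    _ ≤ ∑ i ∈ J, |c i| * (2 * q + 1) :=
        Finset.sum_le_sum fun i _ => mul_le_mul_of_nonneg_left (hcount i) (abs_nonneg _)
    _ = _ := by rw [← Finset.sum_mul, mul_comm]

lemma combVariance_le_sq (hν : IsDisorderLaw ν q ρ) (J : Finset ℕ) (c : ℕ → ℝ) :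
    combVariance ρ J c (fun i : ℕ => (i : ℤ)) ≤ (∑ i ∈ J, |c i|) ^ 2 := by
  rw [combVariance, sq, Finset.sum_mul]
  refine Finset.sum_le_sum fun j _ => (le_abs_self _).trans ?_
  rw [abs_mul]
  exact mul_le_mul_of_nonneg_left (hν.abs_meanShift_le _ _ _ _) (abs_nonneg _)

/-- The decoupling constant. -/
def decoupleConst (q : ℕ) (β h : ℝ) : ℝ≥0∞ :=
  ENNReal.ofReal (Real.exp (|h| * (q + 1))) * (2 ^ (q + 1) *
    ENNReal.ofReal (Real.exp ((β * (q + 1)) ^ 2 / 2 + 2 * (β * ((2 * q + 1) * (β * (q + 1)))))))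

/-- Cameron–Martin removes the tilt at the cost of half its variance, at most `(β (q + 1)) ^ 2 / 2`.
The resulting shift has total size at most `(2 q + 1) β (q + 1)`, so each of the two partition
functions changes by at most `exp (β (2 q + 1) β (q + 1))`. They depend on sites more than `q`
apart, hence are independent. -/
lemma lintegral_exp_mul_pinned_le (hν : IsDisorderLaw ν q ρ) (hβ : 0 ≤ β) (hγ0 : 0 < γ)
    (hγ1 : γ ≤ 1) {J : Finset ℕ} (hJ : J.card ≤ q + 1) {c : ℕ → ℝ} (hc : ∀ i, |c i| ≤ β)
    {j n N : ℕ} (hjn : j + q ≤ n) (hnN : n ≤ N) :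
    ∫⁻ w, ENNReal.ofReal (Real.exp (linComb J c (fun i : ℕ => (i : ℤ)) w)) *
      (pinned κ β h w 0 j ^ γ * pinned κ β h w n N ^ γ) ∂ν ≤
      ENNReal.ofReal (Real.exp ((β * (q + 1)) ^ 2 / 2 +
        2 * (β * ((2 * q + 1) * (β * (q + 1)))))) *
        (fracMoment ν κ β h γ j * fracMoment ν κ β h γ (N - n)) := by
  have hsum : ∑ i ∈ J, |c i| ≤ β * (q + 1) := by
    calc ∑ i ∈ J, |c i| ≤ ∑ i ∈ J, β := Finset.sum_le_sum fun i _ => hc i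
      _ = J.card * β := by simp
      _ ≤ ((q + 1 : ℕ) : ℝ) * β := by gcongr
      _ = _ := by push_cast; ring
  set s := meanShift ρ J c (fun i : ℕ => (i : ℤ)) with hs
  have hs' : ∀ S : Finset ℕ, ∑ k ∈ S, |s k| ≤ (2 * q + 1) * (β * (q + 1)) := fun S =>
    (sum_abs_meanShift_le hν J c S).trans (by gcongr)
  set E : ℝ := β * ((2 * q + 1) * (β * (q + 1))) with hE
  have hE0 : 0 ≤ E := by positivity
  have hF : ∀ a b, Measurable fun w => pinned κ β h w a b ^ γ := fun a b =>
    (measurable_pinned a b).pow_const γ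
  have hFF : Measurable fun w => pinned κ β h w 0 j ^ γ * pinned κ β h w n N ^ γ :=
    (hF 0 j).mul (hF n N)
  have hCM := hν.lintegral_exp_linComb_mul J c (fun i : ℕ => (i : ℤ))
    (F := fun w => pinned κ β h w 0 j ^ γ * pinned κ β h w n N ^ γ) hFF
  rw [hCM]
  have hshift : ∀ w a b, pinned κ β h (w + s) a b ^ γ ≤
      ENNReal.ofReal (Real.exp E) * pinned κ β h w a b ^ γ := by
    intro w a b
    refine (ENNReal.rpow_le_rpow (pinned_add_le hβ w s hs' a b) hγ0.le).trans ?_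
    rw [ENNReal.mul_rpow_of_nonneg _ _ hγ0.le]
    refine mul_le_mul_left ?_ _
    have h1 : (1 : ℝ≥0∞) ≤ ENNReal.ofReal (Real.exp E) := by
      rw [ENNReal.one_le_ofReal, Real.one_le_exp_iff]; exact hE0
    simpa using ENNReal.rpow_le_rpow_of_exponent_le h1 hγ1
  have hgap := hν.lintegral_mul_of_gap (A := {i | i ≤ (j : ℤ)}) (B := {i | (n : ℤ) < i})
    (F := fun w => pinned κ β h w 0 j ^ γ) (G := fun w => pinned κ β h w n N ^ γ)
    (fun i hi i' hi' => by
      simp only [Set.mem_ofPred_eq] at hi hi'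
      omega) (hF 0 j) (hF n N)
    (fun w w' hw => by rw [pinned_congr fun i _ hi => hw i hi])
    (fun w w' hw => by rw [pinned_congr fun i hi _ => hw i hi])
  calc _ ≤ ENNReal.ofReal (Real.exp ((β * (q + 1)) ^ 2 / 2)) *
        ∫⁻ w, ENNReal.ofReal (Real.exp E) * ENNReal.ofReal (Real.exp E) *
          (pinned κ β h w 0 j ^ γ * pinned κ β h w n N ^ γ) ∂ν := by
        refine mul_le_mul' (ENNReal.ofReal_le_ofReal (Real.exp_le_exp.2 ?_))
          (lintegral_mono fun w => ?_)
        · have h1 := combVariance_le_sq hν J c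
          have h2 : (∑ i ∈ J, |c i|) ^ 2 ≤ (β * (q + 1)) ^ 2 := by gcongr
          linarith
        · refine (mul_le_mul' (hshift w 0 j) (hshift w n N)).trans (le_of_eq ?_)
          ring
    _ = _ := by
        rw [lintegral_const_mul _ hFF, hgap,
          lintegral_pinned_rpow hν hnN, ← ENNReal.ofReal_mul (by positivity), ← Real.exp_add,
          ← mul_assoc, ← ENNReal.ofReal_mul (by positivity), ← Real.exp_add]
        congr 3
        ring

/-- Since `exp (β |x|) ≤ exp (β x) + exp (-β x)`, expanding the product over `J` leaves at most `2 ^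
(q + 1)` linear tilts, indexed by the subset of sites that carry the sign plus. -/
lemma lintegral_exp_abs_mul_pinned_le (hν : IsDisorderLaw ν q ρ) (hβ : 0 ≤ β) (hγ0 : 0 < γ)
    (hγ1 : γ ≤ 1) {J : Finset ℕ} (hJ : J.card ≤ q + 1) {j n N : ℕ} (hjn : j + q ≤ n)
    (hnN : n ≤ N) :
    ∫⁻ w, ENNReal.ofReal (Real.exp (∑ k ∈ J, (β * |w k| + |h|))) *
      (pinned κ β h w 0 j ^ γ * pinned κ β h w n N ^ γ) ∂ν ≤
      decoupleConst q β h * (fracMoment ν κ β h γ j * fracMoment ν κ β h γ (N - n)) := by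
  classical
  have hF : ∀ a b, Measurable fun w => pinned κ β h w a b ^ γ := fun a b =>
    (measurable_pinned a b).pow_const γ
  set c : Finset ℕ → ℕ → ℝ := fun I i => if i ∈ I then β else -β with hc
  have hpt : ∀ w : ℤ → ℝ, ENNReal.ofReal (Real.exp (∑ k ∈ J, (β * |w k| + |h|))) ≤
      ENNReal.ofReal (Real.exp (|h| * (q + 1))) * ∑ I ∈ J.powerset,
        ENNReal.ofReal (Real.exp (linComb J (c I) (fun i : ℕ => (i : ℤ)) w)) := by
    intro w
    rw [← ENNReal.ofReal_sum_of_nonneg fun _ _ => (Real.exp_pos _).le,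
      ← ENNReal.ofReal_mul (by positivity)]
    refine ENNReal.ofReal_le_ofReal ?_
    rw [Finset.sum_add_distrib, Real.exp_add, mul_comm]
    refine mul_le_mul (Real.exp_le_exp.2 ?_) ?_ (by positivity) (by positivity)
    · rw [Finset.sum_const, nsmul_eq_mul, mul_comm]
      refine mul_le_mul_of_nonneg_left ?_ (abs_nonneg h)
      exact_mod_cast hJ
    · rw [Real.exp_sum]
      calc ∏ k ∈ J, Real.exp (β * |w k|)
          ≤ ∏ k ∈ J, (Real.exp (β * w k) + Real.exp (-β * w k)) := by
            refine Finset.prod_le_prod (fun _ _ => (Real.exp_pos _).le) fun k _ => ?_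
            rcases abs_cases (w k) with ⟨h1, _⟩ | ⟨h1, _⟩ <;> rw [h1]
            · linarith [Real.exp_pos (-β * w k)]
            · rw [mul_neg, ← neg_mul]
              linarith [Real.exp_pos (β * w k)]
        _ = _ := by
            rw [Finset.prod_add]
            refine Finset.sum_congr rfl fun I hI => ?_
            rw [Finset.mem_powerset] at hI
            rw [← Real.exp_sum, ← Real.exp_sum, ← Real.exp_add, linComb,
              ← Finset.sum_sdiff hI (f := fun i => c I i * w i), add_comm]
            congr 2
            · refine Finset.sum_congr rfl fun k hk => ?_
              rw [Finset.mem_sdiff] at hk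
              simp [hc, hk.2]
            · refine Finset.sum_congr rfl fun k hk => ?_
              simp [hc, hk]
  calc _ ≤ ∫⁻ w, ENNReal.ofReal (Real.exp (|h| * (q + 1))) * ∑ I ∈ J.powerset,
        ENNReal.ofReal (Real.exp (linComb J (c I) (fun i : ℕ => (i : ℤ)) w)) *
        (pinned κ β h w 0 j ^ γ * pinned κ β h w n N ^ γ) ∂ν := by
        refine lintegral_mono fun w => ?_
        refine (mul_le_mul_left (hpt w) _).trans (le_of_eq ?_)
        rw [mul_assoc, Finset.sum_mul]
    _ = ENNReal.ofReal (Real.exp (|h| * (q + 1))) * ∑ I ∈ J.powerset, ∫⁻ w,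
        ENNReal.ofReal (Real.exp (linComb J (c I) (fun i : ℕ => (i : ℤ)) w)) *
        (pinned κ β h w 0 j ^ γ * pinned κ β h w n N ^ γ) ∂ν := by
        have hm : ∀ I ∈ J.powerset, Measurable fun w : ℤ → ℝ =>
            ENNReal.ofReal (Real.exp (linComb J (c I) (fun i : ℕ => (i : ℤ)) w)) *
            (pinned κ β h w 0 j ^ γ * pinned κ β h w n N ^ γ) := fun I _ =>
          ((measurable_linComb _ _ _).exp.ennreal_ofReal).mul ((hF 0 j).mul (hF n N))
        rw [lintegral_const_mul _ (Finset.measurable_fun_sum _ hm), lintegral_finsetSum _ hm]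
    _ ≤ ENNReal.ofReal (Real.exp (|h| * (q + 1))) * ∑ I ∈ J.powerset,
        ENNReal.ofReal (Real.exp ((β * (q + 1)) ^ 2 / 2 +
        2 * (β * ((2 * q + 1) * (β * (q + 1)))))) *
        (fracMoment ν κ β h γ j * fracMoment ν κ β h γ (N - n)) := by
        refine mul_le_mul_right (Finset.sum_le_sum fun I _ => ?_) _
        refine lintegral_exp_mul_pinned_le hν hβ hγ0 hγ1 hJ (fun i => ?_) hjn hnN
        simp only [hc]
        split_ifs <;> simp [abs_of_nonneg hβ]
    _ ≤ _ := by
        rw [Finset.sum_const, Finset.card_powerset, nsmul_eq_mul, decoupleConst, mul_assoc,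
          mul_assoc]
        refine mul_le_mul_right (mul_le_mul_left ?_ _) _
        push_cast
        exact pow_le_pow_right₀ one_le_two hJ

end Decoupling

section Criterion

variable {ν : Measure (ℤ → ℝ)} {q : ℕ} {ρ : ℕ → ℝ} {κ : ℕ → ℝ≥0∞} {β h γ : ℝ}

/-- The tail of the fractional powers of the gap law. -/
def rpowTail (κ : ℕ → ℝ≥0∞) (γ : ℝ) (r : ℕ) : ℝ≥0∞ := ∑' t, if r ≤ t + 1 then κ t ^ γ else 0

/-- The two boundary contacts of the middle part together with the middle part. -/
lemma pinned_rpow_le (hκ : ∑' t, κ t = 1) (hβ : 0 ≤ β) (hγ0 : 0 < γ) (hγ1 : γ ≤ 1)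
    {k N : ℕ} (hk : 1 ≤ k) (hN : k + q ≤ N) (w : ℤ → ℝ) :
    pinned κ β h w 0 N ^ γ ≤ ∑' j, ∑' t,
      ((if j < k ∧ k + q ≤ j + t + 1 then κ t ^ γ else 0) *
        (ENNReal.ofReal (Real.exp (∑ s ∈ insert (j + t + 1) (Finset.Ico k (k + q)),
          (β * |w s| + |h|))) *
          (pinned κ β h w 0 j ^ γ * pinned κ β h w (j + t + 1) N ^ γ)) +
      ∑' i, ∑' u, (if j < k ∧ k ≤ j + t + 1 ∧ k ≤ i ∧ i < k + q ∧ k + q ≤ i + u + 1 then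
          κ t ^ γ * κ u ^ γ else 0) *
        (ENNReal.ofReal (Real.exp (∑ s ∈ insert (i + u + 1) (Finset.Ico k (k + q)),
          (β * |w s| + |h|))) *
          (pinned κ β h w 0 j ^ γ * pinned κ β h w (i + u + 1) N ^ γ))) := by
  have hmid : ∀ J : Finset ℕ, ∀ X : ℝ≥0∞,
      X ≤ ENNReal.ofReal (Real.exp (∑ s ∈ J, (β * |w s| + |h|))) →
      X ^ γ ≤ ENNReal.ofReal (Real.exp (∑ s ∈ J, (β * |w s| + |h|))) := by
    intro J X hX
    have h1 : (1 : ℝ≥0∞) ≤ ENNReal.ofReal (Real.exp (∑ s ∈ J, (β * |w s| + |h|))) := by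
      rw [ENNReal.one_le_ofReal, Real.one_le_exp_iff]
      exact Finset.sum_nonneg fun _ _ => by positivity
    refine (ENNReal.rpow_le_rpow hX hγ0.le).trans ?_
    simpa using ENNReal.rpow_le_rpow_of_exponent_le h1 hγ1
  have hbol : ∀ S J : Finset ℕ, S ⊆ J →
      boltzmann β h w S ≤ ENNReal.ofReal (Real.exp (∑ s ∈ J, (β * |w s| + |h|))) := by
    intro S J hSJ
    rw [boltzmann]
    refine ENNReal.ofReal_le_ofReal (Real.exp_le_exp.2 ?_)
    calc ∑ k ∈ S, (β * w k + h) ≤ ∑ k ∈ S, (β * |w k| + |h|) :=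
          Finset.sum_le_sum fun k _ => add_le_add
            (mul_le_mul_of_nonneg_left (le_abs_self _) hβ) (le_abs_self _)
      _ ≤ _ := Finset.sum_le_sum_of_subset_of_nonneg hSJ fun k _ _ => by positivity
  rw [pinned_decomposition w (by omega : 0 < k) (by omega : k ≤ N)]
  refine (ENNReal_rpow_tsum_le _ hγ0 hγ1).trans (ENNReal.tsum_le_tsum fun j => ?_)
  refine (ENNReal_rpow_tsum_le _ hγ0 hγ1).trans (ENNReal.tsum_le_tsum fun t => ?_)
  by_cases hjt : j < k ∧ k ≤ j + t + 1
  swap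
  · rw [if_neg hjt, ENNReal.zero_rpow_of_pos hγ0]; exact zero_le
  rw [if_pos hjt]
  -- Either the gap across `k` jumps over the whole window `[k, k + q)`, or the path has a contact
  -- in the window and is decomposed a second time, at `k + q`. In both cases the outer pieces are
  -- separated by the window.
  by_cases hq : k + q ≤ j + t + 1
  · refine le_trans ?_ le_self_add
    rw [if_pos ⟨hjt.1, hq⟩, ENNReal.mul_rpow_of_nonneg _ _ hγ0.le,
      ENNReal.mul_rpow_of_nonneg _ _ hγ0.le, ENNReal.mul_rpow_of_nonneg _ _ hγ0.le]
    calc _ = κ t ^ γ * (boltzmann β h w {j + t + 1} ^ γ *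
          (pinned κ β h w 0 j ^ γ * pinned κ β h w (j + t + 1) N ^ γ)) := by ring
      _ ≤ _ := by
        refine mul_le_mul_right (mul_le_mul_left (hmid _ _ (hbol _ _ ?_)) _) _
        simp
  · refine le_trans ?_ le_add_self
    rw [pinned_decomposition w (by omega : j + t + 1 < k + q) hN]
    rw [← ENNReal.tsum_mul_left, ← ENNReal.tsum_mul_left, ← ENNReal.tsum_mul_left]
    refine (ENNReal_rpow_tsum_le _ hγ0 hγ1).trans (ENNReal.tsum_le_tsum fun i => ?_)
    rw [← ENNReal.tsum_mul_left, ← ENNReal.tsum_mul_left, ← ENNReal.tsum_mul_left]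
    refine (ENNReal_rpow_tsum_le _ hγ0 hγ1).trans (ENNReal.tsum_le_tsum fun u => ?_)
    by_cases hiu : i < k + q ∧ k + q ≤ i + u + 1
    swap
    · rw [if_neg hiu]
      simp [ENNReal.zero_rpow_of_pos hγ0]
    rw [if_pos hiu]
    by_cases hi : k ≤ i
    swap
    · rw [pinned_eq_zero (by omega : i < j + t + 1)]
      simp [ENNReal.zero_rpow_of_pos hγ0]
    rw [if_pos ⟨hjt.1, hjt.2, hi, hiu.1, hiu.2⟩]
    set J := insert (i + u + 1) (Finset.Ico k (k + q)) with hJ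
    -- The contacts at `j + t + 1`, those up to `i`, and the one at `i + u + 1` are distinct sites
    -- of `J`, so the middle of the path costs at most one factor per site of `J`.
    have hx : boltzmann β h w {j + t + 1} *
        (pinned κ β h w (j + t + 1) i * boltzmann β h w {i + u + 1}) ≤
        ENNReal.ofReal (Real.exp (∑ s ∈ J, (β * |w s| + |h|))) := by
      rcases lt_or_ge i (j + t + 1) with hlt | hge
      · rw [pinned_eq_zero hlt]; simp
      have h1 := pinned_le_exp hκ w (β := β) (h := h) (a := j + t + 1) (b := i)
        (J := Finset.Ioc (j + t + 1) i) hβ le_rfl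
      have hdisj : Disjoint ({j + t + 1} : Finset ℕ) (Finset.Ioc (j + t + 1) i) := by simp
      have hdisj2 : Disjoint ({j + t + 1} ∪ Finset.Ioc (j + t + 1) i) {i + u + 1} := by
        rw [Finset.disjoint_singleton_right]
        simp
        omega
      calc _ ≤ ENNReal.ofReal (Real.exp (∑ s ∈ {j + t + 1}, (β * |w s| + |h|))) *
            (ENNReal.ofReal (Real.exp (∑ s ∈ Finset.Ioc (j + t + 1) i, (β * |w s| + |h|))) *
            ENNReal.ofReal (Real.exp (∑ s ∈ {i + u + 1}, (β * |w s| + |h|)))) :=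
            mul_le_mul' (hbol _ _ subset_rfl) (mul_le_mul' h1 (hbol _ _ subset_rfl))
        _ = ENNReal.ofReal (Real.exp (∑ s ∈ ({j + t + 1} ∪ Finset.Ioc (j + t + 1) i) ∪
              {i + u + 1}, (β * |w s| + |h|))) := by
            rw [Finset.sum_union hdisj2, Finset.sum_union hdisj, Real.exp_add, Real.exp_add,
              ENNReal.ofReal_mul (by positivity), ENNReal.ofReal_mul (by positivity), mul_assoc]
        _ ≤ _ := by
            refine ENNReal.ofReal_le_ofReal (Real.exp_le_exp.2 ?_)
            refine Finset.sum_le_sum_of_subset_of_nonneg ?_ fun s _ _ => by positivity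
            intro s hs
            simp only [Finset.mem_union, Finset.mem_singleton, Finset.mem_Ioc] at hs
            rw [hJ, Finset.mem_insert, Finset.mem_Ico]
            omega
    calc _ = (κ t ^ γ * κ u ^ γ) * ((boltzmann β h w {j + t + 1} *
          (pinned κ β h w (j + t + 1) i * boltzmann β h w {i + u + 1})) ^ γ *
          (pinned κ β h w 0 j ^ γ * pinned κ β h w (i + u + 1) N ^ γ)) := by
          rw [← ENNReal.mul_rpow_of_nonneg _ _ hγ0.le, ← ENNReal.mul_rpow_of_nonneg _ _ hγ0.le,
            ← ENNReal.mul_rpow_of_nonneg _ _ hγ0.le, ← ENNReal.mul_rpow_of_nonneg _ _ hγ0.le]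
          congr 1
          ring
      _ ≤ _ := mul_le_mul_right (mul_le_mul_left (hmid _ _ hx) _) _

/-- The finite volume criterion: if the fractional moments up to scale `k` are small enough, they
are bounded on all scales. -/
theorem fracMoment_le_of_criterion (hν : IsDisorderLaw ν q ρ) (hκ : ∑' t, κ t = 1) (hβ : 0 ≤ β)
    (hγ0 : 0 < γ) (hγ1 : γ ≤ 1) {k : ℕ} (hk : 1 ≤ k)
    (hcrit : decoupleConst q β h * (1 + q * ∑' t, κ t ^ γ) *
      ∑ j ∈ Finset.range k, fracMoment ν κ β h γ j * rpowTail κ γ (k - j) ≤ 1) (N : ℕ) :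
    fracMoment ν κ β h γ N ≤ ∑ i ∈ Finset.range (k + q), fracMoment ν κ β h γ i := by
  set D := ∑ i ∈ Finset.range (k + q), fracMoment ν κ β h γ i with hD
  induction N using Nat.strong_induction_on with
  | _ N ih =>
  rcases lt_or_ge N (k + q) with hN | hN
  · exact Finset.single_le_sum (f := fun i => fracMoment ν κ β h γ i) (fun _ _ => zero_le)
      (Finset.mem_range.2 hN)
  set A := fun i => fracMoment ν κ β h γ i with hA
  set C := decoupleConst q β h with hC
  set Y : ℕ → (ℤ → ℝ) → ℝ≥0∞ := fun n w =>
    ENNReal.ofReal (Real.exp (∑ s ∈ insert n (Finset.Ico k (k + q)), (β * |w s| + |h|))) with hY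
  have hΦm : ∀ j n, Measurable fun w =>
      Y n w * (pinned κ β h w 0 j ^ γ * pinned κ β h w n N ^ γ) := by
    intro j n
    refine Measurable.mul ?_ (((measurable_pinned 0 j).pow_const γ).mul
      ((measurable_pinned n N).pow_const γ))
    simp only [hY]
    refine (Measurable.exp (Finset.measurable_fun_sum _ fun s _ => ?_)).ennreal_ofReal
    exact ((measurable_pi_apply (s : ℤ)).norm.const_mul β).add_const |h|
  -- The right piece has size `N - n < N`, so the induction hypothesis bounds its fractional moment
  -- by `D`; the left piece keeps its moment `A j`.
  have hΦ : ∀ j n, j < k → k + q ≤ n →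
      ∫⁻ w, Y n w * (pinned κ β h w 0 j ^ γ * pinned κ β h w n N ^ γ) ∂ν ≤ C * (A j * D) := by
    intro j n hj hn
    rcases le_or_gt n N with hnN | hnN
    · refine (lintegral_exp_abs_mul_pinned_le hν hβ hγ0 hγ1 ?_ (by omega) hnN).trans ?_
      · refine (Finset.card_insert_le _ _).trans ?_
        rw [Nat.card_Ico]; omega
      · exact mul_le_mul_right (mul_le_mul_right (ih (N - n) (by omega)) _) _
    · simp [pinned_eq_zero hnN, ENNReal.zero_rpow_of_pos hγ0]
  have hinner : ∀ (j n : ℕ) (p : Prop) [Decidable p] (c : ℝ≥0∞), (p → j < k ∧ k + q ≤ n) →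
      ∫⁻ w, (if p then c else 0) * (Y n w * (pinned κ β h w 0 j ^ γ * pinned κ β h w n N ^ γ)) ∂ν ≤
        (if p then c else 0) * (C * (A j * D)) := by
    intro j n p _ c hp
    rw [lintegral_const_mul _ (hΦm j n)]
    split_ifs with h
    · exact mul_le_mul_right (hΦ j n (hp h).1 (hp h).2) _
    · simp
  have hm1 : ∀ j t : ℕ, Measurable fun w =>
      (if j < k ∧ k + q ≤ j + t + 1 then κ t ^ γ else 0) *
        (Y (j + t + 1) w * (pinned κ β h w 0 j ^ γ * pinned κ β h w (j + t + 1) N ^ γ)) :=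
    fun j t => (hΦm j _).const_mul _
  have hm2 : ∀ j t i u : ℕ, Measurable fun w =>
      (if j < k ∧ k ≤ j + t + 1 ∧ k ≤ i ∧ i < k + q ∧ k + q ≤ i + u + 1 then
          κ t ^ γ * κ u ^ γ else 0) *
        (Y (i + u + 1) w * (pinned κ β h w 0 j ^ γ * pinned κ β h w (i + u + 1) N ^ γ)) :=
    fun j t i u => (hΦm j _).const_mul _
  have hm3 : ∀ j t : ℕ, Measurable fun w =>
      ∑' i, ∑' u, (if j < k ∧ k ≤ j + t + 1 ∧ k ≤ i ∧ i < k + q ∧ k + q ≤ i + u + 1 then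
          κ t ^ γ * κ u ^ γ else 0) *
        (Y (i + u + 1) w * (pinned κ β h w 0 j ^ γ * pinned κ β h w (i + u + 1) N ^ γ)) :=
    fun j t => Measurable.tsum fun i => Measurable.tsum fun u => hm2 j t i u
  have hm4 : ∀ j t : ℕ, Measurable fun w =>
      (if j < k ∧ k + q ≤ j + t + 1 then κ t ^ γ else 0) *
        (Y (j + t + 1) w * (pinned κ β h w 0 j ^ γ * pinned κ β h w (j + t + 1) N ^ γ)) +
      ∑' i, ∑' u, (if j < k ∧ k ≤ j + t + 1 ∧ k ≤ i ∧ i < k + q ∧ k + q ≤ i + u + 1 then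
          κ t ^ γ * κ u ^ γ else 0) *
        (Y (i + u + 1) w * (pinned κ β h w 0 j ^ γ * pinned κ β h w (i + u + 1) N ^ γ)) :=
    fun j t => (hm1 j t).add (hm3 j t)
  clear_value D
  set B := ∑' t, κ t ^ γ with hB
  calc fracMoment ν κ β h γ N
      ≤ ∫⁻ w, ∑' j, ∑' t,
        ((if j < k ∧ k + q ≤ j + t + 1 then κ t ^ γ else 0) *
          (Y (j + t + 1) w * (pinned κ β h w 0 j ^ γ * pinned κ β h w (j + t + 1) N ^ γ)) +
        ∑' i, ∑' u, (if j < k ∧ k ≤ j + t + 1 ∧ k ≤ i ∧ i < k + q ∧ k + q ≤ i + u + 1 then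
          κ t ^ γ * κ u ^ γ else 0) *
        (Y (i + u + 1) w * (pinned κ β h w 0 j ^ γ * pinned κ β h w (i + u + 1) N ^ γ))) ∂ν :=
        lintegral_mono fun w => pinned_rpow_le hκ hβ hγ0 hγ1 hk hN w
    _ ≤ ∑' j, ∑' t, ((if j < k ∧ k + q ≤ j + t + 1 then κ t ^ γ else 0) * (C * (A j * D)) +
        ∑' i, ∑' u, (if j < k ∧ k ≤ j + t + 1 ∧ k ≤ i ∧ i < k + q ∧ k + q ≤ i + u + 1 then
          κ t ^ γ * κ u ^ γ else 0) * (C * (A j * D))) := by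
        rw [lintegral_tsum fun j => (Measurable.tsum fun t => hm4 j t).aemeasurable]
        refine ENNReal.tsum_le_tsum fun j => ?_
        rw [lintegral_tsum fun t => (hm4 j t).aemeasurable]
        refine ENNReal.tsum_le_tsum fun t => ?_
        rw [lintegral_add_left (hm1 j t)]
        refine add_le_add (hinner _ _ _ _ fun h => h) ?_
        rw [lintegral_tsum fun i => (Measurable.tsum fun u => hm2 j t i u).aemeasurable]
        refine ENNReal.tsum_le_tsum fun i => ?_
        rw [lintegral_tsum fun u => (hm2 j t i u).aemeasurable]
        exact ENNReal.tsum_le_tsum fun u => hinner _ _ _ _ fun h => ⟨h.1, h.2.2.2.2⟩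
    -- The gap across `k` contributes the tail. A second crossing costs at most `B` for its gap and
    -- `q` for the position `i` of its left end in the window.
    _ ≤ ∑' j, if j < k then rpowTail κ γ (k - j) * (1 + q * B) * (C * (A j * D)) else 0 := by
        refine ENNReal.tsum_le_tsum fun j => ?_
        by_cases hj : j < k
        swap
        · simp [hj]
        rw [if_pos hj]
        simp only [ENNReal.tsum_mul_right, ← add_mul]
        refine mul_le_mul_left ?_ _
        rw [rpowTail, ← ENNReal.tsum_mul_right]
        refine ENNReal.tsum_le_tsum fun t => ?_
        by_cases ht : k - j ≤ t + 1
        swap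
        · have h1 : ¬ k ≤ j + t + 1 := by omega
          have h2 : ¬ k + q ≤ j + t + 1 := by omega
          simp [h1, h2]
        rw [if_pos ht, mul_add, mul_one]
        refine add_le_add ?_ ?_
        · split_ifs
          · exact le_rfl
          · exact zero_le
        · calc _ ≤ ∑' i, ∑' u, (if k ≤ i ∧ i < k + q then κ t ^ γ * κ u ^ γ else 0) := by
                refine ENNReal.tsum_le_tsum fun i => ENNReal.tsum_le_tsum fun u => ?_
                split_ifs with h1 h2 h2
                · exact le_rfl
                · exact absurd ⟨h1.2.2.1, h1.2.2.2.1⟩ h2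
                · exact zero_le
                · exact le_rfl
            _ = ∑' i, (if i ∈ Finset.Ico k (k + q) then κ t ^ γ * B else 0) := by
                refine tsum_congr fun i => ?_
                simp only [Finset.mem_Ico]
                split_ifs
                · rw [ENNReal.tsum_mul_left]
                · simp
            _ = q * (κ t ^ γ * B) := by
                rw [tsum_eq_sum (s := Finset.Ico k (k + q)) fun i hi => if_neg hi,
                  Finset.sum_ite_mem]
                simp
            _ = _ := by ring
    _ = (C * (1 + q * B) * ∑ j ∈ Finset.range k, A j * rpowTail κ γ (k - j)) * D := by
        rw [tsum_eq_sum (s := Finset.range k) fun j hj => if_neg (by simpa using hj),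
          Finset.mul_sum, Finset.sum_mul]
        refine Finset.sum_congr rfl fun j hj => ?_
        rw [if_pos (Finset.mem_range.1 hj)]
        ring
    _ ≤ D := mul_le_of_le_one_left zero_le hcrit

end Criterion

/-! ### Negativity of the annealed critical parameter -/

section Negative

variable {ν : Measure (ℤ → ℝ)} {q : ℕ} {ρ : ℕ → ℝ} {κ : ℕ → ℝ≥0∞}

/-- The number of consecutive pairs of gaps that both have the length `q + 1`. -/
def longPairs (q : ℕ) : List ℕ → ℕ
  | t :: t' :: l => (if t = q ∧ t' = q then 1 else 0) + longPairs q l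
  | _ => 0

/-- The contact between two gaps of length `q + 1` is out of range of all others. The gaps are read
in disjoint pairs, so these contacts are distinct; the condition `a + q < x` is what keeps them away
from earlier contacts in the induction. -/
lemma exists_isolated (q a : ℕ) (l : List ℕ) : ∃ I ⊆ supp a l, I.card = longPairs q l ∧
    ∀ x ∈ I, a + q < x ∧ ∀ y ∈ supp a l, y ≠ x → q < ((x : ℤ) - y).natAbs := by
  induction l using longPairs.induct generalizing a with
  | case1 t t' l ih =>
    obtain ⟨I, hI, hcard, hfar⟩ := ih (a + t + 1 + t' + 1)
    have hmem : ∀ y, y ∈ supp a (t :: t' :: l) ↔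
        y = a + t + 1 ∨ y = a + t + 1 + t' + 1 ∨ y ∈ supp (a + t + 1 + t' + 1) l := by
      simp [supp]
    have hold : ∀ x ∈ I, a + q < x ∧
        ∀ y ∈ supp a (t :: t' :: l), y ≠ x → q < ((x : ℤ) - y).natAbs := by
      intro x hx
      obtain ⟨h1, h2⟩ := hfar x hx
      refine ⟨by omega, fun y hy hne => ?_⟩
      rcases (hmem y).1 hy with rfl | rfl | hy
      · omega
      · omega
      · exact h2 y hy hne
    by_cases hq : t = q ∧ t' = q
    · refine ⟨insert (a + t + 1) I, ?_, ?_, ?_⟩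
      · intro y hy
        rw [Finset.mem_insert] at hy
        rw [hmem]
        exact hy.imp_right fun h => Or.inr (hI h)
      · rw [Finset.card_insert_of_notMem, hcard, longPairs, if_pos hq, add_comm]
        intro h
        have := (hold _ h).2 (a + t + 1 + t' + 1) (by simp [hmem]) (by omega)
        have := (hfar _ h).1
        omega
      · intro x hx
        rcases Finset.mem_insert.1 hx with rfl | hx
        · refine ⟨by omega, fun y hy hne => ?_⟩
          rcases (hmem y).1 hy with rfl | rfl | hy
          · exact absurd rfl hne
          · omega
          · have := (lt_and_le_of_mem_supp hy).1
            omega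
        · exact hold x hx
    · refine ⟨I, fun y hy => (hmem y).2 (Or.inr (Or.inr (hI hy))), ?_, hold⟩
      rw [hcard, longPairs, if_neg hq, zero_add]
  | case2 l h =>
    refine ⟨∅, by simp, ?_, by simp⟩
    rw [longPairs]
    · rfl
    · exact h

/-- Isolated contacts contribute their variance to the energy. -/
lemma longPairs_le_energy (hν : IsDisorderLaw ν q ρ) (l : List ℕ) :
    longPairs q l ≤ energy ρ (supp 0 l) := by
  obtain ⟨I, hI, hcard, hfar⟩ := exists_isolated q 0 l
  have h1 : energy ρ I = I.card := by
    rw [energy, Finset.card_eq_sum_ones, Nat.cast_sum]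
    refine Finset.sum_congr rfl fun i hi => ?_
    rw [Finset.sum_eq_single i]
    · simp [hν.variance_one]
    · exact fun j hj hne => hν.finite_range _ ((hfar i hi).2 j (hI hj) hne)
    · exact fun h => absurd hi h
  have h2 := energy_union ρ (Finset.disjoint_sdiff (s := I) (t := supp 0 l))
  rw [Finset.union_sdiff_of_subset hI, h1, Finset.sum_eq_zero, mul_zero, add_zero] at h2
  · rw [h2, hcard]
    linarith [hν.energy_nonneg (supp 0 l \ I)]
  · intro i hi
    refine Finset.sum_eq_zero fun j hj => ?_
    rw [Finset.mem_sdiff] at hj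
    exact hν.finite_range _ ((hfar i hi).2 j hj.1 fun h => hj.2 (h ▸ hi))

/-- Disjoint pairs of gaps are independent under `κ`, and a pair has both gaps equal to `q + 1` with
probability `κ q * κ q`. -/
lemma levelSum_pow_longPairs (hκ : ∑' t, κ t = 1) (q : ℕ) {E : ℝ≥0∞} (m : ℕ) :
    levelSum κ (2 * m) (fun l => (1 + E) ^ longPairs q l) = (1 + κ q * (κ q * E)) ^ m := by
  induction m with
  | zero => simp [levelSum, longPairs]
  | succ m ih =>
    have h : ∀ t t' : ℕ, (1 + E) ^ (if t = q ∧ t' = q then 1 else 0) =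
        1 + if t = q then (if t' = q then E else 0) else 0 := by
      intro t t'
      by_cases h1 : t = q <;> by_cases h2 : t' = q <;> simp [h1, h2]
    rw [show 2 * (m + 1) = (2 * m + 1) + 1 by ring]
    simp only [levelSum, longPairs, pow_add, levelSum_const_mul, ih, h]
    simp only [← mul_assoc, ENNReal.tsum_mul_right]
    simp only [mul_add, mul_one, ENNReal.tsum_add, hκ]
    rw [pow_succ, mul_comm]
    congr 2
    rw [tsum_eq_single q fun t ht => by simp [ht], tsum_eq_single q fun t ht => by simp [ht]]
    simp [mul_assoc]

/-- The annealed critical parameter is negative. -/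
theorem IsCriticalWeight.neg (hν : IsDisorderLaw ν q ρ) (hκ : ∑' t, κ t = 1) (hq : κ q ≠ 0)
    {β h : ℝ} (hβ : 0 < β) (hW : IsCriticalWeight κ (glueConst q β) (annealedWeight ρ β h)) :
    h < 0 := by
  by_contra! hh
  set E : ℝ≥0∞ := ENNReal.ofReal (Real.exp (β ^ 2 / 2) - 1) with hE
  have hE0 : E ≠ 0 := by
    rw [hE, Ne, ENNReal.ofReal_eq_zero, not_le, sub_pos, Real.one_lt_exp_iff]
    positivity
  have hE1 : 1 + E = ENNReal.ofReal (Real.exp (β ^ 2 / 2)) := by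
    rw [hE, ← ENNReal.ofReal_one, ← ENNReal.ofReal_add zero_le_one, add_sub_cancel]
    rw [sub_nonneg, Real.one_le_exp_iff]
    positivity
  -- For `h ≥ 0` each isolated contact multiplies the weight by at least `exp (β ^ 2 / 2) = 1 + E`.
  -- The masses of the even levels would then grow geometrically, although criticality bounds them.
  have hbound : ∀ m : ℕ, (1 + κ q * (κ q * E)) ^ m ≤ glueConst q β := by
    intro m
    rw [← levelSum_pow_longPairs hκ]
    refine (levelSum_mono fun l _ => ?_).trans (hW.level_le (2 * m))
    rw [hE1, annealedWeight, ← ENNReal.ofReal_pow (by positivity), ← Real.exp_nat_mul]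
    refine ENNReal.ofReal_le_ofReal (Real.exp_le_exp.2 ?_)
    have h1 := longPairs_le_energy hν l
    have h2 : 0 ≤ h * l.length := by positivity
    nlinarith [sq_nonneg β]
  have h1 : (1 : ℝ≥0∞) < 1 + κ q * (κ q * E) :=
    ENNReal.lt_add_right ENNReal.one_ne_top (mul_ne_zero hq (mul_ne_zero hq hE0))
  have h2 := ENNReal.tendsto_pow_atTop_nhds_top_iff.2 h1
  exact absurd (le_of_tendsto' h2 hbound) (not_le.2 (glueConst_ne_top q β).lt_top)

end Negative

/-! ### Unlikely events, the choice of the scale, and the density of contacts -/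

section Scale

variable {ν : Measure (ℤ → ℝ)} {q : ℕ} {ρ : ℕ → ℝ} {κ : ℕ → ℝ≥0∞} {γ : ℝ}

/-- Hölder's inequality with exponents `1 / γ` and `1 / (1 - γ)`, between `f ^ γ` and one. -/
lemma setLIntegral_rpow_le {X : Type*} [MeasurableSpace X] {μ : Measure X} {f : X → ℝ≥0∞}
    (hf : Measurable f) (hγ0 : 0 ≤ γ) (hγ1 : γ ≤ 1) (A : Set X) :
    ∫⁻ x in A, f x ^ γ ∂μ ≤ (∫⁻ x in A, f x ∂μ) ^ γ * μ A ^ (1 - γ) := by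
  have := ENNReal.lintegral_mul_norm_pow_le (μ := μ.restrict A) (f := f) (g := fun _ => 1)
    hf.aemeasurable aemeasurable_const hγ0 (sub_nonneg.2 hγ1) (add_sub_cancel _ _)
  simpa using this

lemma fracMoment_le (hν : IsDisorderLaw ν q ρ) (hγ0 : 0 ≤ γ) (hγ1 : γ ≤ 1) (β h : ℝ) (n : ℕ) :
    fracMoment ν κ β h γ n ≤ annealedPinned κ ρ β h n ^ γ := by
  have := hν.isProbabilityMeasure
  have h := setLIntegral_rpow_le (μ := ν) (measurable_pinned (κ := κ) (β := β) (h := h) 0 n)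
    hγ0 hγ1 Set.univ
  simpa [lintegral_pinned hν, fracMoment] using h

/-- The fractional moment is small if the environment can be forced into an unlikely event by the
contacts of most configurations. -/
lemma fracMoment_le_of_event (hν : IsDisorderLaw ν q ρ) (hγ0 : 0 ≤ γ) (hγ1 : γ ≤ 1) {β h : ℝ}
    {n : ℕ} {A : Set (ℤ → ℝ)} (hA : MeasurableSet A) (good : List ℕ → Prop) [DecidablePred good]
    {ε : ℝ≥0∞} (hgood : ∀ l, good l → endpoint 0 l = n →
      ν {w | w + contactShift ρ β (supp 0 l) ∉ A} ≤ ε) :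
    fracMoment ν κ β h γ n ≤ annealedPinned κ ρ β h n ^ γ * ν A ^ (1 - γ) +
      (gapSum κ (fun l => annealedWeight ρ β h l * if endpoint 0 l = n ∧ ¬ good l then 1 else 0) +
        annealedPinned κ ρ β h n * ε) ^ γ := by
  have := hν.isProbabilityMeasure
  have hm := measurable_pinned (κ := κ) (β := β) (h := h) 0 n
  rw [fracMoment, ← lintegral_add_compl _ hA]
  refine add_le_add ?_ ?_
  · refine (setLIntegral_rpow_le hm hγ0 hγ1 A).trans ?_
    refine mul_le_mul_left (ENNReal.rpow_le_rpow ?_ hγ0) _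
    rw [← lintegral_pinned hν]
    exact setLIntegral_le_lintegral _ _
  -- Off `A` the annealed mean is computed path by path: a good path sees a shifted environment that
  -- avoids `A` with probability at most `ε`, and a bad path is counted with its full weight.
  · refine (setLIntegral_rpow_le hm hγ0 hγ1 Aᶜ).trans ?_
    have h1 : ν Aᶜ ^ (1 - γ) ≤ 1 := by
      simpa using ENNReal.rpow_le_rpow (prob_le_one (μ := ν) (s := Aᶜ)) (sub_nonneg.2 hγ1)
    refine (mul_le_of_le_one_right zero_le h1).trans (ENNReal.rpow_le_rpow ?_ hγ0)
    have hind : Measurable (Aᶜ.indicator (1 : (ℤ → ℝ) → ℝ≥0∞)) := measurable_one.indicator hA.compl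
    have h2 : ∫⁻ w in Aᶜ, pinned κ β h w 0 n ∂ν =
        ∫⁻ w, pinned κ β h w 0 n * Aᶜ.indicator 1 w ∂ν := by
      rw [← lintegral_indicator hA.compl]
      refine lintegral_congr fun w => ?_
      by_cases hw : w ∈ Aᶜ <;> simp [hw]
    rw [h2, lintegral_pinned_mul hν β h n hind, annealedPinned, mul_comm (gapSum _ _) ε,
      ← gapSum_const_mul, ← gapSum_add]
    refine gapSum_mono fun l => ?_
    by_cases hl : endpoint 0 l = n
    swap
    · simp [hl]
    have h3 : ∫⁻ w, Aᶜ.indicator 1 (w + contactShift ρ β (supp 0 l)) ∂ν =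
        ν {w | w + contactShift ρ β (supp 0 l) ∉ A} := by
      have hms : MeasurableSet {w | w + contactShift ρ β (supp 0 l) ∉ A} :=
        (measurable_id.add_const (contactShift ρ β (supp 0 l))) hA.compl
      rw [← lintegral_indicator_one hms]
      rfl
    rw [if_pos hl, if_pos hl, h3]
    by_cases hg : good l
    · refine le_trans ?_ le_add_self
      rw [mul_one, mul_comm]
      exact mul_le_mul_left (hgood l hg hl) _
    · refine le_trans ?_ le_self_add
      rw [if_pos ⟨hl, hg⟩]
      exact mul_le_mul_right prob_le_one _

/-- A gap of length `t + 1` can cross to `k` from at most `t + 1` sites. From sites farther than `R`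
from `k` it must satisfy `R ≤ t`, so the crude bound `D` only meets the tail of a convergent series.
-/
lemma sum_mul_rpowTail_le {A : ℕ → ℝ≥0∞} {η D : ℝ≥0∞} {k R : ℕ}
    (hη : ∀ j < k, k ≤ j + R → A j ≤ η) (hD : ∀ j < k, A j ≤ D) :
    ∑ j ∈ Finset.range k, A j * rpowTail κ γ (k - j) ≤
      η * ∑' t : ℕ, (t + 1) * κ t ^ γ + D * ∑' t : ℕ, if R ≤ t then (t + 1) * κ t ^ γ else 0 := by
  simp only [rpowTail, ← ENNReal.tsum_mul_left]
  rw [← ENNReal.tsum_add, ← Summable.tsum_finsetSum fun _ _ => ENNReal.summable]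
  refine ENNReal.tsum_le_tsum fun t => ?_
  calc ∑ j ∈ Finset.range k, A j * (if k - j ≤ t + 1 then κ t ^ γ else 0)
      ≤ ∑ j ∈ Finset.range k, if k - j ≤ t + 1 then
          (η + if R ≤ t then D else 0) * κ t ^ γ else 0 := by
        refine Finset.sum_le_sum fun j hj => ?_
        rw [Finset.mem_range] at hj
        split_ifs with h1 h2
        · exact mul_le_mul_left ((hD j hj).trans le_add_self) _
        · exact mul_le_mul_left ((hη j hj (by omega)).trans le_self_add) _
        · simp
    _ = ((Finset.range k).filter fun j => k - j ≤ t + 1).card *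
          ((η + if R ≤ t then D else 0) * κ t ^ γ) := by
        rw [← Finset.sum_filter, Finset.sum_const, nsmul_eq_mul]
    _ ≤ (t + 1) * ((η + if R ≤ t then D else 0) * κ t ^ γ) := by
        refine mul_le_mul_left ?_ _
        have h : ((Finset.range k).filter fun j => k - j ≤ t + 1) ⊆ Finset.Ico (k - (t + 1)) k := by
          intro j hj
          rw [Finset.mem_filter, Finset.mem_range] at hj
          rw [Finset.mem_Ico]
          omega
        have h2 := Finset.card_le_card h
        rw [Nat.card_Ico] at h2
        have h3 : ((Finset.range k).filter fun j => k - j ≤ t + 1).card ≤ t + 1 := by omega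
        exact_mod_cast h3
    _ = _ := by split_ifs <;> ring

lemma tendsto_tsum_ite_le {f : ℕ → ℝ≥0∞} (hf : ∑' t, f t ≠ ∞) :
    Tendsto (fun R => ∑' t, if R ≤ t then f t else 0) atTop (𝓝 0) := by
  refine (ENNReal.tendsto_sum_nat_add f hf).congr fun R => ?_
  rw [← Summable.sum_add_tsum_nat_add' (f := fun t => if R ≤ t then f t else 0) (k := R)
    ENNReal.summable, Finset.sum_eq_zero, zero_add]
  · simp
  · intro t ht
    rw [Finset.mem_range] at ht
    exact if_neg (by omega)

lemma decoupleConst_mono (q : ℕ) {β b h H : ℝ} (hβ : 0 ≤ β) (hb : β ≤ b) (hH : |h| ≤ H) :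
    decoupleConst q β h ≤ decoupleConst q b H := by
  have hb0 : 0 ≤ b := hβ.trans hb
  have hH' : |h| ≤ |H| := hH.trans (le_abs_self H)
  unfold decoupleConst
  gcongr

lemma decoupleConst_ne_top (q : ℕ) (β h : ℝ) : decoupleConst q β h ≠ ∞ :=
  ENNReal.mul_ne_top ENNReal.ofReal_ne_top
    (ENNReal.mul_ne_top (ENNReal.pow_ne_top ENNReal.ofNat_ne_top) ENNReal.ofReal_ne_top)

lemma glueConst_mono (q : ℕ) {β b : ℝ} (hβ : 0 ≤ β) (hb : β ≤ b) :
    glueConst q β ≤ glueConst q b := by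
  unfold glueConst
  gcongr

lemma exists_ofReal_le_of_tendsto {f : ℝ≥0∞ → ℝ≥0∞} (hf : Tendsto f (𝓝 0) (𝓝 0)) {c : ℝ≥0∞}
    (hc : c ≠ 0) : ∃ ε : ℝ, 0 < ε ∧ f (ENNReal.ofReal ε) ≤ c := by
  have h1 : Tendsto (fun ε : ℝ => f (ENNReal.ofReal ε)) (𝓝[>] 0) (𝓝 0) := by
    refine (hf.comp ?_).mono_left nhdsWithin_le_nhds
    simpa using (ENNReal.continuous_ofReal.tendsto 0)
  have h2 := (h1.eventually_lt_const (pos_iff_ne_zero.2 hc)).and self_mem_nhdsWithin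
  obtain ⟨ε, h3, h4⟩ := h2.exists
  exact ⟨ε, h4, h3.le⟩

/-- At the inverse distance to the annealed critical point, it suffices to make the fractional
moments small near that scale, by forcing an unlikely event. -/
theorem exists_scale (hκ : ∑' t, κ t = 1) (hγ0 : 0 < γ) (hγ1 : γ < 1)
    (hsum : ∑' t : ℕ, (t + 1) * κ t ^ γ ≠ ∞) (q : ℕ) (b : ℝ) :
    ∃ R : ℕ, ∃ ε : ℝ, 0 < ε ∧ ∀ {ν : Measure (ℤ → ℝ)} {ρ : ℕ → ℝ} {β h : ℝ} {k : ℕ},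
      IsDisorderLaw ν q ρ → 0 ≤ β → β ≤ b → |h| ≤ β ^ 2 * q ^ 2 + β ^ 2 / 2 →
      IsCriticalWeight κ (glueConst q β) (annealedWeight ρ β h) → 1 ≤ k →
      (∀ j < k, k ≤ j + R → ∃ A : Set (ℤ → ℝ), MeasurableSet A ∧ ν A ≤ ENNReal.ofReal ε ∧
        ∃ (good : List ℕ → Prop) (_ : DecidablePred good), (∀ l, good l → endpoint 0 l = j →
          ν {w | w + contactShift ρ β (supp 0 l) ∉ A} ≤ ENNReal.ofReal ε) ∧
        gapSum κ (fun l => annealedWeight ρ β h l * if endpoint 0 l = j ∧ ¬ good l then 1 else 0) ≤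
          ENNReal.ofReal ε) →
      ∃ D : ℝ≥0∞, D ≠ ∞ ∧ ∀ N, fracMoment ν κ β (h + 1 / k) γ N ≤ D := by
  set e : ℝ≥0∞ := ENNReal.ofReal (Real.exp 1) with he
  -- Constants uniform over `β ≤ b` and `k ≥ 1`: `E` bounds the annealed partition functions of size
  -- below `k` at `h + 1 / k`, the factor `e` coming from `j / k ≤ 1`, and `H` bounds `|h + 1 / k|`.
  set G := glueConst q b with hG
  set E := e * G ^ 3 with hE
  set H := b ^ 2 * q ^ 2 + b ^ 2 / 2 + 1 with hH
  set B := ∑' t, κ t ^ γ with hB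
  set B' := ∑' t : ℕ, (t + 1) * κ t ^ γ with hB'
  set C := decoupleConst q b H * (1 + q * B) with hC
  have hGtop : G ≠ ∞ := glueConst_ne_top q b
  have hetop : e ≠ ∞ := ENNReal.ofReal_ne_top
  have hEtop : E ≠ ∞ := ENNReal.mul_ne_top hetop (ENNReal.pow_ne_top hGtop)
  have hEγ : E ^ γ ≠ ∞ := ENNReal.rpow_ne_top_of_nonneg hγ0.le hEtop
  have hBtop : B ≠ ∞ := by
    refine ne_top_of_le_ne_top hsum (ENNReal.tsum_le_tsum fun t => ?_)
    exact le_mul_of_one_le_left zero_le le_add_self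
  have hCtop : C ≠ ∞ := ENNReal.mul_ne_top (decoupleConst_ne_top _ _ _)
    (ENNReal.add_ne_top.2 ⟨ENNReal.one_ne_top, ENNReal.mul_ne_top (ENNReal.natCast_ne_top q) hBtop⟩)
  have half0 : (2⁻¹ : ℝ≥0∞) ≠ 0 := by simp
  -- The criterion asks for a total of at most one. Sizes within `R` of `k` get one half through
  -- `η`, the remaining sizes get the other half through `R`, and `ε` is then chosen so that the
  -- event bound yields `η`.
  obtain ⟨η, hη0, hη⟩ : ∃ η : ℝ, 0 < η ∧ C * (ENNReal.ofReal η * B') ≤ 2⁻¹ := by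
    refine exists_ofReal_le_of_tendsto (f := fun x => C * (x * B')) ?_ half0
    have h1 : Tendsto (fun x : ℝ≥0∞ => x * B') (𝓝 0) (𝓝 (0 * B')) :=
      ENNReal.Tendsto.mul_const tendsto_id (Or.inr hsum)
    have h2 := ENNReal.Tendsto.const_mul (a := C) h1 (Or.inr hCtop)
    simpa using h2
  obtain ⟨R, hR⟩ : ∃ R : ℕ, C * (E ^ γ * ∑' t : ℕ, if R ≤ t then (t + 1) * κ t ^ γ else 0) ≤
      2⁻¹ := by
    have h1 := ENNReal.Tendsto.const_mul (a := C) (ENNReal.Tendsto.const_mul (a := E ^ γ)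
      (tendsto_tsum_ite_le hsum) (Or.inr hEγ)) (Or.inr hCtop)
    rw [mul_zero, mul_zero] at h1
    obtain ⟨R, hR⟩ := (h1.eventually_lt_const (pos_iff_ne_zero.2 half0)).exists
    exact ⟨R, hR.le⟩
  obtain ⟨ε, hε0, hε⟩ : ∃ ε : ℝ, 0 < ε ∧ E ^ γ * ENNReal.ofReal ε ^ (1 - γ) +
      (e * ENNReal.ofReal ε + E * ENNReal.ofReal ε) ^ γ ≤ ENNReal.ofReal η := by
    refine exists_ofReal_le_of_tendsto
      (f := fun x => E ^ γ * x ^ (1 - γ) + (e * x + E * x) ^ γ) ?_ ?_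
    · have h1 : Tendsto (fun x : ℝ≥0∞ => x ^ (1 - γ)) (𝓝 0) (𝓝 0) := by
        have := (ENNReal.continuous_rpow_const (y := 1 - γ)).tendsto 0
        rwa [ENNReal.zero_rpow_of_pos (by linarith)] at this
      have h2 := ENNReal.Tendsto.const_mul (a := E ^ γ) h1 (Or.inr hEγ)
      have h3 : Tendsto (fun x : ℝ≥0∞ => e * x + E * x) (𝓝 0) (𝓝 (e * 0 + E * 0)) :=
        (ENNReal.Tendsto.const_mul tendsto_id (Or.inr hetop)).add
          (ENNReal.Tendsto.const_mul tendsto_id (Or.inr hEtop))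
      rw [mul_zero, mul_zero, zero_add] at h3
      have h4 := ((ENNReal.continuous_rpow_const (y := γ)).tendsto 0).comp h3
      rw [ENNReal.zero_rpow_of_pos hγ0] at h4
      simpa using h2.add h4
    · exact (ENNReal.ofReal_pos.2 hη0).ne'
  refine ⟨R, ε, hε0, ?_⟩
  intro ν ρ β h k hν hβ hβb hh hW hk hevent
  have hk' : (1 : ℝ) ≤ k := by exact_mod_cast hk
  have hkk : h ≤ h + 1 / k := by
    have : (0 : ℝ) ≤ 1 / k := by positivity
    linarith
  have hGb : glueConst q β ≤ G := glueConst_mono q hβ hβb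
  have hexp : ∀ j < k, ENNReal.ofReal (Real.exp ((h + 1 / k - h) * j)) ≤ e := by
    intro j hj
    refine ENNReal.ofReal_le_ofReal (Real.exp_le_exp.2 ?_)
    have : (j : ℝ) ≤ k := by exact_mod_cast hj.le
    rw [add_sub_cancel_left, div_mul_eq_mul_div, one_mul]
    exact (div_le_one (by linarith)).2 this
  have hann : ∀ j < k, annealedPinned κ ρ β (h + 1 / k) j ≤ E := by
    intro j hj
    refine (annealedPinned_le ρ hkk j).trans (mul_le_mul' (hexp j hj) ?_)
    exact (hW.annealedPinned_le j).trans (pow_le_pow_left' hGb 3)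
  have hD : ∀ j < k, fracMoment ν κ β (h + 1 / k) γ j ≤ E ^ γ := fun j hj =>
    (fracMoment_le hν hγ0.le hγ1.le _ _ _).trans (ENNReal.rpow_le_rpow (hann j hj) hγ0.le)
  have hsmall : ∀ j < k, k ≤ j + R →
      fracMoment ν κ β (h + 1 / k) γ j ≤ ENNReal.ofReal η := by
    intro j hj hjR
    obtain ⟨A, hA, hνA, good, hdec, hgood, hbad⟩ := hevent j hj hjR
    refine (fracMoment_le_of_event hν hγ0.le hγ1.le hA good hgood).trans (le_trans ?_ hε)
    refine add_le_add (mul_le_mul' (ENNReal.rpow_le_rpow (hann j hj) hγ0.le)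
      (ENNReal.rpow_le_rpow hνA (sub_nonneg.2 hγ1.le))) (ENNReal.rpow_le_rpow ?_ hγ0.le)
    refine add_le_add ?_ (mul_le_mul_left (hann j hj) _)
    refine le_trans ?_ (mul_le_mul' (hexp j hj) hbad)
    rw [← gapSum_const_mul]
    refine gapSum_mono fun l => ?_
    split_ifs with hl
    · rw [mul_one, mul_one]
      exact annealedWeight_le_of_endpoint ρ hkk hl.1
    · simp
  have hcrit : decoupleConst q β (h + 1 / k) * (1 + q * ∑' t, κ t ^ γ) *
      ∑ j ∈ Finset.range k, fracMoment ν κ β (h + 1 / k) γ j * rpowTail κ γ (k - j) ≤ 1 := by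
    calc _ ≤ C * (ENNReal.ofReal η * B' +
          E ^ γ * ∑' t : ℕ, if R ≤ t then (t + 1) * κ t ^ γ else 0) := by
          refine mul_le_mul' (mul_le_mul_left (decoupleConst_mono q hβ hβb ?_) _)
            (sum_mul_rpowTail_le hsmall hD)
          have h1 : (1 : ℝ) / k ≤ 1 := (div_le_one (by linarith)).2 hk'
          have h2 : |1 / (k : ℝ)| ≤ 1 := by rwa [abs_of_nonneg (by positivity)]
          have h3 : β ^ 2 ≤ b ^ 2 := by gcongr
          have h4 : β ^ 2 * q ^ 2 ≤ b ^ 2 * q ^ 2 := by gcongr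
          exact (abs_add_le _ _).trans (by linarith)
      _ ≤ 2⁻¹ + 2⁻¹ := by
          rw [mul_add]
          exact add_le_add hη hR
      _ = 1 := ENNReal.inv_two_add_inv_two
  have hE1 : 1 ≤ E := by
    refine one_le_mul ?_ (one_le_pow₀ (one_le_glueConst q b))
    rw [he, ENNReal.one_le_ofReal, Real.one_le_exp_iff]
    exact zero_le_one
  refine ⟨_, ?_, fracMoment_le_of_criterion hν hκ hβ hγ0 hγ1.le hk hcrit⟩
  refine ENNReal.sum_ne_top.2 fun i _ => ?_
  refine ne_top_of_le_ne_top ?_ (fracMoment_le hν hγ0.le hγ1.le _ _ _)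
  refine ENNReal.rpow_ne_top_of_nonneg hγ0.le (hW.annealedPinned_ne_top hkk i)

/-- Configurations with a small density of contacts carry little mass. -/
lemma exists_density (hmean : ∑' t : ℕ, κ t * (t + 1) ≠ ∞) (q : ℕ) {b : ℝ} {ε : ℝ}
    (hε : 0 < ε) :
    ∃ c : ℝ, 0 < c ∧ c ≤ 1 ∧ ∀ {ν : Measure (ℤ → ℝ)} {ρ : ℕ → ℝ} {β h : ℝ} {j : ℕ},
      IsDisorderLaw ν q ρ → 0 ≤ β → β ≤ b → |h| ≤ β ^ 2 * q ^ 2 + β ^ 2 / 2 →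
      IsCriticalWeight κ (glueConst q β) (annealedWeight ρ β h) → 1 ≤ j →
      gapSum κ (fun l => annealedWeight ρ β h l *
        if endpoint 0 l = j ∧ ¬ c * j ≤ l.length then 1 else 0) ≤ ENNReal.ofReal ε := by
  -- A bound for the weighted mean of one gap: a single contact has weight `exp (h + β ^ 2 / 2)`,
  -- and `h ≤ β ^ 2 q ^ 2 + β ^ 2 / 2`.
  set M := ENNReal.ofReal (Real.exp (b ^ 2 * q ^ 2 + b ^ 2)) * ∑' t : ℕ, κ t * (t + 1) with hM
  have hMtop : M ≠ ∞ := ENNReal.mul_ne_top ENNReal.ofReal_ne_top hmean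
  set X := glueConst q b ^ 6 * M with hX
  have hXtop : X ≠ ∞ := ENNReal.mul_ne_top (ENNReal.pow_ne_top (glueConst_ne_top q b)) hMtop
  obtain ⟨c, hc0, hc⟩ : ∃ c : ℝ, 0 < c ∧ ENNReal.ofReal c * X ≤ ENNReal.ofReal ε := by
    refine exists_ofReal_le_of_tendsto (f := fun x => x * X) ?_ (ENNReal.ofReal_pos.2 hε).ne'
    have h1 : Tendsto (fun x : ℝ≥0∞ => x * X) (𝓝 0) (𝓝 (0 * X)) :=
      ENNReal.Tendsto.mul_const tendsto_id (Or.inr hXtop)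
    simpa using h1
  refine ⟨min c 1, lt_min hc0 one_pos, min_le_right _ _, ?_⟩
  intro ν ρ β h j hν hβ hβb hh hW hj
  set d := min c 1 with hd
  have hd0 : 0 < d := lt_min hc0 one_pos
  -- Paths with fewer than `d j` contacts lie in the levels up to `m₀`. Their mass is at most `m₀ X
  -- / j ≤ c X` by the Markov bound on few contacts.
  set m₀ := ⌊d * j⌋₊ with hm₀
  have hj' : (j : ℝ≥0∞) ≠ 0 := by
    rw [Nat.cast_ne_zero]; omega
  have hmean' : ∑' t : ℕ, κ t * (annealedWeight ρ β h [t] * (t + 1)) ≤ M := by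
    rw [hM, ← ENNReal.tsum_mul_left]
    refine ENNReal.tsum_le_tsum fun t => ?_
    rw [annealedWeight_singleton hν, mul_left_comm]
    refine mul_le_mul_left (ENNReal.ofReal_le_ofReal (Real.exp_le_exp.2 ?_)) _
    have h3 : β ^ 2 ≤ b ^ 2 := by gcongr
    have h4 : β ^ 2 * q ^ 2 ≤ b ^ 2 * q ^ 2 := by gcongr
    linarith [(abs_le.1 hh).2]
  have hbad : gapSum κ (fun l => annealedWeight ρ β h l *
      if endpoint 0 l = j ∧ ¬ d * j ≤ l.length then 1 else 0) ≤
      ∑ m ∈ Finset.range (m₀ + 1), levelSum κ m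
        (fun l => annealedWeight ρ β h l * if endpoint 0 l = j then 1 else 0) := by
    rw [gapSum, tsum_eq_sum (s := Finset.range (m₀ + 1))]
    · refine Finset.sum_le_sum fun m _ => levelSum_mono fun l _ => mul_le_mul_right ?_ _
      split_ifs with h1 h2
      · exact le_rfl
      · exact absurd h1.1 h2
      · exact zero_le
      · exact le_rfl
    · intro m hm
      have h0 : levelSum κ m (fun _ => 0) = 0 := by
        simpa using levelSum_const_mul (κ := κ) (m := m) 0 fun _ => 0
      refine (levelSum_congr (g := fun _ => 0) fun l hl => ?_).trans h0
      rw [if_neg, mul_zero]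
      rintro ⟨-, h2⟩
      refine h2 ?_
      rw [Finset.mem_range, not_lt] at hm
      rw [hl]
      have h3 := (Nat.lt_floor_add_one (d * j)).le
      have h4 : ((m₀ : ℝ) + 1) ≤ m := by exact_mod_cast hm
      linarith
  refine hbad.trans ?_
  have h1 := hW.mul_sum_levelSum_endpoint_le m₀ j
  have h2 : (m₀ : ℝ≥0∞) * (glueConst q β ^ 6 *
      ∑' t : ℕ, κ t * (annealedWeight ρ β h [t] * (t + 1))) ≤ j * ENNReal.ofReal ε := by
    calc _ ≤ (ENNReal.ofReal c * j) * X := by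
          refine mul_le_mul' ?_ (mul_le_mul' (pow_le_pow_left' (glueConst_mono q hβ hβb) 6) hmean')
          rw [← ENNReal.ofReal_natCast, ← ENNReal.ofReal_natCast j,
            ← ENNReal.ofReal_mul hc0.le]
          refine ENNReal.ofReal_le_ofReal ((Nat.floor_le (by positivity)).trans ?_)
          exact mul_le_mul_of_nonneg_right (min_le_left _ _) (Nat.cast_nonneg j)
      _ = j * (ENNReal.ofReal c * X) := by ring
      _ ≤ _ := mul_le_mul_right hc _
  exact (ENNReal.mul_le_mul_iff_right hj' (ENNReal.natCast_ne_top j)).1 (h1.trans h2)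

end Scale

/-! ### The two gaps: the sum and the sum of squares of the environment -/

section Events

variable {ν : Measure (ℤ → ℝ)} {q : ℕ} {ρ : ℕ → ℝ} {κ : ℕ → ℝ≥0∞} {β h γ : ℝ}

lemma sum_Icc_natAbs (f : ℕ → ℝ) (s : ℤ) (q : ℕ) :
    ∑ i ∈ Finset.Icc (s - q) (s + q), f (s - i).natAbs = f 0 + 2 * ∑ k ∈ Finset.Icc 1 q, f k := by
  induction q with
  | zero => simp
  | succ q ih =>
    have e : Finset.Icc (s - (q + 1 : ℕ)) (s + (q + 1 : ℕ)) =
        insert (s - (q + 1)) (insert (s + (q + 1)) (Finset.Icc (s - q) (s + q))) := by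
      ext i
      simp only [Finset.mem_insert, Finset.mem_Icc]
      push_cast
      omega
    rw [e, Finset.sum_insert, Finset.sum_insert, ih, ← Finset.insert_Icc_right_eq_Icc_add_one,
      Finset.sum_insert]
    · rw [show (s - (s - ((q : ℤ) + 1))).natAbs = q + 1 by omega,
        show (s - (s + ((q : ℤ) + 1))).natAbs = q + 1 by omega]
      ring
    · simp
    · omega
    · rw [Finset.mem_Icc]; omega
    · rw [Finset.mem_insert, Finset.mem_Icc]; omega

/-- The summation window exceeds `[1, j]` by `q` on either side, so it captures the full row of
covariances of each contact, with no boundary correction. -/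
lemma sum_contactShift (hν : IsDisorderLaw ν q ρ) (β : ℝ) {S : Finset ℕ} {j : ℕ}
    (hS : ∀ s ∈ S, 0 < s ∧ s ≤ j) :
    ∑ i ∈ Finset.Icc (1 - q : ℤ) (j + q), contactShift ρ β S i =
      β * (1 + 2 * ∑ k ∈ Finset.Icc 1 q, ρ k) * S.card := by
  simp only [contactShift, meanShift]
  rw [Finset.sum_comm]
  have : ∀ s ∈ S, ∑ i ∈ Finset.Icc (1 - q : ℤ) (j + q), β * ρ ((s : ℤ) - i).natAbs =
      β * (1 + 2 * ∑ k ∈ Finset.Icc 1 q, ρ k) := by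
    intro s hs
    have hs' := hS s hs
    rw [← Finset.mul_sum, ← hν.variance_one, ← sum_Icc_natAbs ρ s q]
    congr 1
    symm
    refine Finset.sum_subset (Finset.Icc_subset_Icc (by omega) (by omega)) fun i _ hi => ?_
    rw [Finset.mem_Icc] at hi
    exact hν.finite_range _ (by omega)
  rw [Finset.sum_congr rfl this, Finset.sum_const, nsmul_eq_mul, mul_comm]

/-- A quadratic lower bound for the shift of the critical point, when the correlations do not
cancel. -/
theorem exists_quadratic_gap (hν : IsDisorderLaw ν q ρ) (hκ : ∑' t, κ t = 1) (hγ0 : 0 < γ)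
    (hγ1 : γ < 1) (hsum : ∑' t : ℕ, (t + 1) * κ t ^ γ ≠ ∞) (hmean : ∑' t : ℕ, κ t * (t + 1) ≠ ∞)
    (hσ : 0 < 1 + 2 * ∑ k ∈ Finset.Icc 1 q, ρ k) :
    ∃ a : ℝ, 0 < a ∧ ∀ β h : ℝ, 0 < β → β ≤ 1 → |h| ≤ β ^ 2 * q ^ 2 + β ^ 2 / 2 →
      IsCriticalWeight κ (glueConst q β) (annealedWeight ρ β h) →
      ∃ u : ℝ, a * β ^ 2 ≤ u ∧ ∃ D : ℝ≥0∞, D ≠ ∞ ∧ ∀ N, fracMoment ν κ β (h + u) γ N ≤ D := by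
  set σ := 1 + 2 * ∑ k ∈ Finset.Icc 1 q, ρ k with hσd
  obtain ⟨R, ε, hε, hscale⟩ := exists_scale hκ hγ0 hγ1 hsum q 1
  obtain ⟨c, hc0, -, hdens⟩ := exists_density hmean q (b := 1) hε
  -- With `β ^ 2 k ≥ B`, the first terms ensure that sizes within `R` of `k` satisfy `k ≤ 2 j` and
  -- `2 q ≤ j`, and the last one is what Chebyshev's inequality needs. Rounding `B / β ^ 2` up gives
  -- `1 / k ≥ β ^ 2 / (B + 1)`.
  set B : ℝ := 2 * R + 4 * q + 2 + 16 * (2 * q + 1) / (σ ^ 2 * c ^ 2 * ε) with hB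
  have hX0 : 0 < 16 * (2 * q + 1) / (σ ^ 2 * c ^ 2 * ε) := by positivity
  have hB0 : 0 < B := by positivity
  refine ⟨1 / (B + 1), by positivity, fun β h hβ hβ1 hh hW => ?_⟩
  set k := ⌈B / β ^ 2⌉₊ with hk
  have hβ2 : 0 < β ^ 2 := by positivity
  have hβ21 : β ^ 2 ≤ 1 := pow_le_one₀ hβ.le hβ1
  have hkB : B / β ^ 2 ≤ k := Nat.le_ceil _
  have hkB' : B ≤ β ^ 2 * k := by rwa [div_le_iff₀' hβ2] at hkB
  have hkB2 : B ≤ k := hkB'.trans (mul_le_of_le_one_left (Nat.cast_nonneg k) hβ21)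
  have hk2 : 2 * R + 4 * q + 2 ≤ k := by
    have : ((2 * R + 4 * q + 2 : ℕ) : ℝ) ≤ k := by push_cast; linarith
    exact_mod_cast this
  have hk0 : (0 : ℝ) < k := lt_of_lt_of_le hB0 hkB2
  refine ⟨1 / k, ?_, hscale hν hβ.le hβ1 hh hW (by omega) fun j hj hjR => ?_⟩
  · rw [div_mul_eq_mul_div, one_mul, div_le_div_iff₀ (by positivity) hk0, one_mul]
    have := (Nat.ceil_lt_add_one (by positivity : 0 ≤ B / β ^ 2)).le
    calc β ^ 2 * k ≤ β ^ 2 * (B / β ^ 2 + 1) := mul_le_mul_of_nonneg_left this hβ2.le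
      _ = B + β ^ 2 := by field_simp
      _ ≤ B + 1 := by linarith
  have hj1 : 1 ≤ j := by omega
  have hj0 : (0 : ℝ) < j := by exact_mod_cast hj1
  have hjk : (k : ℝ) ≤ 2 * j := by
    have : k ≤ 2 * j := by omega
    exact_mod_cast this
  have hjq : (j : ℝ) + 2 * q ≤ 2 * j := by
    have : j + 2 * q ≤ 2 * j := by omega
    exact_mod_cast this
  set I := Finset.Icc (1 - q : ℤ) (j + q) with hI
  have hIcard : (I.card : ℝ) = j + 2 * q := by
    rw [hI, Int.card_Icc, show (j + q + 1 - (1 - q) : ℤ).toNat = j + 2 * q by omega]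
    push_cast
    ring
  -- Half of the least shift `β σ c j` of the sum under a path of density `c`. The event that the
  -- sum reaches `t` is unlikely, and to miss it after the shift the unshifted sum must be below
  -- `-t`.
  set t : ℝ := β * σ * c * j / 2 with ht
  have ht0 : 0 < t := by positivity
  have hcheb : ν {w | t ≤ |linComb I (fun _ => 1) id w|} ≤ ENNReal.ofReal ε := by
    refine (hν.measure_le_abs_linComb I (fun _ => 1) ht0).trans (ENNReal.ofReal_le_ofReal ?_)
    simp only [one_pow, Finset.sum_const, nsmul_eq_mul, mul_one, hIcard]
    rw [div_le_iff₀ (by positivity)]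
    have h1 : 16 * (2 * q + 1) / (σ ^ 2 * c ^ 2 * ε) ≤ β ^ 2 * (2 * j) := by
      have h2 : β ^ 2 * k ≤ β ^ 2 * (2 * j) := mul_le_mul_of_nonneg_left hjk hβ2.le
      have h3 : (0 : ℝ) ≤ 2 * R + 4 * q + 2 := by positivity
      linarith
    rw [div_le_iff₀ (by positivity)] at h1
    calc (2 * q + 1) * ((j : ℝ) + 2 * q) ≤ (2 * q + 1) * (2 * j) := by gcongr
      _ = 16 * (2 * q + 1) * (j / 8) := by ring
      _ ≤ β ^ 2 * (2 * j) * (σ ^ 2 * c ^ 2 * ε) * (j / 8) := by gcongr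
      _ = ε * t ^ 2 := by rw [ht]; ring
  refine ⟨{w | t ≤ linComb I (fun _ => 1) id w},
    measurableSet_le measurable_const (measurable_linComb _ _ _),
    (measure_mono (Set.ofPred_subset_ofPred.2 fun w hw => hw.trans (le_abs_self _))).trans hcheb,
    fun l => c * j ≤ l.length, fun _ => Classical.dec _, fun l hl hlj => ?_, ?_⟩
  · refine (measure_mono fun w hw => ?_).trans hcheb
    simp only [Set.mem_ofPred_eq, not_le] at hw ⊢
    have hsum := sum_contactShift hν β (S := supp 0 l) (j := j) fun s hs => by
      have := lt_and_le_of_mem_supp hs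
      rw [hlj] at this
      exact this
    have hadd : linComb I (fun _ => 1) id (w + contactShift ρ β (supp 0 l)) =
        linComb I (fun _ => 1) id w + ∑ i ∈ I, contactShift ρ β (supp 0 l) i := by
      simp [linComb, Finset.sum_add_distrib]
    rw [hadd, hsum, card_supp] at hw
    have h1 : β * σ * (c * j) ≤ β * σ * l.length := by gcongr
    rw [le_abs]
    right
    have h2 : 2 * t = β * σ * (c * j) := by rw [ht]; ring
    linarith
  · convert hdens hν hβ.le hβ1 hh hW hj1 using 3

lemma abs_contactShift_le (hν : IsDisorderLaw ν q ρ) (hβ : 0 ≤ β) (S : Finset ℕ) (i : ℕ) :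
    |contactShift ρ β S i| ≤ β * (2 * q + 1) := by
  have h1 := sum_abs_meanShift_le hν {i} (fun _ => 1) S
  simp only [meanShift, Finset.sum_singleton, abs_one, one_mul, mul_one] at h1
  rw [contactShift, meanShift]
  calc _ ≤ ∑ s ∈ S, |β * ρ ((s : ℤ) - i).natAbs| := Finset.abs_sum_le_sum_abs _ _
    _ = β * ∑ s ∈ S, |ρ ((i : ℤ) - s).natAbs| := by
      rw [Finset.mul_sum]
      refine Finset.sum_congr rfl fun s _ => ?_
      rw [abs_mul, abs_of_nonneg hβ, show ((s : ℤ) - i).natAbs = ((i : ℤ) - s).natAbs by omega]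
    _ ≤ _ := mul_le_mul_of_nonneg_left h1 hβ

/-- The shift induced by a configuration of large energy is large in the mean square. -/
lemma le_sum_sq_contactShift (ρ : ℕ → ℝ) (β : ℝ) {e : ℝ} (he : 0 ≤ e) {S : Finset ℕ} {j : ℕ}
    (hS : ∀ s ∈ S, 0 < s ∧ s ≤ j) (henergy : e * S.card ≤ energy ρ S) :
    β ^ 2 * e ^ 2 * S.card ≤ ∑ i ∈ Finset.Icc 1 (j : ℤ), contactShift ρ β S i ^ 2 := by
  rcases Nat.eq_zero_or_pos S.card with h0 | h0
  · rw [h0, Nat.cast_zero, mul_zero]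
    exact Finset.sum_nonneg fun _ _ => sq_nonneg _
  have h0' : (0 : ℝ) < S.card := by exact_mod_cast h0
  -- The shift summed over the contacts alone is `β` times the energy; Cauchy–Schwarz over `S` then
  -- bounds its square sum from below by `β ^ 2 energy ^ 2 / |S|`.
  have h1 : ∑ s ∈ S, contactShift ρ β S s = β * energy ρ S := by
    simp only [contactShift, meanShift, energy, Finset.mul_sum]
    rw [Finset.sum_comm]
  have h2 : ∑ s ∈ S, contactShift ρ β S s ^ 2 ≤
      ∑ i ∈ Finset.Icc 1 (j : ℤ), contactShift ρ β S i ^ 2 := by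
    have h3 : ∑ s ∈ S, contactShift ρ β S s ^ 2 =
        ∑ i ∈ S.map Nat.castEmbedding, contactShift ρ β S i ^ 2 := by
      rw [Finset.sum_map]
      rfl
    rw [h3]
    refine Finset.sum_le_sum_of_subset_of_nonneg (fun i hi => ?_) fun _ _ _ => sq_nonneg _
    obtain ⟨s, hs, rfl⟩ := Finset.mem_map.1 hi
    have := hS s hs
    rw [Finset.mem_Icc, Nat.castEmbedding_apply]
    omega
  refine le_trans ?_ h2
  have h4 := sq_sum_le_card_mul_sum_sq (s := S) (f := fun s : ℕ => contactShift ρ β S s)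
  rw [h1] at h4
  have h5 : (e * S.card) ^ 2 ≤ energy ρ S ^ 2 := by gcongr
  have h6 : β ^ 2 * (e * S.card) ^ 2 ≤ S.card * ∑ s ∈ S, contactShift ρ β S s ^ 2 := by
    refine le_trans ?_ h4
    rw [mul_pow β]
    exact mul_le_mul_of_nonneg_left h5 (sq_nonneg β)
  refine le_of_mul_le_mul_left ?_ h0'
  linarith

lemma gapSum_endpoint_le_one (hκ : ∑' t, κ t = 1) (j : ℕ) :
    gapSum κ (fun l => if endpoint 0 l = j then 1 else 0) ≤ 1 := by
  have h := pinned_le_exp hκ (β := 0) (h := 0) (fun _ => 0) (a := 0) (b := j) le_rfl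
    (subset_refl _)
  simpa [pinned, boltzmann] using h

/-- A strict gap between the critical points, as soon as the annealed one is negative. -/
theorem exists_gap (hν : IsDisorderLaw ν q ρ) (hκ : ∑' t, κ t = 1) (hγ0 : 0 < γ)
    (hγ1 : γ < 1) (hsum : ∑' t : ℕ, (t + 1) * κ t ^ γ ≠ ∞) (hmean : ∑' t : ℕ, κ t * (t + 1) ≠ ∞)
    (hβ : 0 < β) (hh : |h| ≤ β ^ 2 * q ^ 2 + β ^ 2 / 2) (hneg : h < 0)
    (hW : IsCriticalWeight κ (glueConst q β) (annealedWeight ρ β h)) :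
    ∃ u : ℝ, 0 < u ∧ ∃ D : ℝ≥0∞, D ≠ ∞ ∧ ∀ N, fracMoment ν κ β (h + u) γ N ≤ D := by
  obtain ⟨R, ε, hε, hscale⟩ := exists_scale hκ hγ0 hγ1 hsum q β
  obtain ⟨c, hc0, -, hdens⟩ := exists_density hmean q (b := β) (half_pos hε)
  obtain ⟨V, hV0, hV⟩ := hν.exists_measure_le_abs_sum_sq
  have hβ2 : 0 < β ^ 2 := by positivity
  -- With this threshold, a path of energy below `e` per contact has weight at most `exp (h n / 2)`
  -- for `n` contacts, so the negative `h` makes such paths negligible.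
  set e : ℝ := -h / β ^ 2 with he
  have he0 : 0 < e := div_pos (neg_pos.2 hneg) hβ2
  -- A good path adds at least `4 η j` to the sum of squares. The fluctuation of that sum costs at
  -- most `η j` and the doubled cross term at most `2 η j`, off small events, which leaves the
  -- excess `η j` required by the event.
  set η : ℝ := β ^ 2 * e ^ 2 * c / 4 with hη
  have hη0 : 0 < η := by positivity
  set X : ℝ := (2 * q + 1) * (β * (2 * q + 1)) ^ 2 with hX
  have hdiv : ∀ x : ℝ, ∀ᶠ j : ℕ in atTop, x * j / (η * j) ^ 2 ≤ ε / 2 := by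
    intro x
    have h1 := tendsto_const_div_atTop_nhds_zero_nat (x / η ^ 2)
    filter_upwards [h1.eventually_le_const (half_pos hε), eventually_ge_atTop 1] with j hj hj1
    have hj0 : (0 : ℝ) < j := by exact_mod_cast hj1
    refine le_trans (le_of_eq ?_) hj
    field_simp
  have hexp : ∀ᶠ j : ℕ in atTop, Real.exp (h * c / 2 * j) ≤ ε / 2 := by
    have h1 : Tendsto (fun j : ℕ => h * c / 2 * (j : ℝ)) atTop atBot :=
      tendsto_natCast_atTop_atTop.const_mul_atTop_of_neg
        (by have := mul_neg_of_neg_of_pos hneg hc0; linarith)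
    exact (Real.tendsto_exp_atBot.comp h1).eventually_le_const (half_pos hε)
  obtain ⟨J, hJ⟩ := eventually_atTop.1 (((hdiv V).and (hdiv X)).and
    (hexp.and (eventually_ge_atTop 1)))
  -- Here `β` is fixed, so any scale will do whose sizes within distance `R` all exceed the
  -- threshold `J`.
  refine ⟨1 / (J + R + 1 : ℕ), by positivity,
    hscale hν hβ.le le_rfl hh hW (by omega) fun j _ hjR => ?_⟩
  obtain ⟨⟨hj1, hj2⟩, hj3, hj4⟩ := hJ j (by omega)
  have hj0 : (0 : ℝ) < j := by exact_mod_cast hj4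
  set I := Finset.Icc 1 (j : ℤ) with hI
  have hIcard : I.card = j := by rw [hI, Int.card_Icc]; omega
  have hcheb : ν {w | η * j ≤ |(∑ i ∈ I, w i ^ 2) - j|} ≤ ENNReal.ofReal (ε / 2) := by
    have h1 := hV I (η * j) (by positivity)
    rw [hIcard] at h1
    exact h1.trans (ENNReal.ofReal_le_ofReal hj1)
  have hhalf : ENNReal.ofReal (ε / 2) + ENNReal.ofReal (ε / 2) = ENNReal.ofReal ε := by
    rw [← ENNReal.ofReal_add (by positivity) (by positivity), add_halves]
  have hmeas : Measurable fun w : ℤ → ℝ => ∑ i ∈ I, w i ^ 2 :=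
    Finset.measurable_fun_sum _ fun i _ => (measurable_pi_apply i).pow_const 2
  refine ⟨{w | j + η * j ≤ ∑ i ∈ I, w i ^ 2}, measurableSet_le measurable_const hmeas, ?_,
    fun l => c * j ≤ l.length ∧ e * l.length ≤ energy ρ (supp 0 l), fun _ => Classical.dec _,
    fun l hl hlj => ?_, ?_⟩
  · refine (measure_mono fun w hw => ?_).trans
      (hcheb.trans (ENNReal.ofReal_le_ofReal (by linarith)))
    simp only [Set.mem_ofPred_eq] at hw ⊢
    rw [le_abs]
    left
    linarith
  · set s := contactShift ρ β (supp 0 l) with hs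
    have hS : ∀ x ∈ supp 0 l, 0 < x ∧ x ≤ j := fun x hx => by
      have := lt_and_le_of_mem_supp hx
      rwa [hlj] at this
    have hlow : 4 * (η * j) ≤ ∑ i ∈ I, s i ^ 2 := by
      refine le_trans ?_ (le_sum_sq_contactShift ρ β he0.le hS (by rw [card_supp]; exact hl.2))
      rw [card_supp]
      calc 4 * (η * j) = β ^ 2 * e ^ 2 * (c * j) := by rw [hη]; ring
        _ ≤ _ := mul_le_mul_of_nonneg_left hl.1 (by positivity)
    have hup : ∑ i ∈ I, s i ^ 2 ≤ (β * (2 * q + 1)) ^ 2 * j := by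
      calc ∑ i ∈ I, s i ^ 2 ≤ ∑ i ∈ I, (β * (2 * q + 1)) ^ 2 := by
            refine Finset.sum_le_sum fun i hi => ?_
            rw [hI, Finset.mem_Icc] at hi
            lift i to ℕ using by omega
            rw [← sq_abs]
            have := abs_contactShift_le hν hβ.le (supp 0 l) i
            gcongr
        _ = _ := by rw [Finset.sum_const, hIcard, nsmul_eq_mul, mul_comm]
    have hlin : ν {w | η * j ≤ |linComb I s id w|} ≤ ENNReal.ofReal (ε / 2) := by
      refine (hν.measure_le_abs_linComb I s (by positivity)).trans
        (ENNReal.ofReal_le_ofReal (le_trans ?_ hj2))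
      rw [hX, mul_assoc]
      refine div_le_div_of_nonneg_right (mul_le_mul_of_nonneg_left hup ?_) (sq_nonneg _)
      positivity
    rw [← hhalf]
    refine le_trans (measure_mono (t := {w : ℤ → ℝ | η * j ≤ |(∑ i ∈ I, w i ^ 2) - (j : ℝ)|} ∪
      {w | η * j ≤ |linComb I s id w|}) fun w hw => ?_)
      ((measure_union_le _ _).trans (add_le_add hcheb hlin))
    simp only [Set.mem_ofPred_eq, not_le, Set.mem_union] at hw ⊢
    have hexpand : ∑ i ∈ I, (w + s) i ^ 2 =
        ∑ i ∈ I, w i ^ 2 + 2 * linComb I s id w + ∑ i ∈ I, s i ^ 2 := by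
      rw [linComb, Finset.mul_sum, ← Finset.sum_add_distrib, ← Finset.sum_add_distrib]
      refine Finset.sum_congr rfl fun i _ => ?_
      simp only [Pi.add_apply, id]
      ring
    rw [hexpand] at hw
    by_contra! hcon
    have h1 := (abs_lt.1 hcon.1).1
    have h2 := (abs_lt.1 hcon.2).1
    linarith
  · rw [← hhalf]
    have h1 : gapSum κ (fun l => ENNReal.ofReal (Real.exp (h * c / 2 * j)) *
        if endpoint 0 l = j then 1 else 0) ≤ ENNReal.ofReal (ε / 2) := by
      rw [gapSum_const_mul]
      refine (mul_le_of_le_one_right zero_le (gapSum_endpoint_le_one hκ j)).trans ?_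
      exact ENNReal.ofReal_le_ofReal hj3
    refine le_trans ?_ (add_le_add (hdens hν hβ.le le_rfl hh hW hj4) h1)
    rw [← gapSum_add]
    refine gapSum_mono fun l => ?_
    by_cases hlj : endpoint 0 l = j
    swap
    · simp [hlj]
    by_cases hlen : c * j ≤ l.length
    swap
    · refine le_trans ?_ le_self_add
      simp [hlj, hlen]
    by_cases hen : e * l.length ≤ energy ρ (supp 0 l)
    · simp [hlj, hlen, hen]
    -- Dense paths of small energy: their weight is at most `exp (h c j / 2)`, and the renewal mass
    -- at the endpoint `j` is at most one.
    · refine le_trans ?_ le_add_self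
      rw [if_pos ⟨hlj, fun h => hen h.2⟩, if_pos hlj, mul_one, mul_one, annealedWeight]
      refine ENNReal.ofReal_le_ofReal (Real.exp_le_exp.2 ?_)
      rw [not_le] at hen
      have h2 : β ^ 2 / 2 * energy ρ (supp 0 l) ≤ β ^ 2 / 2 * (e * l.length) := by gcongr
      have h3 : β ^ 2 / 2 * (e * l.length) = -(h * l.length) / 2 := by
        rw [he]
        field_simp
      have h4 : h * l.length ≤ h * (c * j) := mul_le_mul_of_nonpos_left hlen hneg.le
      linarith

end Events

/-! ### Comparison of the critical points -/

section Conclusion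

variable {Ω Ω' : Type*} [MeasurableSpace Ω] [MeasurableSpace Ω'] {μ : Measure Ω}
  {P : Measure Ω'} [IsProbabilityMeasure P] {α : ℝ} {L : ℝ → ℝ} {K : ℕ → ℝ} {T : ℕ → Ω' → ℕ}
  {q : ℕ} {ρ : ℕ → ℝ} {ω : ℤ → Ω → ℝ} {γ : ℝ}

lemma IsInterarrivalLaw.tsum_rpow_gapWeight_ne_top (hK : IsInterarrivalLaw α L K) (hγ : 0 ≤ γ)
    (hsum : Summable fun t : ℕ => ((t : ℝ) + 1) * K (t + 1) ^ γ) :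
    ∑' t : ℕ, (t + 1) * gapWeight K t ^ γ ≠ ∞ := by
  have e : ∀ t : ℕ, ((t : ℝ≥0∞) + 1) * gapWeight K t ^ γ =
      ENNReal.ofReal (((t : ℝ) + 1) * K (t + 1) ^ γ) := by
    intro t
    rw [ENNReal.ofReal_mul (by positivity), gapWeight,
      ENNReal.ofReal_rpow_of_nonneg (hK.pos t).le hγ, ← Nat.cast_succ, ← Nat.cast_succ,
      ENNReal.ofReal_natCast]
  simp only [e]
  exact hsum.tsum_ofReal_ne_top

lemma tsum_mul_add_one_ne_top {κ : ℕ → ℝ≥0∞} (hκ : ∑' t, κ t = 1) (hγ : γ ≤ 1)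
    (hsum : ∑' t : ℕ, (t + 1) * κ t ^ γ ≠ ∞) : ∑' t : ℕ, κ t * (t + 1) ≠ ∞ := by
  refine ne_top_of_le_ne_top hsum (ENNReal.tsum_le_tsum fun t => ?_)
  rw [mul_comm]
  refine mul_le_mul_right ?_ _
  have h1 : κ t ≤ 1 := hκ ▸ ENNReal.le_tsum t
  simpa using ENNReal.rpow_le_rpow_of_exponent_ge h1 hγ

lemma mem_quenchedDelocalized (hT : IsInterarrivalSequence P K T) (hK : IsInterarrivalLaw α L K)
    (hω : IsFiniteRangeGaussianDisorder μ q ρ ω) {β h : ℝ} (hγ : 0 < γ)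
    (H : ∃ D : ℝ≥0∞, D ≠ ∞ ∧ ∀ N,
      fracMoment (μ.map fun y i => ω i y) (gapWeight K) β h γ N ≤ D) :
    h ∈ quenchedDelocalized μ P ω T β := by
  obtain ⟨D, hD, hle⟩ := H
  exact hasQuenchedFreeEnergy_of_map hT hK hω
    (hasQuenchedFreeEnergy_of_lintegral_rpow_le hT hK hω.isDisorderLaw_map hγ hD hle)

/-- The first moment is already bounded at the annealed critical point, so the fractional moment
bound applies with exponent one. This shows that the quenched set is nonempty and that `h_c ≥
h_c^a`. -/
lemma mem_quenchedDelocalized_of_isCriticalWeight (hT : IsInterarrivalSequence P K T)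
    (hK : IsInterarrivalLaw α L K) (hω : IsFiniteRangeGaussianDisorder μ q ρ ω) {β h : ℝ}
    (hW : IsCriticalWeight (gapWeight K) (glueConst q β) (annealedWeight ρ β h)) :
    h ∈ quenchedDelocalized μ P ω T β := by
  refine mem_quenchedDelocalized hT hK hω one_pos
    ⟨glueConst q β ^ 3, ENNReal.pow_ne_top (glueConst_ne_top q β), fun N => ?_⟩
  refine (fracMoment_le hω.isDisorderLaw_map zero_le_one le_rfl β h N).trans ?_
  rw [ENNReal.rpow_one]
  exact hW.annealedPinned_le N

lemma bddAbove_quenchedDelocalized (hT : IsInterarrivalSequence P K T)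
    (hK : IsInterarrivalLaw α L K) (hω : IsFiniteRangeGaussianDisorder μ q ρ ω) (β : ℝ) :
    BddAbove (quenchedDelocalized μ P ω T β) :=
  ⟨_, fun _ hh => le_neg_log_of_mem_quenchedDelocalized hT hK hω hh⟩

end Conclusion

end PinningModel

theorem theorem2p4
    {Ω Ω' : Type*} [MeasurableSpace Ω] [MeasurableSpace Ω']
    (μ : Measure Ω) [IsProbabilityMeasure μ] (P : Measure Ω') [IsProbabilityMeasure P]
    (α : ℝ) (hα : 1 < α) (L : ℝ → ℝ) (K : ℕ → ℝ) (hK : PinningModel.IsInterarrivalLaw α L K)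
    (T : ℕ → Ω' → ℕ) (hT : PinningModel.IsInterarrivalSequence P K T)
    (q : ℕ) (hq : 1 ≤ q) (ρ : ℕ → ℝ) (ω : ℤ → Ω → ℝ)
    (hω : PinningModel.IsFiniteRangeGaussianDisorder μ q ρ ω) :
    -- both critical points are genuine suprema, of nonempty sets that are bounded above
    (∀ β : ℝ, 0 ≤ β →
      IsLUB (PinningModel.quenchedDelocalized μ P ω T β)
        (PinningModel.criticalPoint μ P ω T β) ∧
      IsLUB (PinningModel.annealedDelocalized μ P ω T β)
        (PinningModel.annealedCriticalPoint μ P ω T β)) ∧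
    (0 < 1 + 2 * ∑ k ∈ Finset.Icc 1 q, ρ k →
      ∃ a : ℝ, 0 < a ∧ ∀ β : ℝ, 0 ≤ β → β ≤ 1 →
        PinningModel.annealedCriticalPoint μ P ω T β + a * β ^ 2 ≤
          PinningModel.criticalPoint μ P ω T β) ∧
    (∀ β : ℝ, 0 < β →
      PinningModel.annealedCriticalPoint μ P ω T β < PinningModel.criticalPoint μ P ω T β) := by
  open PinningModel in
  have hν := hω.isDisorderLaw_map
  have hκ := hK.tsum_gapWeight
  obtain ⟨γ, hγ0, hγ1, hγ⟩ := hK.exists_summable_rpow hα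
  have hsum := hK.tsum_rpow_gapWeight_ne_top hγ0.le hγ
  have hmean := tsum_mul_add_one_ne_top hκ hγ1.le hsum
  choose h hh hW using exists_isCriticalWeight hν hκ
  have hann : ∀ β, annealedCriticalPoint μ P ω T β = h β := fun β =>
    annealedCriticalPoint_eq hT hK hω (hW β)
  have hbdd := bddAbove_quenchedDelocalized hT hK hω
  have hmem : ∀ β, h β ∈ quenchedDelocalized μ P ω T β := fun β =>
    mem_quenchedDelocalized_of_isCriticalWeight hT hK hω (hW β)
  refine ⟨fun β _ => ⟨isLUB_csSup ⟨_, hmem β⟩ (hbdd β), ?_⟩, fun hσ => ?_, fun β hβ => ?_⟩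
  · rw [hann]
    exact isLUB_annealedDelocalized hT hK hω (hW β)
  · obtain ⟨a, ha, hgap⟩ := exists_quadratic_gap hν hκ hγ0 hγ1 hsum hmean hσ
    refine ⟨a, ha, fun β hβ hβ1 => ?_⟩
    rw [hann]
    -- At `β = 0` the quadratic term vanishes and only the weak inequality between the critical
    -- points is needed.
    rcases hβ.eq_or_lt with rfl | hβ0
    · simpa [criticalPoint] using le_csSup (hbdd 0) (hmem 0)
    obtain ⟨u, hu, H⟩ := hgap β (h β) hβ0 hβ1 (hh β) (hW β)
    have := le_csSup (hbdd β) (mem_quenchedDelocalized hT hK hω hγ0 H)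
    exact le_trans (by linarith) this
  · have hneg := (hW β).neg hν hκ (hK.gapWeight_ne_zero q) hβ
    obtain ⟨u, hu, H⟩ := exists_gap hν hκ hγ0 hγ1 hsum hmean hβ (hh β) hneg (hW β)
    rw [hann]
    have := le_csSup (hbdd β) (mem_quenchedDelocalized hT hK hω hγ0 H)
    exact lt_of_lt_of_le (by linarith) this

end
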